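/- Fix $\kappa>1$, $\beta\in\mathbb R$ and $N_1,N_2\in C^\infty(\mathbb R)$. Consider the lattice of unit masses joined by springs that exert alternately the forces $\kappa r+\beta r^2+r^3N_1(r)$ and $r+r^2+r^3N_2(r)$. Put $$\lambda_\pm(k)=1+\kappa\pm\sqrt{(1-\kappa)^2+4\kappa\cos^2k},\qquad c_\kappa=\sqrt{\tfrac{2\kappa}{1+\kappa}},\qquad c_\epsilon=\sqrt{c_\kappa^2+\epsilon^2},$$ $$\varpi^\epsilon(k)=\frac{\epsilon^2\lambda_-(\epsilon k)}{\lambda_-(\epsilon k)-c_\epsilon^2(\epsilon k)^2}\ (k\ne0),\qquad \varpi^\epsilon(0)=-c_\kappa^2 .$$ Let $J(k)$ be the matrix with columns $d_-(k)\,(2\cos k,\;2\kappa-\lambda_-(k))^{T}$ and $d_+(k)\,(2-\lambda_+(k),\;2\kappa\cos k)^{T}$. These are eigenvectors, for $\lambda_-(k)$ and $\lambda_+(k)$ respectively, of the symbol $\begin{pmatrix}2\kappa&-2\cos k\\-2\kappa\cos k&2\end{pmatrix}$ of the linearized lattice operator. The normalizing factors $d_\pm$ are arbitrary smooth, even, $2\pi$-periodic,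 nowhere vanishing real functions. Let $M_\alpha=\mathrm{diag}(\alpha,1)$. Write $J^\epsilon$, $J_1^\epsilon$, $\lambda_+^\epsilon$, $\varpi^\epsilon$ for the Fourier multipliers (acting on periodic functions of $X\in\mathbb R$) with symbols $J(\epsilon k)$, $J(\epsilon k)^{-1}$, $\lambda_+(\epsilon k)$, $\varpi^\epsilon(k)$. The long-wave lattice system for $\boldsymbol\theta=(\theta_1,\theta_2)$ is $$\theta_1+\varpi^\epsilon\big(B^\epsilon_1+\mathcal Q^\epsilon_1\big)=0,\qquad \epsilon^2c_\epsilon^2\theta_2''+\lambda_+^\epsilon\theta_2+\epsilon^2\lambda_+^\epsilon\big(B^\epsilon_2+\mathcal Q^\epsilon_2\big)=0, \tag{LW}$$ where, with componentwise products and powers and $N(p)=(N_1(p_1),N_2(p_2))$, $$B^\epsilon=J_1^\epsilon M_{\beta/\kappa}\big[(J^\epsilon\boldsymbol\theta)^{2}\big],\qquad \mathcal Q^\epsilon=\epsilon^2J_1^\epsilon M_{1/\kappa}\big[(J^\epsilon\boldsymbol\theta)^{3}N(\epsilon^2J^\epsilon\boldsymbol\theta)\big].$$ Let $\boldsymbol\nu=(0,\cos(\cdot))$,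 and let $H^r_{\mathrm{per}}$ be the Sobolev space of $2\pi$-periodic functions with norm $\|f\|_{H^r_{\mathrm{per}}}^2=\sum_{k\in\mathbb Z}(1+k^2)^r|\hat f(k)|^2$; the norm of a pair in $H^r_{\mathrm{per}}\times H^r_{\mathrm{per}}$ is the sum of the norms of its components. **Theorem.** There are $\epsilon_{\mathrm{per}},a_{\mathrm{per}}>0$ and, for $0<\epsilon<\epsilon_{\mathrm{per}}$ and $|a|\le a_{\mathrm{per}}$, frequencies $\omega_\epsilon>0$, $\omega_\epsilon^a>0$ and pairs $\boldsymbol\psi_\epsilon^a=(\psi_{\epsilon,1}^a,\psi_{\epsilon,2}^a)$ of smooth, even, $2\pi$-periodic real functions, lying in $H^r_{\mathrm{per}}\times H^r_{\mathrm{per}}$ for all $r\ge0$, with $\int_0^{2\pi}\psi_{\epsilon,2}^a(y)\cos y\,dy=0$ (that is, $\boldsymbol\psi_\epsilon^a\perp\boldsymbol\nu$), such that: (i) $a\boldsymbol\varphi_\epsilon^a(X)=a\boldsymbol\nu(\omega_\epsilon^aX)+a\boldsymbol\psi_\epsilon^a(\omega_\epsilon^aX)$ is a smooth $2\pi/\omega_\epsilon^a$-periodic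 (and even) solution of (LW). (ii) $\omega_\epsilon$ is the unique positive number with $c_\epsilon^2(\epsilon\omega_\epsilon)^2=\lambda_+(\epsilon\omega_\epsilon)$. Moreover $\omega_\epsilon^0=\omega_\epsilon$, and $$\frac1\epsilon\cdot\frac{\sqrt{2\kappa}}{\sqrt{c_\kappa^2+\epsilon_{\mathrm{per}}^2}}\le\omega_\epsilon\le\frac1\epsilon\cdot\frac{\sqrt{2+2\kappa}}{c_\kappa}.$$ (iii) $\boldsymbol\psi_\epsilon^0=0$. (iv) For each $r\ge0$ there is $C_r>0$ such that for all $0<\epsilon<\epsilon_{\mathrm{per}}$ and $|a|,|a'|\le a_{\mathrm{per}}$ $$\|\boldsymbol\psi_\epsilon^a\|_{H^r_{\mathrm{per}}\times H^r_{\mathrm{per}}}+|\omega_\epsilon^a-\omega_\epsilon|\le C_r,\qquad \|\boldsymbol\psi_\epsilon^a-\boldsymbol\psi_\epsilon^{a'}\|_{H^r_{\mathrm{per}}\times H^r_{\mathrm{per}}}+|\omega_\epsilon^a-\omega_\epsilon^{a'}|\le C_r|a-a'|.$$ -/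

import Mathlib

open scoped ContDiff

noncomputable section

namespace SpringDimer

/-! ### Dispersion relation of the spring dimer lattice

The lattice has unit masses and springs that exert alternately the forces
`κ r + β r² + r³ N₀(r)` and `r + r² + r³ N₁(r)`.  With relative displacements
`r_j(t) = p₀(j - ct)` (`j` odd), `p₁(j - ct)` (`j` even), Newton's law is
`c² p'' + L (p + M_{β/κ} p^{.2} + M_{1/κ} (p^{.3}.N(p))) = 0`, where `L` is the Fourier multiplier
with the symbol `latticeSymbol` below. -/

/-- The symbol of the linear part of the lattice operator. -/
def latticeSymbol (κ k : ℝ) : Matrix (Fin 2) (Fin 2) ℝ :=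
  !![2 * κ, -2 * Real.cos k; -2 * κ * Real.cos k, 2]

/-- The square root in the dispersion relation. -/
def rho (κ k : ℝ) : ℝ := Real.sqrt ((1 - κ) ^ 2 + 4 * κ * Real.cos k ^ 2)

/-- The lower (acoustic) eigenvalue `λ₋(k)`. -/
def lamMinus (κ k : ℝ) : ℝ := 1 + κ - rho κ k

/-- The upper (optical) eigenvalue `λ₊(k)`. -/
def lamPlus (κ k : ℝ) : ℝ := 1 + κ + rho κ k

/-- The speed of sound `c_κ`. -/
def soundSpeed (κ : ℝ) : ℝ := Real.sqrt (2 * κ / (1 + κ))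

/-- The wave speed `c_ε = √(c_κ² + ε²)`. -/
def waveSpeed (κ ε : ℝ) : ℝ := Real.sqrt (soundSpeed κ ^ 2 + ε ^ 2)

/-- The symbol `ξ_c(k) = -c² k² + λ₊(k)`. -/
def xiSymbol (κ c k : ℝ) : ℝ := -c ^ 2 * k ^ 2 + lamPlus κ k

/-- The symbol `ϖ^ε(k) = ε² λ₋(εk) / (λ₋(εk) - c_ε² (εk)²)`, extended continuously to `k = 0`
(where `λ₋(K) / K² → c_κ²`, so that the value is `-c_κ²`). -/
def varpiSymbol (κ ε k : ℝ) : ℝ :=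
  if k = 0 then -soundSpeed κ ^ 2
  else ε ^ 2 * lamMinus κ (ε * k) / (lamMinus κ (ε * k) - waveSpeed κ ε ^ 2 * (ε * k) ^ 2)

/-- The matrix `J(k)`: its first column is an eigenvector of `latticeSymbol κ k` for `λ₋(k)`, its
second column one for `λ₊(k)`.  The two eigenvectors carry arbitrary scalar factors
`d 0 k`, `d 1 k`. -/
def eigMatrix (κ : ℝ) (d : Fin 2 → ℝ → ℝ) (k : ℝ) : Matrix (Fin 2) (Fin 2) ℝ :=
  !![d 0 k * (2 * Real.cos k), d 1 k * (2 - lamPlus κ k);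
     d 0 k * (2 * κ - lamMinus κ k), d 1 k * (2 * κ * Real.cos k)]

/-- Admissible scalar factors for the eigenvectors: smooth, even, `2π`-periodic, nowhere zero. -/
def IsNormalization (d : Fin 2 → ℝ → ℝ) : Prop :=
  ∀ i, ContDiff ℝ ∞ (d i) ∧ Function.Even (d i) ∧ Function.Periodic (d i) (2 * Real.pi) ∧
    ∀ k, d i k ≠ 0

theorem rho_sq {κ : ℝ} (hκ : 1 < κ) (k : ℝ) :
    rho κ k ^ 2 = (1 - κ) ^ 2 + 4 * κ * Real.cos k ^ 2 :=
  Real.sq_sqrt (by positivity)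

/-- `J(k)` diagonalizes the lattice symbol. -/
theorem latticeSymbol_mul_eigMatrix {κ : ℝ} (hκ : 1 < κ) (d : Fin 2 → ℝ → ℝ) (k : ℝ) :
    latticeSymbol κ k * eigMatrix κ d k
      = eigMatrix κ d k * Matrix.diagonal ![lamMinus κ k, lamPlus κ k] := by
  have h := rho_sq hκ k
  ext i j
  fin_cases i <;> fin_cases j <;>
    simp [latticeSymbol, eigMatrix, Matrix.mul_apply, Matrix.diagonal, lamMinus, lamPlus]
  · ring
  · linear_combination (d 1 k) * h
  · linear_combination (d 0 k) * h
  · ring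

/-- `J(k)` is invertible. -/
theorem det_eigMatrix_ne_zero {κ : ℝ} (hκ : 1 < κ) {d : Fin 2 → ℝ → ℝ} (hd : IsNormalization d)
    (k : ℝ) : (eigMatrix κ d k).det ≠ 0 := by
  have h := rho_sq hκ k
  have h0 := (hd 0).2.2.2 k
  have h1 := (hd 1).2.2.2 k
  have hr : 0 ≤ rho κ k := Real.sqrt_nonneg _
  have e : (eigMatrix κ d k).det
      = d 0 k * d 1 k * (4 * κ * Real.cos k ^ 2 + (κ - 1 + rho κ k) ^ 2) := by
    simp [eigMatrix, Matrix.det_fin_two, lamMinus, lamPlus]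
    ring
  rw [e]
  have : 0 < κ - 1 + rho κ k := by linarith
  positivity

/-! ### Fourier multipliers and Sobolev norms of periodic functions -/

/-- The `k`-th Fourier coefficient of a function of period `2π/w`. -/
def fCoeff (w : ℝ) (f : ℝ → ℝ) (k : ℤ) : ℂ :=
  ((w / (2 * Real.pi) : ℝ) : ℂ) *
    ∫ x in (0 : ℝ)..(2 * Real.pi / w), (f x : ℂ) * Complex.exp (-(Complex.I * (w * k * x : ℝ)))

/-- The Fourier multiplier with symbol `m` on functions of period `2π/w`: the mode
`e^{iwkX}` is multiplied by `m (w k)`.  For a real even symbol and a real function the series is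
real. -/
def perMult (w : ℝ) (m : ℝ → ℝ) (f : ℝ → ℝ) (X : ℝ) : ℝ :=
  (∑' k : ℤ, (m (w * k) : ℂ) * fCoeff w f k * Complex.exp (Complex.I * (w * k * X : ℝ))).re

/-- Matrix-valued Fourier multiplier. -/
def perMatMult (w : ℝ) (m : ℝ → Matrix (Fin 2) (Fin 2) ℝ) (f : Fin 2 → ℝ → ℝ) (i : Fin 2)
    (X : ℝ) : ℝ :=
  ∑ j, perMult w (fun k => m k i j) (f j) X

/-- Membership in the Sobolev space `H^r_per` of `2π`-periodic functions, `r ≥ 0`. -/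
def MemHper (r : ℝ) (f : ℝ → ℝ) : Prop :=
  Function.Periodic f (2 * Real.pi) ∧
    MeasureTheory.MemLp f 2 (MeasureTheory.volume.restrict (Set.Ioc 0 (2 * Real.pi))) ∧
    Summable fun k : ℤ => (1 + (k : ℝ) ^ 2) ^ r * ‖fCoeff 1 f k‖ ^ 2

/-- The norm of `H^r_per`. -/
def hperNorm (r : ℝ) (f : ℝ → ℝ) : ℝ :=
  Real.sqrt (∑' k : ℤ, (1 + (k : ℝ) ^ 2) ^ r * ‖fCoeff 1 f k‖ ^ 2)

/-- The norm of `H^r_per × H^r_per`. -/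
def hperNorm₂ (r : ℝ) (f : Fin 2 → ℝ → ℝ) : ℝ := hperNorm r (f 0) + hperNorm r (f 1)

/-! ### The long wave system

It is obtained from the lattice equation by `p(x) = ε² (J^ε θ)(εx)`, `c = c_ε`.  Here `m^ε` has the
symbol `m(ε·)`.  The functions below are of period `2π/w`. -/

/-- `J^ε θ`. -/
def opJ (κ : ℝ) (d : Fin 2 → ℝ → ℝ) (ε w : ℝ) (θ : Fin 2 → ℝ → ℝ) : Fin 2 → ℝ → ℝ :=
  perMatMult w (fun k => eigMatrix κ d (ε * k)) θ

/-- `J₁^ε θ`, where `J₁ = J⁻¹`. -/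
def opJ₁ (κ : ℝ) (d : Fin 2 → ℝ → ℝ) (ε w : ℝ) (θ : Fin 2 → ℝ → ℝ) : Fin 2 → ℝ → ℝ :=
  perMatMult w (fun k => (eigMatrix κ d (ε * k))⁻¹) θ

/-- `M_α = diag(α, 1)`. -/
def opM (α : ℝ) (θ : Fin 2 → ℝ → ℝ) : Fin 2 → ℝ → ℝ := fun i X => ![α, 1] i * θ i X

/-- The quadratic term `B^ε(θ, η) = J₁^ε M_{β/κ} [(J^ε θ).(J^ε η)]`. -/
def opB (κ β : ℝ) (d : Fin 2 → ℝ → ℝ) (ε w : ℝ) (θ η : Fin 2 → ℝ → ℝ) : Fin 2 → ℝ → ℝ :=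
  opJ₁ κ d ε w (opM (β / κ) fun i X => opJ κ d ε w θ i X * opJ κ d ε w η i X)

/-- The higher order term
`Q^ε(θ, θ, θ) = ε² J₁^ε M_{1/κ} [(J^ε θ)^{.3} . N(ε² J^ε θ)]`. -/
def opQ (κ : ℝ) (N d : Fin 2 → ℝ → ℝ) (ε w : ℝ) (θ : Fin 2 → ℝ → ℝ) : Fin 2 → ℝ → ℝ :=
  fun i X => ε ^ 2 * opJ₁ κ d ε w (opM (1 / κ) fun j Y =>
    opJ κ d ε w θ j Y ^ 3 * N j (ε ^ 2 * opJ κ d ε w θ j Y)) i X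

/-- The long wave operator `Θ_ε(θ)`. -/
def longWave (κ β : ℝ) (N d : Fin 2 → ℝ → ℝ) (ε w : ℝ) (θ : Fin 2 → ℝ → ℝ) :
    Fin 2 → ℝ → ℝ :=
  ![fun X => θ 0 X
      + perMult w (varpiSymbol κ ε) (opB κ β d ε w θ θ 0) X
      + perMult w (varpiSymbol κ ε) (opQ κ N d ε w θ 0) X,
    fun X => ε ^ 2 * waveSpeed κ ε ^ 2 * iteratedDeriv 2 (θ 1) X
      + perMult w (fun k => lamPlus κ (ε * k)) (θ 1) X
      + ε ^ 2 * perMult w (fun k => lamPlus κ (ε * k)) (opB κ β d ε w θ θ 1) X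
      + ε ^ 2 * perMult w (fun k => lamPlus κ (ε * k)) (opQ κ N d ε w θ 1) X]

/-- `θ` is a smooth solution, of period `2π/w`, of the long wave system `Θ_ε(θ) = 0`. -/
def IsPeriodicSolution (κ β : ℝ) (N d : Fin 2 → ℝ → ℝ) (ε w : ℝ) (θ : Fin 2 → ℝ → ℝ) : Prop :=
  (∀ i, ContDiff ℝ ∞ (θ i) ∧ Function.Periodic (θ i) (2 * Real.pi / w)) ∧
    ∀ i X, longWave κ β N d ε w θ i X = 0

/-- `ν = cos(·) j` with `j = (0, 1)`. -/
def nu : Fin 2 → ℝ → ℝ := ![fun _ => 0, Real.cos]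

/-- The profile `φ(X) = ν(om X) + ψ(om X)`. -/
def profile (om : ℝ) (ψ : Fin 2 → ℝ → ℝ) : Fin 2 → ℝ → ℝ :=
  fun i X => nu i (om * X) + ψ i (om * X)

end SpringDimer

end

noncomputable section

namespace SpringDimer

/-! ### Families of functions with weighted `C^n` bounds -/

/-! This is a Lyapunov–Schmidt reduction solved by one contraction that is uniform in `ε`. Seek even
solutions `a(ν + ψ)(ωX)` and put `K = εω`. On the mode `k` every multiplier is evaluated at `K k`,
and `ε` survives only in bounded factors, so uniformity in `ε` amounts to keeping `K` in a fixed
window. Evenness and reality make all Fourier coefficients real, and the system becomes countably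
many scalar equations.

The acoustic equations are already solved for the first component. The optical equation at mode `k`
is divided by `ξ(Kk)`, `ξ(K) = λ₊(K) - c_ε² K²`, except at `k = ±1`, where `ψ` is required to
vanish. What remains there is the bifurcation equation `ξ(K) = ε² τ`, with `τ` equal to `a` times a
bounded functional of the profile. On the window `κ + 1 ≤ c_ε² K² ≤ 2κ + 3` there are no other
resonances: `λ₋ ≤ 2 < κ + 1` (`lamMinus_sub_le`), and for `|k| ≥ 2` one has `λ₊ ≤ 2κ + 2 < 4(κ + 1)`
(`xiSymbol_le`). Moreover `ξ` is expanding there (`abs_sub_le_xiSymbol_sub`), so `K` is a Lipschitz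
function of `τ`. After division by `a` the whole problem reads `z = a Φ(z)` for `z = (ψ, τ)`.

The difficulty is that `K` is unknown: varying `K` in a symbol at `K k` costs a factor `k`, that is,
one derivative. The smoothing of order 2 of the inverted linear part pays for it. Coefficients are
measured in weighted `ℓ¹` (`WBound`), where a profile lies in `C^n`; nonlinear forces are estimated
in `C^n` (`CBound`); Parseval returns weighted `ℓ²` (`LBound`), and an order -2 symbol followed by
Cauchy–Schwarz regains `ℓ¹` with one weight more (`LBound.symbol_mul`). Hence differences of
responses are controlled at level `n + 1` by differences of profiles at level `n` together with
bounds at level `n + 1` (`WBound.response_sub`). Thus `Φ` is bounded and Lipschitz on the unit ball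
with a constant `C` independent of `ε` (`responseMap_bounds`), and `a Φ` is a contraction for `|a| ≤
1/(2C)`.

Feeding the solution back into its equation gains one weight each time, which gives smoothness and
all Sobolev bounds on the same range of `ε` and `a` (`exists_smooth_coeffSolution`). -/

/-- The family `f` of `C^n` functions satisfies `|f i ^ (j)| ≤ C * w i` for `j ≤ n`, with `C`
independent of the index `i`. -/
def CBound {ι : Type*} : ℕ → (ι → ℝ) → (ι → ℝ → ℝ) → Prop
  | 0, w, f => (∀ i, Continuous (f i)) ∧ ∃ C, ∀ i y, |f i y| ≤ C * w i
  | n + 1, w, f => ((∀ i, Continuous (f i)) ∧ ∃ C, ∀ i y, |f i y| ≤ C * w i) ∧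
      (∀ i, Differentiable ℝ (f i)) ∧ CBound n w (fun i => deriv (f i))

namespace CBound

variable {ι : Type*} {n : ℕ} {w w₁ w₂ : ι → ℝ} {f g : ι → ℝ → ℝ}

theorem zero (h : CBound n w f) : CBound 0 w f := by
  cases n with
  | zero => exact h
  | succ n => exact h.1

theorem continuous (h : CBound n w f) (i : ι) : Continuous (f i) := h.zero.1 i

theorem bound (h : CBound n w f) : ∃ C, ∀ i y, |f i y| ≤ C * w i := h.zero.2

theorem of_succ (h : CBound (n + 1) w f) : CBound n w f := by
  induction n generalizing f with
  | zero => exact h.1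
  | succ n ih => exact ⟨h.1, h.2.1, ih h.2.2⟩

theorem add (hf : CBound n w f) (hg : CBound n w g) : CBound n w (fun i y => f i y + g i y) := by
  have base : ∀ {f g : ι → ℝ → ℝ}, CBound 0 w f → CBound 0 w g →
      CBound 0 w (fun i y => f i y + g i y) := by
    rintro f g ⟨hf, C, hC⟩ ⟨hg, D, hD⟩
    refine ⟨fun i => (hf i).add (hg i), C + D, fun i y => ?_⟩
    calc |f i y + g i y| ≤ |f i y| + |g i y| := abs_add_le _ _
      _ ≤ (C + D) * w i := by linarith [hC i y, hD i y]
  induction n generalizing f g with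
  | zero => exact base hf hg
  | succ n ih =>
    refine ⟨base hf.zero hg.zero, fun i => (hf.2.1 i).add (hg.2.1 i), ?_⟩
    convert ih hf.2.2 hg.2.2 using 3 with i y
    exact deriv_fun_add (hf.2.1 i _) (hg.2.1 i _)

theorem mul (hf : CBound n w₁ f) (hg : CBound n w₂ g) (hw : ∀ i, w₁ i * w₂ i = w i) :
    CBound n w (fun i y => f i y * g i y) := by
  have base : ∀ {f g : ι → ℝ → ℝ}, CBound 0 w₁ f → CBound 0 w₂ g →
      CBound 0 w (fun i y => f i y * g i y) := by
    rintro f g ⟨hf, C, hC⟩ ⟨hg, D, hD⟩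
    refine ⟨fun i => (hf i).mul (hg i), C * D, fun i y => ?_⟩
    calc |f i y * g i y| = |f i y| * |g i y| := abs_mul _ _
      _ ≤ (C * w₁ i) * (D * w₂ i) :=
        mul_le_mul (hC i y) (hD i y) (abs_nonneg _) ((abs_nonneg _).trans (hC i y))
      _ = C * D * w i := by rw [← hw]; ring
  induction n generalizing f g with
  | zero => exact base hf hg
  | succ n ih =>
    refine ⟨base hf.zero hg.zero, fun i => (hf.2.1 i).mul (hg.2.1 i), ?_⟩
    convert add (ih hf.2.2 hg.of_succ) (ih hf.of_succ hg.2.2) using 3 with i y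
    exact deriv_fun_mul (hf.2.1 i _) (hg.2.1 i _)

theorem const {c : ι → ℝ} (hc : ∃ C, ∀ i, |c i| ≤ C * w i) : CBound n w (fun i _ => c i) := by
  obtain ⟨C, hC⟩ := hc
  have hw : ∀ i, 0 ≤ C * w i := fun i => (abs_nonneg _).trans (hC i)
  have key : ∀ c : ι → ℝ, (∀ i, |c i| ≤ C * w i) → CBound n w (fun i _ => c i) := by
    induction n with
    | zero => exact fun c hc => ⟨fun i => continuous_const, C, fun i _ => hc i⟩
    | succ n ih =>
      intro c hc
      refine ⟨⟨fun i => continuous_const, C, fun i _ => hc i⟩,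
        fun i => differentiable_const _, ?_⟩
      convert ih (fun _ => 0) (by simpa using hw) using 3
      simp
  exact key c hC

/-- With weight 1 all values of the family lie in one compact interval, on which `H` and each of its
derivatives are bounded; hence the constant is uniform in the index. -/
theorem comp {H : ℝ → ℝ} (hH : ContDiff ℝ ∞ H) (hf : CBound n (fun _ => 1) f) :
    CBound n (fun _ => 1) (fun i y => H (f i y)) := by
  have base : ∀ {H : ℝ → ℝ}, ContDiff ℝ ∞ H → CBound 0 (fun _ => 1) f →
      CBound 0 (fun _ => 1) (fun i y => H (f i y)) := by
    rintro H hH ⟨hf, C, hC⟩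
    obtain ⟨B, hB⟩ := (isCompact_Icc (a := -C) (b := C)).exists_bound_of_continuousOn
      hH.continuous.continuousOn
    refine ⟨fun i => hH.continuous.comp (hf i), B, fun i y => ?_⟩
    rw [mul_one]
    exact hB _ (abs_le.1 (by simpa using hC i y))
  induction n generalizing H with
  | zero => exact base hH hf
  | succ n ih =>
    have hH' := contDiff_infty_iff_deriv.1 hH
    refine ⟨base hH hf.zero, fun i => hH'.1.comp (hf.2.1 i), ?_⟩
    convert mul (w := fun _ => 1) (ih hH'.2 hf.of_succ) hf.2.2 (by simp) using 3 with i y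
    exact deriv_comp y (hH'.1 _) (hf.2.1 i y)

/-- The mean value theorem on a common compact interval gives the sup bound; higher orders follow
from `H'(f) f' - H'(g) g' = H'(f)(f' - g') + (H'(f) - H'(g)) g'` and induction applied to `H'`. -/
theorem comp_sub {H : ℝ → ℝ} (hH : ContDiff ℝ ∞ H) (hf : CBound n (fun _ => 1) f)
    (hg : CBound n (fun _ => 1) g) (hfg : CBound n w (fun i y => f i y - g i y)) :
    CBound n w (fun i y => H (f i y) - H (g i y)) := by
  have base : ∀ {H : ℝ → ℝ}, ContDiff ℝ ∞ H → CBound 0 (fun _ => 1) f → CBound 0 (fun _ => 1) g →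
      CBound 0 w (fun i y => f i y - g i y) → CBound 0 w (fun i y => H (f i y) - H (g i y)) := by
    rintro H hH ⟨hf, C, hC⟩ ⟨hg, D, hD⟩ ⟨-, E, hE⟩
    obtain ⟨B, hB⟩ := (isCompact_Icc (a := -max C D) (b := max C D)).exists_bound_of_continuousOn
      (contDiff_infty_iff_deriv.1 hH).2.continuous.continuousOn
    refine ⟨fun i => (hH.continuous.comp (hf i)).sub (hH.continuous.comp (hg i)), |B| * E,
      fun i y => ?_⟩
    have h := (convex_Icc (-max C D) (max C D)).norm_image_sub_le_of_norm_deriv_le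
      (fun x _ => (contDiff_infty_iff_deriv.1 hH).1 x) (fun x hx => (hB x hx).trans (le_abs_self B))
      (abs_le.1 ((show |g i y| ≤ D by simpa using hD i y).trans (le_max_right C D)))
      (abs_le.1 ((show |f i y| ≤ C by simpa using hC i y).trans (le_max_left C D)))
    calc |H (f i y) - H (g i y)| ≤ |B| * |f i y - g i y| := h
      _ ≤ |B| * (E * w i) := mul_le_mul_of_nonneg_left (hE i y) (abs_nonneg _)
      _ = |B| * E * w i := by ring
  induction n generalizing H with
  | zero => exact base hH hf hg hfg
  | succ n ih =>
    have hH' := contDiff_infty_iff_deriv.1 hH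
    refine ⟨base hH hf.zero hg.zero hfg.zero,
      fun i => (hH'.1.comp (hf.2.1 i)).sub (hH'.1.comp (hg.2.1 i)), ?_⟩
    have hd : CBound n w (fun i y => deriv (f i) y - deriv (g i) y) := by
      convert hfg.2.2 using 3 with i y
      exact (deriv_fun_sub (hf.2.1 i y) (hg.2.1 i y)).symm
    convert add (mul (w := w) (comp hH'.2 hf.of_succ) hd (by simp))
      (mul (w₁ := w) (w₂ := fun _ => 1) (ih hH'.2 hf.of_succ hg.of_succ hfg.of_succ) hg.2.2
        (by simp)) using 3 with i y
    have e := ((hH'.1 (f i y)).hasDerivAt.comp y (hf.2.1 i y).hasDerivAt).sub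
      ((hH'.1 (g i y)).hasDerivAt.comp y (hg.2.1 i y).hasDerivAt)
    refine e.deriv.trans ?_
    ring

theorem contDiff (h : ∀ n, CBound n w f) (i : ι) : ContDiff ℝ ∞ (f i) := by
  have key : ∀ n : ℕ, ∀ f : ι → ℝ → ℝ, CBound n w f → ContDiff ℝ n (f i) := by
    intro n
    induction n with
    | zero => exact fun f hf => contDiff_zero.2 (hf.1 i)
    | succ n ih =>
      intro f hf
      rw [Nat.cast_succ, contDiff_succ_iff_deriv]
      exact ⟨hf.2.1 i, by simp, ih _ hf.2.2⟩
  exact contDiff_infty.2 fun n => key n f (h n)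

end CBound

/-! ### Weighted summable families of coefficients -/

/-- The weight `1 + |k|` on the integers. -/
def wt (k : ℤ) : ℝ := 1 + |(k : ℝ)|

theorem one_le_wt (k : ℤ) : 1 ≤ wt k := le_add_of_nonneg_right (abs_nonneg _)

theorem wt_pos (k : ℤ) : 0 < wt k := one_pos.trans_le (one_le_wt k)

theorem abs_le_wt (k : ℤ) : |(k : ℝ)| ≤ wt k := le_add_of_nonneg_left zero_le_one

/-- Families of coefficients with `∑ (1 + |k|) ^ n |x i k| ≤ C * w i`. -/
def WBound {ι : Type*} (n : ℕ) (w : ι → ℝ) (x : ι → ℤ → ℝ) : Prop :=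
  ∃ C, ∀ i, Summable (fun k => wt k ^ n * |x i k|) ∧ ∑' k, wt k ^ n * |x i k| ≤ C * w i

/-- Families of coefficients with `∑ ((1 + |k|) ^ n |x i k|) ^ 2 ≤ (C * w i) ^ 2`. -/
def LBound {ι : Type*} (n : ℕ) (w : ι → ℝ) (x : ι → ℤ → ℝ) : Prop :=
  ∃ C, ∀ i, 0 ≤ C * w i ∧ Summable (fun k => (wt k ^ n * x i k) ^ 2) ∧
    ∑' k, (wt k ^ n * x i k) ^ 2 ≤ (C * w i) ^ 2

/-- Families of symbols with `|S i k| ≤ C * w i * g k`. -/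
def SBound {ι : Type*} (g : ℤ → ℝ) (w : ι → ℝ) (S : ι → ℤ → ℝ) : Prop :=
  ∃ C, ∀ i k, |S i k| ≤ C * w i * g k

section

variable {ι : Type*} {n : ℕ} {w w₁ w₂ : ι → ℝ} {x y : ι → ℤ → ℝ}

namespace WBound

theorem of_le (hx : ∃ C, ∀ i, ∃ v : ℤ → ℝ, Summable v ∧ (∀ k, wt k ^ n * |x i k| ≤ v k) ∧
    ∑' k, v k ≤ C * w i) : WBound n w x := by
  obtain ⟨C, hC⟩ := hx
  refine ⟨C, fun i => ?_⟩
  obtain ⟨v, hv, hle, hs⟩ := hC i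
  have h0 : ∀ k, 0 ≤ wt k ^ n * |x i k| := fun k =>
    mul_nonneg (pow_nonneg (wt_pos k).le _) (abs_nonneg _)
  have hsum := Summable.of_nonneg_of_le h0 hle hv
  exact ⟨hsum, (hsum.tsum_le_tsum hle hv).trans hs⟩

theorem summable (h : WBound n w x) (i : ι) : Summable (fun k => wt k ^ n * |x i k|) :=
  (h.choose_spec i).1

theorem mono {m : ℕ} (h : WBound n w x) (hmn : m ≤ n) : WBound m w x := by
  obtain ⟨C, hC⟩ := h
  refine of_le ⟨C, fun i => ⟨_, (hC i).1, fun k => ?_, (hC i).2⟩⟩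
  exact mul_le_mul_of_nonneg_right (pow_le_pow_right₀ (one_le_wt k) hmn) (abs_nonneg _)

theorem summable_abs (h : WBound n w x) (i : ι) : Summable (fun k => |x i k|) := by
  simpa using (h.mono (Nat.zero_le n)).summable i

theorem comap {ι' : Type*} (e : ι' → ι) (h : WBound n w x) :
    WBound n (fun i => w (e i)) (fun i => x (e i)) :=
  h.imp fun _ hC i => hC (e i)

theorem add (hx : WBound n w x) (hy : WBound n w y) :
    WBound n w (fun i k => x i k + y i k) := by
  obtain ⟨C, hC⟩ := hx
  obtain ⟨D, hD⟩ := hy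
  refine of_le ⟨C + D, fun i => ⟨_, (hC i).1.add (hD i).1, fun k => ?_, ?_⟩⟩
  · rw [← mul_add]
    exact mul_le_mul_of_nonneg_left (abs_add_le _ _) (pow_nonneg (wt_pos k).le _)
  · rw [(hC i).1.tsum_add (hD i).1, add_mul]
    exact add_le_add (hC i).2 (hD i).2

theorem symbol_mul {p : ℕ} {S : ι → ℤ → ℝ} (hS : SBound (fun k => wt k ^ p) w₁ S)
    (hx : WBound (n + p) w₂ x) (hw : ∀ i, w₁ i * w₂ i = w i) :
    WBound n w (fun i k => S i k * x i k) := by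
  obtain ⟨C, hC⟩ := hS
  obtain ⟨D, hD⟩ := hx
  -- The weight at `k = 0` is 1, so the symbol bound at that mode yields the sign of the constant.
  have h0 : ∀ i, 0 ≤ C * w₁ i := fun i => by
    simpa [wt] using (abs_nonneg _).trans (hC i 0)
  refine of_le ⟨C * D, fun i => ⟨_, (hD i).1.mul_left (C * w₁ i), fun k => ?_, ?_⟩⟩
  · rw [abs_mul]
    calc wt k ^ n * (|S i k| * |x i k|) ≤ wt k ^ n * ((C * w₁ i * wt k ^ p) * |x i k|) := by
          gcongr
          · exact pow_nonneg (wt_pos k).le _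
          · exact hC i k
      _ = C * w₁ i * (wt k ^ (n + p) * |x i k|) := by rw [pow_add]; ring
  · rw [tsum_mul_left]
    calc C * w₁ i * ∑' k, wt k ^ (n + p) * |x i k| ≤ C * w₁ i * (D * w₂ i) :=
          mul_le_mul_of_nonneg_left (hD i).2 (h0 i)
      _ = C * D * w i := by rw [← hw]; ring

theorem const_mul {c : ι → ℝ} (hc : ∃ C, ∀ i, |c i| ≤ C * w₁ i) (hx : WBound n w₂ x)
    (hw : ∀ i, w₁ i * w₂ i = w i) : WBound n w (fun i k => c i * x i k) :=
  symbol_mul (p := 0) (S := fun i _ => c i) (hc.imp fun C hC i k => by simpa using hC i) hx hw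

end WBound

/-! ### Trigonometric series -/

/-- The trigonometric series `∑ x k cos (k y + θ)`. -/
def trigSeries (x : ℤ → ℝ) (θ y : ℝ) : ℝ := ∑' k : ℤ, x k * Real.cos (k * y + θ)

theorem abs_trig_term_le (x : ℤ → ℝ) (θ y : ℝ) (k : ℤ) : |x k * Real.cos (k * y + θ)| ≤ |x k| := by
  rw [abs_mul]
  exact mul_le_of_le_one_right (abs_nonneg _) (Real.abs_cos_le_one _)

theorem summable_trig {x : ℤ → ℝ} (hx : Summable fun k => |x k|) (θ y : ℝ) :
    Summable fun k : ℤ => x k * Real.cos (k * y + θ) :=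
  Summable.of_norm_bounded hx fun k => abs_trig_term_le x θ y k

theorem continuous_trigSeries {x : ℤ → ℝ} (hx : Summable fun k => |x k|) (θ : ℝ) :
    Continuous (trigSeries x θ) :=
  continuous_tsum (fun k => by fun_prop) hx fun k y => abs_trig_term_le x θ y k

theorem abs_trigSeries_le {x : ℤ → ℝ} (hx : Summable fun k => |x k|) (θ y : ℝ) :
    |trigSeries x θ y| ≤ ∑' k, |x k| :=
  tsum_of_norm_bounded (f := fun k : ℤ => x k * Real.cos (k * y + θ)) hx.hasSum
    fun k => abs_trig_term_le x θ y k

/-- The phase is what closes this class under differentiation: `-sin` is `cos` shifted by `π/2`, so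
induction on the order never leaves cosine series. -/
theorem hasDerivAt_trigSeries {x : ℤ → ℝ} (hx : Summable fun k => wt k * |x k|) (θ y : ℝ) :
    HasDerivAt (trigSeries x θ)
      (trigSeries (fun k => k * x k) (θ + Real.pi / 2) y) y := by
  have hx0 : Summable fun k => |x k| := Summable.of_nonneg_of_le (fun k => abs_nonneg _)
    (fun k => le_mul_of_one_le_left (abs_nonneg _) (one_le_wt k)) hx
  refine hasDerivAt_tsum (u := fun k => wt k * |x k|)
    (g := fun (k : ℤ) y => x k * Real.cos (k * y + θ)) (g' := fun k y => k * x k * Real.cos (k * y + (θ + Real.pi / 2))) hx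
    (fun k y => ?_) (fun k y => ?_) (y₀ := 0) (summable_trig hx0 θ 0) y
  · have h := (((hasDerivAt_id y).const_mul (k : ℝ)).add_const θ).cos.const_mul (x k)
    refine h.congr_deriv ?_
    simp only [id]
    rw [← add_assoc, Real.cos_add_pi_div_two]
    ring
  · refine (abs_trig_term_le (fun k => k * x k) _ y k).trans ?_
    rw [abs_mul]
    exact mul_le_mul_of_nonneg_right (abs_le_wt k) (abs_nonneg _)

theorem WBound.trigSeries (hx : WBound n w x) (θ : ℝ) :
    CBound n w (fun i => trigSeries (x i) θ) := by
  have base : ∀ {n : ℕ} {x : ι → ℤ → ℝ}, WBound n w x → ∀ θ,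
      CBound 0 w (fun i => SpringDimer.trigSeries (x i) θ) := by
    intro n x hx θ
    obtain ⟨C, hC⟩ := hx.mono (Nat.zero_le n)
    simp only [pow_zero, one_mul] at hC
    exact ⟨fun i => continuous_trigSeries (hC i).1 θ, C,
      fun i y => (abs_trigSeries_le (hC i).1 θ y).trans (hC i).2⟩
  induction n generalizing x θ with
  | zero => exact base hx θ
  | succ n ih =>
    have hd := fun (i : ι) (y : ℝ) => hasDerivAt_trigSeries
      (by simpa using (hx.mono (Nat.le_add_left 1 n)).summable i) θ y
    refine ⟨base hx θ, fun i y => (hd i y).differentiableAt, ?_⟩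
    have hk : WBound n w (fun i k => k * x i k) :=
      WBound.symbol_mul (p := 1) (w₁ := fun _ => 1) (S := fun _ k => k)
        ⟨1, fun i k => by simpa using abs_le_wt k⟩ hx (by simp)
    have e : (fun i => deriv (SpringDimer.trigSeries (x i) θ)) =
        fun i => SpringDimer.trigSeries (fun k => k * x i k) (θ + Real.pi / 2) :=
      funext fun i => funext fun y => (hd i y).deriv
    rw [e]
    exact ih hk (θ + Real.pi / 2)

/-! ### Symbols of order `-2` -/

theorem summable_wt_inv_sq : Summable fun k : ℤ => ((wt k)⁻¹) ^ 2 := by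
  have h : Summable fun k : ℤ => ((k : ℝ) ^ 2)⁻¹ := by
    simpa using Real.summable_one_div_int_pow.2 (one_lt_two)
  refine Summable.of_norm_bounded_eventually h ?_
  filter_upwards [(Set.finite_singleton (0 : ℤ)).compl_mem_cofinite] with k hk
  have hk' : (k : ℝ) ≠ 0 := by simpa using hk
  rw [Real.norm_of_nonneg (by positivity), inv_pow]
  have : (k : ℝ) ^ 2 ≤ wt k ^ 2 := by
    rw [← sq_abs]
    exact pow_le_pow_left₀ (abs_nonneg _) (abs_le_wt k) 2
  gcongr

/-- Of the two inverse weights, one is paired with the `ℓ²` coefficients by Cauchy–Schwarz, since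
`wt⁻¹` is square summable; the other remains as a gain of one order. -/
theorem LBound.symbol_mul {S : ι → ℤ → ℝ} (hS : SBound (fun k => ((wt k)⁻¹) ^ 2) w₁ S)
    (hx : LBound n w₂ x) (hw : ∀ i, w₁ i * w₂ i = w i) :
    WBound (n + 1) w (fun i k => S i k * x i k) := by
  obtain ⟨C, hC⟩ := hS
  obtain ⟨D, hD⟩ := hx
  have h0 : ∀ i, 0 ≤ C * w₁ i := fun i => by
    simpa [wt] using (abs_nonneg _).trans (hC i 0)
  set E : ℝ := Real.sqrt (∑' k : ℤ, ((wt k)⁻¹) ^ 2)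
  refine WBound.of_le ⟨C * (E * D), fun i => ?_⟩
  obtain ⟨hD0, hDs, hD⟩ := hD i
  have hDs' : Summable fun k => |wt k ^ n * x i k| ^ (2 : ℝ) := by
    simpa only [Real.rpow_two, sq_abs] using hDs
  have hE' : Summable fun k : ℤ => ((wt k)⁻¹) ^ (2 : ℝ) := by
    simpa only [Real.rpow_two] using summable_wt_inv_sq
  have hcs := Real.summable_and_inner_le_Lp_mul_Lq_tsum_of_nonneg (p := 2) (q := 2) .two_two (f := fun k => (wt k)⁻¹)
    (g := fun k => |wt k ^ n * x i k|) (fun k => (inv_pos.2 (wt_pos k)).le)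
    (fun k => abs_nonneg _) hE' hDs'
  refine ⟨_, hcs.1.mul_left (C * w₁ i), fun k => ?_, ?_⟩
  · rw [abs_mul, abs_mul, abs_of_pos (pow_pos (wt_pos k) n)]
    have := hC i k
    have hk := wt_pos k
    calc wt k ^ (n + 1) * (|S i k| * |x i k|)
        ≤ wt k ^ (n + 1) * ((C * w₁ i * ((wt k)⁻¹) ^ 2) * |x i k|) := by gcongr
      _ = C * w₁ i * ((wt k)⁻¹ * (wt k ^ n * |x i k|)) := by
          field_simp
          ring
  · rw [tsum_mul_left]
    have h2 : ∑' k, (wt k)⁻¹ * |wt k ^ n * x i k| ≤ E * (D * w₂ i) := by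
      refine hcs.2.trans ?_
      simp only [Real.rpow_two, ← Real.sqrt_eq_rpow, sq_abs]
      exact mul_le_mul_of_nonneg_left ((Real.sqrt_le_left hD0).2 hD) (Real.sqrt_nonneg _)
    calc C * w₁ i * _ ≤ C * w₁ i * (E * (D * w₂ i)) := mul_le_mul_of_nonneg_left h2 (h0 i)
      _ = C * (E * D) * w i := by rw [← hw]; ring

end

/-! ### Fourier coefficients of `2π`-periodic functions -/

theorem fourier_two_pi_apply (k : ℤ) (x : ℝ) :
    fourier (T := 2 * Real.pi - 0) (-k) (x : AddCircle (2 * Real.pi - 0))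
      = Complex.exp (-(Complex.I * (1 * k * x : ℝ))) := by
  rw [fourier_coe_apply]
  congr 1
  have := Real.pi_ne_zero
  push_cast
  rw [sub_zero]
  field_simp

theorem fCoeff_one_eq (f : ℝ → ℝ) (k : ℤ) :
    fCoeff 1 f k = fourierCoeffOn Real.two_pi_pos (fun x => (f x : ℂ)) k := by
  rw [fourierCoeffOn_eq_integral, fCoeff, div_one]
  simp only [fourier_two_pi_apply, smul_eq_mul, Complex.real_smul, sub_zero]
  congr 1
  exact intervalIntegral.integral_congr fun x _ => mul_comm _ _

theorem memLp_two_of_continuous {f : ℝ → ℝ} (hf : Continuous f) :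
    MeasureTheory.MemLp f 2 (MeasureTheory.volume.restrict (Set.Ioc 0 (2 * Real.pi))) := by
  obtain ⟨C, hC⟩ := (isCompact_Icc (a := 0) (b := 2 * Real.pi)).exists_bound_of_continuousOn
    hf.continuousOn
  refine MeasureTheory.MemLp.of_bound hf.aestronglyMeasurable C ?_
  filter_upwards [MeasureTheory.self_mem_ae_restrict measurableSet_Ioc] with x hx
  exact hC x (Set.Ioc_subset_Icc_self hx)

/-- Parseval's identity, with the mean square bounded by the square of the supremum. Working in `ℓ²`
at this point costs no derivative. -/
theorem fCoeff_sq_bound {f : ℝ → ℝ} (hf : Continuous f) {C : ℝ} (hC : ∀ y, |f y| ≤ C) :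
    Summable (fun k => ‖fCoeff 1 f k‖ ^ 2) ∧ ∑' k, ‖fCoeff 1 f k‖ ^ 2 ≤ C ^ 2 := by
  have h := hasSum_sq_fourierCoeffOn Real.two_pi_pos (f := fun x => (f x : ℂ))
    (memLp_two_of_continuous hf).ofReal
  have h' : HasSum (fun k => ‖fCoeff 1 f k‖ ^ 2)
      ((2 * Real.pi - 0)⁻¹ • ∫ x in (0 : ℝ)..(2 * Real.pi), ‖(f x : ℂ)‖ ^ 2) := by
    simpa only [fCoeff_one_eq] using h
  refine ⟨h'.summable, h'.tsum_eq.trans_le ?_⟩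
  have hle : ∫ x in (0 : ℝ)..(2 * Real.pi), ‖(f x : ℂ)‖ ^ 2
      ≤ ∫ _ in (0 : ℝ)..(2 * Real.pi), C ^ 2 := by
    refine intervalIntegral.integral_mono_on Real.two_pi_pos.le
      (Continuous.intervalIntegrable (by fun_prop) _ _) (by simp) fun x _ => ?_
    rw [Complex.norm_real]
    exact pow_le_pow_left₀ (norm_nonneg _) (hC x) 2
  rw [intervalIntegral.integral_const, smul_eq_mul] at hle
  rw [smul_eq_mul, inv_mul_le_iff₀ (by simpa using Real.pi_pos)]
  exact hle

theorem norm_fCoeff_deriv {f : ℝ → ℝ} (hf : Differentiable ℝ f) (hf' : Continuous (deriv f))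
    (hp : Function.Periodic f (2 * Real.pi)) (k : ℤ) :
    ‖fCoeff 1 (deriv f) k‖ = |(k : ℝ)| * ‖fCoeff 1 f k‖ := by
  have hend : f (2 * Real.pi) = f 0 := by simpa using hp 0
  -- The integration by parts formula divides by `k`, so the mean is treated apart: the derivative
  -- of a periodic function has mean zero.
  rcases eq_or_ne k 0 with rfl | hk
  · have h := intervalIntegral.integral_deriv_eq_sub (a := 0) (b := 2 * Real.pi) (f := f)
      (fun x _ => hf x) (hf'.intervalIntegrable _ _)
    have : ∫ x in (0 : ℝ)..(2 * Real.pi), ((deriv f x : ℝ) : ℂ) = 0 := by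
      rw [intervalIntegral.integral_ofReal, h, hend]
      simp
    simp [fCoeff, this]
  · have h := fourierCoeffOn_of_hasDerivAt Real.two_pi_pos (f := fun x => (f x : ℂ))
      (f' := fun x => ((deriv f x : ℝ) : ℂ)) hk (fun x _ => (hf x).hasDerivAt.ofReal_comp)
      (Continuous.intervalIntegrable (by fun_prop) _ _)
    rw [← fCoeff_one_eq, ← fCoeff_one_eq, hend, sub_self, mul_zero, zero_sub] at h
    have hk' : (k : ℝ) ≠ 0 := by exact_mod_cast hk
    rw [h]
    simp only [norm_mul, norm_neg, norm_div, norm_one, Complex.norm_I, Complex.norm_intCast,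
      Complex.norm_real, Complex.ofReal_zero, sub_zero, Complex.norm_ofNat, mul_one]
    have := Real.pi_pos
    have h2 : ‖Real.pi‖ ≠ 0 := norm_ne_zero_iff.2 this.ne'
    have h3 : |(k : ℝ)| ≠ 0 := by simpa using hk
    field_simp
    norm_num

theorem LBound.of_abs_le {ι : Type*} {n : ℕ} {w : ι → ℝ} {x y : ι → ℤ → ℝ} (hx : LBound n w x)
    (h : ∀ i k, |y i k| ≤ x i k) : LBound n w y := by
  refine hx.imp fun C hC i => ?_
  have hle : ∀ k, (wt k ^ n * y i k) ^ 2 ≤ (wt k ^ n * x i k) ^ 2 := fun k => by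
    rw [mul_pow, mul_pow, ← sq_abs (y i k)]
    have := h i k
    gcongr
  have hs := Summable.of_nonneg_of_le (fun k => sq_nonneg _) hle (hC i).2.1
  exact ⟨(hC i).1, hs, (hs.tsum_le_tsum hle (hC i).2.1).trans (hC i).2.2⟩

theorem CBound.norm_fCoeff {ι : Type*} {n : ℕ} {w : ι → ℝ} {f : ι → ℝ → ℝ} (hf : CBound n w f)
    (hp : ∀ i, Function.Periodic (f i) (2 * Real.pi)) :
    LBound n w (fun i k => ‖fCoeff 1 (f i) k‖) := by
  have base : ∀ {n : ℕ} {f : ι → ℝ → ℝ}, CBound n w f →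
      LBound 0 w (fun i k => ‖fCoeff 1 (f i) k‖) := by
    intro n f hf
    obtain ⟨C, hC⟩ := hf.bound
    refine ⟨C, fun i => ⟨(abs_nonneg _).trans (hC i 0), ?_⟩⟩
    simpa using fCoeff_sq_bound (hf.continuous i) (hC i)
  induction n generalizing f with
  | zero => exact base hf
  | succ n ih =>
    obtain ⟨C, hC⟩ := ih hf.of_succ hp
    obtain ⟨D, hD⟩ := ih hf.2.2 fun i y => by
      rw [← deriv_comp_add_const]
      exact congrArg (fun g => deriv g y) (funext (hp i))
    -- One extra weight `1 + |k|` splits into the coefficient of the function and that of its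
    -- derivative; then `(s + t)² ≤ 2s² + 2t²` and `2C² + 2D² ≤ (2(C + D))²`.
    refine ⟨2 * (C + D), fun i => ?_⟩
    obtain ⟨hC0, hCs, hC⟩ := hC i
    obtain ⟨hD0, hDs, hD⟩ := hD i
    have hle : ∀ k, (wt k ^ (n + 1) * ‖fCoeff 1 (f i) k‖) ^ 2 ≤
        2 * (wt k ^ n * ‖fCoeff 1 (f i) k‖) ^ 2
          + 2 * (wt k ^ n * ‖fCoeff 1 (deriv (f i)) k‖) ^ 2 := fun k => by
      rw [norm_fCoeff_deriv (hf.2.1 i) (hf.2.2.continuous i) (hp i)]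
      have e : wt k ^ (n + 1) * ‖fCoeff 1 (f i) k‖ = wt k ^ n * ‖fCoeff 1 (f i) k‖
          + wt k ^ n * (|(k : ℝ)| * ‖fCoeff 1 (f i) k‖) := by
        simp only [wt]; ring
      rw [e]
      linarith [sq_nonneg (wt k ^ n * ‖fCoeff 1 (f i) k‖
        - wt k ^ n * (|(k : ℝ)| * ‖fCoeff 1 (f i) k‖))]
    have hs' := (hCs.mul_left 2).add (hDs.mul_left 2)
    have hs := Summable.of_nonneg_of_le (fun k => sq_nonneg _) hle hs'
    refine ⟨by linarith, hs, (hs.tsum_le_tsum hle hs').trans ?_⟩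
    rw [(hCs.mul_left 2).tsum_add (hDs.mul_left 2), tsum_mul_left, tsum_mul_left]
    nlinarith [mul_nonneg hC0 hD0]

/-! ### Linearity, scaling and parity of Fourier coefficients -/

theorem fCoeff_one_sub {f g : ℝ → ℝ} (hf : Continuous f) (hg : Continuous g) (k : ℤ) :
    fCoeff 1 (fun y => f y - g y) k = fCoeff 1 f k - fCoeff 1 g k := by
  simp only [fCoeff]
  rw [← mul_sub, ← intervalIntegral.integral_sub]
  · simp [sub_mul]
  all_goals exact Continuous.intervalIntegrable (by fun_prop) _ _

theorem fCoeff_one_add {f g : ℝ → ℝ} (hf : Continuous f) (hg : Continuous g) (k : ℤ) :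
    fCoeff 1 (fun y => f y + g y) k = fCoeff 1 f k + fCoeff 1 g k := by
  simp only [fCoeff]
  rw [← mul_add, ← intervalIntegral.integral_add]
  · simp [add_mul]
  all_goals exact Continuous.intervalIntegrable (by fun_prop) _ _

theorem fCoeff_const_mul (w c : ℝ) (f : ℝ → ℝ) (k : ℤ) :
    fCoeff w (fun y => c * f y) k = c * fCoeff w f k := by
  simp only [fCoeff, Complex.ofReal_mul]
  simp only [mul_assoc (c : ℂ), intervalIntegral.integral_const_mul]
  ring

/-- The coefficients of the rescaled function do not see `w`. The unknown frequency therefore enters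
the problem only through the arguments of the symbols. -/
theorem fCoeff_comp_mul {w : ℝ} (hw : 0 < w) (F : ℝ → ℝ) (k : ℤ) :
    fCoeff w (fun X => F (w * X)) k = fCoeff 1 F k := by
  have h := intervalIntegral.integral_comp_mul_left (a := 0) (b := 2 * Real.pi / w)
    (fun x => (F x : ℂ) * Complex.exp (-(Complex.I * (1 * k * x : ℝ)))) hw.ne'
  have e : ∀ x : ℝ, (1 * k * (w * x) : ℝ) = w * k * x := fun x => by ring
  simp only [e, mul_zero, mul_div_cancel₀ _ hw.ne'] at h
  have hwc : (w : ℂ) ≠ 0 := by exact_mod_cast hw.ne'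
  rw [fCoeff, fCoeff, h, div_one, Complex.real_smul]
  push_cast
  field_simp

theorem fCoeff_one_neg {F : ℝ → ℝ} (he : Function.Even F) (hp : Function.Periodic F (2 * Real.pi))
    (k : ℤ) : fCoeff 1 F (-k) = fCoeff 1 F k := by
  rw [fCoeff, fCoeff]
  congr 1
  have h := intervalIntegral.integral_comp_sub_left (a := 0) (b := 2 * Real.pi)
    (fun x => (F x : ℂ) * Complex.exp (-(Complex.I * (1 * k * x : ℝ)))) (2 * Real.pi)
  rw [sub_self, sub_zero] at h
  rw [div_one, ← h]
  refine intervalIntegral.integral_congr fun x _ => ?_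
  have hF : F (2 * Real.pi - x) = F x := by rw [sub_eq_add_neg, add_comm, hp, he]
  simp only [hF]
  congr 1
  refine Complex.exp_eq_exp_iff_exists_int.2 ⟨k, ?_⟩
  push_cast
  ring

theorem conj_fCoeff_one (F : ℝ → ℝ) (k : ℤ) :
    (starRingEnd ℂ) (fCoeff 1 F k) = fCoeff 1 F (-k) := by
  rw [fCoeff, fCoeff, map_mul, Complex.conj_ofReal]
  congr 1
  rw [intervalIntegral, intervalIntegral, map_sub, ← integral_conj, ← integral_conj]
  simp only [map_mul, Complex.conj_ofReal, ← Complex.exp_conj, map_neg, Complex.conj_I]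
  congr 2 <;> ext x <;> congr 2 <;> push_cast <;> ring

/-- The real part of the Fourier coefficients of a `2π`-periodic function. -/
def reCoeff (F : ℝ → ℝ) (k : ℤ) : ℝ := (fCoeff 1 F k).re

/-- For a real function conjugation reverses the mode, and evenness makes this reversal trivial, so
the coefficients are real. This is what allows real sequences to be used throughout. -/
theorem ofReal_reCoeff {F : ℝ → ℝ} (he : Function.Even F)
    (hp : Function.Periodic F (2 * Real.pi)) (k : ℤ) : (reCoeff F k : ℂ) = fCoeff 1 F k :=
  Complex.conj_eq_iff_re.1 (by rw [conj_fCoeff_one, fCoeff_one_neg he hp])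

theorem reCoeff_neg {F : ℝ → ℝ} (he : Function.Even F)
    (hp : Function.Periodic F (2 * Real.pi)) (k : ℤ) : reCoeff F (-k) = reCoeff F k := by
  rw [reCoeff, fCoeff_one_neg he hp, reCoeff]

theorem reCoeff_sub {f g : ℝ → ℝ} (hf : Continuous f) (hg : Continuous g) (k : ℤ) :
    reCoeff (fun y => f y - g y) k = reCoeff f k - reCoeff g k := by
  simp [reCoeff, fCoeff_one_sub hf hg]

theorem CBound.reCoeff {ι : Type*} {n : ℕ} {w : ι → ℝ} {f : ι → ℝ → ℝ} (hf : CBound n w f)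
    (hp : ∀ i, Function.Periodic (f i) (2 * Real.pi)) :
    LBound n w (fun i => reCoeff (f i)) :=
  (hf.norm_fCoeff hp).of_abs_le fun _ _ => Complex.abs_re_le_norm _

theorem trigSeries_periodic (x : ℤ → ℝ) (θ : ℝ) :
    Function.Periodic (trigSeries x θ) (2 * Real.pi) := by
  intro y
  refine tsum_congr fun k => ?_
  rw [show k * (y + 2 * Real.pi) + θ = k * y + θ + k * (2 * Real.pi) by ring,
    Real.cos_add_int_mul_two_pi]

theorem trigSeries_even (x : ℤ → ℝ) : Function.Even (trigSeries x 0) := by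
  intro y
  refine tsum_congr fun k => ?_
  rw [add_zero, add_zero, mul_neg, Real.cos_neg]

/-! ### Trigonometric series and Fourier multipliers -/

theorem integral_cos_mul_exp (n k : ℤ) :
    ∫ y in (0 : ℝ)..(2 * Real.pi), (Real.cos (n * y + 0) : ℂ) *
      Complex.exp (-(Complex.I * (1 * k * y : ℝ)))
        = Real.pi * ((if n = k then 1 else 0) + (if n = -k then 1 else 0)) := by
  have key : ∀ m : ℤ, ∫ y in (0 : ℝ)..(2 * Real.pi), Complex.exp (m * Complex.I * y)
      = if m = 0 then 2 * Real.pi else 0 := by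
    intro m
    split_ifs with hm
    · simp [hm]
    · have hm' : (m : ℂ) * Complex.I ≠ 0 := by simp [hm]
      rw [integral_exp_mul_complex hm']
      have : Complex.exp (m * Complex.I * ((2 * Real.pi : ℝ) : ℂ)) = 1 :=
        Complex.exp_eq_one_iff.2 ⟨m, by push_cast; ring⟩
      rw [this]
      simp
  have e : ∀ y : ℝ, (Real.cos (n * y + 0) : ℂ) * Complex.exp (-(Complex.I * (1 * k * y : ℝ)))
      = (1 / 2) * (Complex.exp (((n - k : ℤ) : ℂ) * Complex.I * y)
        + Complex.exp (((-n - k : ℤ) : ℂ) * Complex.I * y)) := by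
    intro y
    rw [Complex.ofReal_cos, Complex.cos, div_mul_eq_mul_div, add_mul, ← Complex.exp_add,
      ← Complex.exp_add, div_eq_inv_mul, one_div]
    congr 2 <;> congr 1 <;> push_cast <;> ring
  simp only [e]
  rw [intervalIntegral.integral_const_mul, intervalIntegral.integral_add, key, key]
  · have h1 : (n - k = 0) ↔ n = k := sub_eq_zero
    have h2 : (-n - k = 0) ↔ n = -k := by constructor <;> intro h <;> omega
    simp only [h1, h2]
    split_ifs <;> push_cast <;> ring
  all_goals exact Continuous.intervalIntegrable (by fun_prop) _ _

/-- A cosine has equal halves at the modes `n` and `-n`. Thus mode `k` collects `(x k + x (-k)) /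
2`, which is `x k` for symmetric coefficients. -/
theorem fCoeff_trigSeries {x : ℤ → ℝ} (hx : Summable fun k => |x k|) (he : ∀ k, x (-k) = x k)
    (k : ℤ) : fCoeff 1 (trigSeries x 0) k = x k := by
  have hnorm : ∀ (n : ℤ) (y : ℝ), ‖((x n * Real.cos (n * y + 0) : ℝ) : ℂ) *
      Complex.exp (-(Complex.I * (1 * k * y : ℝ)))‖ ≤ |x n| := by
    intro n y
    have h1 : ‖Complex.exp (-(Complex.I * (1 * k * y : ℝ)))‖ = 1 := by
      rw [show -(Complex.I * (1 * k * y : ℝ)) = ((-(1 * k * y) : ℝ) : ℂ) * Complex.I by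
        push_cast; ring]
      exact Complex.norm_exp_ofReal_mul_I _
    rw [norm_mul, h1, mul_one, Complex.norm_real]
    exact abs_trig_term_le x 0 y n
  have h := intervalIntegral.hasSum_integral_of_dominated_convergence
    (μ := MeasureTheory.volume) (a := 0) (b := 2 * Real.pi)
    (F := fun (n : ℤ) (y : ℝ) => ((x n * Real.cos (n * y + 0) : ℝ) : ℂ) *
      Complex.exp (-(Complex.I * (1 * k * y : ℝ))))
    (f := fun y => ((trigSeries x 0 y : ℝ) : ℂ) * Complex.exp (-(Complex.I * (1 * k * y : ℝ))))
    (fun n _ => |x n|)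
    (fun n => Continuous.aestronglyMeasurable (by fun_prop))
    (fun n => Filter.Eventually.of_forall fun y _ => hnorm n y)
    (Filter.Eventually.of_forall fun y _ => hx)
    (by simp)
    (Filter.Eventually.of_forall fun y _ =>
      (Complex.hasSum_ofReal.2 (summable_trig hx 0 y).hasSum).mul_right _)
  have hterm : ∀ n : ℤ, ∫ y in (0 : ℝ)..(2 * Real.pi), ((x n * Real.cos (n * y + 0) : ℝ) : ℂ) *
      Complex.exp (-(Complex.I * (1 * k * y : ℝ)))
      = (Real.pi * (if n = k then (x k : ℂ) else 0)) + Real.pi * (if n = -k then (x k : ℂ) else 0) := by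
    intro n
    have e := integral_cos_mul_exp n k
    simp only [Complex.ofReal_mul, mul_assoc (x n : ℂ)] at e ⊢
    rw [intervalIntegral.integral_const_mul, e]
    by_cases h1 : n = k <;> by_cases h2 : n = -k
    · rw [if_pos h1, if_pos h2, if_pos h1, if_pos h2, h1]; ring
    · rw [if_pos h1, if_neg h2, if_pos h1, if_neg h2, h1]; ring
    · rw [if_neg h1, if_pos h2, if_neg h1, if_pos h2, h2, he]; ring
    · rw [if_neg h1, if_neg h2, if_neg h1, if_neg h2]; ring
  simp only [hterm] at h
  have h' := ((hasSum_ite_eq k (x k : ℂ)).mul_left (Real.pi : ℂ)).add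
    ((hasSum_ite_eq (-k) (x k : ℂ)).mul_left (Real.pi : ℂ))
  have hint := h.unique h'
  rw [fCoeff, div_one, hint]
  have : (Real.pi : ℂ) ≠ 0 := by exact_mod_cast Real.pi_ne_zero
  push_cast
  field_simp
  ring

theorem reCoeff_trigSeries {x : ℤ → ℝ} (hx : Summable fun k => |x k|) (he : ∀ k, x (-k) = x k)
    (k : ℤ) : reCoeff (trigSeries x 0) k = x k := by
  simp [reCoeff, fCoeff_trigSeries hx he]

theorem perMult_comp_mul {w : ℝ} (hw : 0 < w) (m : ℝ → ℝ) {F : ℝ → ℝ} (he : Function.Even F)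
    (hp : Function.Periodic F (2 * Real.pi))
    (hs : Summable fun k : ℤ => |m (w * k) * reCoeff F k|) (X : ℝ) :
    perMult w m (fun X => F (w * X)) X = trigSeries (fun k => m (w * k) * reCoeff F k) 0 (w * X) := by
  have hterm : ∀ k : ℤ, ((m (w * k) : ℝ) : ℂ) * fCoeff w (fun X => F (w * X)) k *
      Complex.exp (Complex.I * (w * k * X : ℝ))
      = ((m (w * k) * reCoeff F k : ℝ) : ℂ) * Complex.exp ((k * (w * X) : ℝ) * Complex.I) := by
    intro k
    rw [fCoeff_comp_mul hw, ← ofReal_reCoeff he hp]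
    push_cast
    congr 2
    ring
  have hsum : Summable fun k : ℤ => ((m (w * k) * reCoeff F k : ℝ) : ℂ) *
      Complex.exp ((k * (w * X) : ℝ) * Complex.I) := by
    refine Summable.of_norm_bounded hs fun k => ?_
    rw [norm_mul, Complex.norm_exp_ofReal_mul_I, mul_one, Complex.norm_real, Real.norm_eq_abs]
  rw [perMult, tsum_congr hterm, Complex.re_tsum hsum]
  refine tsum_congr fun k => ?_
  rw [Complex.re_ofReal_mul, Complex.exp_ofReal_mul_I_re, add_zero]

theorem perMult_trigSeries {w : ℝ} (hw : 0 < w) (m : ℝ → ℝ) {x : ℤ → ℝ}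
    (hx : Summable fun k => |x k|) (he : ∀ k, x (-k) = x k)
    (hs : Summable fun k : ℤ => |m (w * k) * x k|) (X : ℝ) :
    perMult w m (fun X => trigSeries x 0 (w * X)) X
      = trigSeries (fun k => m (w * k) * x k) 0 (w * X) := by
  have h := perMult_comp_mul hw m (trigSeries_even x) (trigSeries_periodic x 0)
    (by simpa only [reCoeff_trigSeries hx he] using hs) X
  simpa only [reCoeff_trigSeries hx he] using h

theorem trigSeries_add {x y : ℤ → ℝ} (hx : Summable fun k => |x k|) (hy : Summable fun k => |y k|)
    (θ t : ℝ) : trigSeries (fun k => x k + y k) θ t = trigSeries x θ t + trigSeries y θ t := by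
  simp only [trigSeries, add_mul]
  exact (summable_trig hx θ t).tsum_add (summable_trig hy θ t)

theorem trigSeries_const_mul (c : ℝ) (x : ℤ → ℝ) (θ t : ℝ) :
    trigSeries (fun k => c * x k) θ t = c * trigSeries x θ t := by
  simp only [trigSeries, mul_assoc, tsum_mul_left]

theorem trigSeries_sub {x y : ℤ → ℝ} (hx : Summable fun k => |x k|) (hy : Summable fun k => |y k|)
    (θ t : ℝ) : trigSeries (fun k => x k - y k) θ t = trigSeries x θ t - trigSeries y θ t := by
  simp only [trigSeries, sub_mul]
  exact (summable_trig hx θ t).tsum_sub (summable_trig hy θ t)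

/-! ### Bounded Lipschitz functions -/

/-- Bounded and Lipschitz continuous functions. -/
def BddLip (f : ℝ → ℝ) : Prop := ∃ C, ∀ s t, |f s| ≤ C ∧ |f s - f t| ≤ C * |s - t|

namespace BddLip

variable {f g : ℝ → ℝ}

theorem of_bounds {A B : ℝ} (hA : ∀ s, |f s| ≤ A) (hB : ∀ s t, |f s - f t| ≤ B * |s - t|) :
    BddLip f :=
  ⟨max A B, fun s t => ⟨(hA s).trans (le_max_left _ _),
    (hB s t).trans (mul_le_mul_of_nonneg_right (le_max_right _ _) (abs_nonneg _))⟩⟩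

theorem const (c : ℝ) : BddLip fun _ => c :=
  of_bounds (A := |c|) (B := 0) (fun _ => le_rfl) (by simp)

theorem add (hf : BddLip f) (hg : BddLip g) : BddLip fun s => f s + g s := by
  obtain ⟨C, hC⟩ := hf
  obtain ⟨D, hD⟩ := hg
  refine ⟨C + D, fun s t => ⟨(abs_add_le _ _).trans (add_le_add (hC s t).1 (hD s t).1), ?_⟩⟩
  calc |f s + g s - (f t + g t)| = |(f s - f t) + (g s - g t)| := by ring_nf
    _ ≤ |f s - f t| + |g s - g t| := abs_add_le _ _
    _ ≤ (C + D) * |s - t| := by linarith [(hC s t).2, (hD s t).2]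

theorem mul (hf : BddLip f) (hg : BddLip g) : BddLip fun s => f s * g s := by
  obtain ⟨C, hC⟩ := hf
  obtain ⟨D, hD⟩ := hg
  have hC0 : 0 ≤ C := (abs_nonneg _).trans (hC 0 0).1
  refine of_bounds (A := C * D) (B := C * D + C * D) (fun s => ?_) (fun s t => ?_)
  · rw [abs_mul]
    exact mul_le_mul (hC s s).1 (hD s s).1 (abs_nonneg _) hC0
  · calc |f s * g s - f t * g t| = |f s * (g s - g t) + (f s - f t) * g t| := by ring_nf
      _ ≤ |f s| * |g s - g t| + |f s - f t| * |g t| := by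
        rw [← abs_mul, ← abs_mul]; exact abs_add_le _ _
      _ ≤ C * (D * |s - t|) + (C * |s - t|) * D :=
        add_le_add (mul_le_mul (hC s s).1 (hD s t).2 (abs_nonneg _) hC0)
          (mul_le_mul (hC s t).2 (hD t t).1 (abs_nonneg _)
            (mul_nonneg hC0 (abs_nonneg _)))
      _ = (C * D + C * D) * |s - t| := by ring

theorem neg (hf : BddLip f) : BddLip fun s => -f s := by
  simpa using (const (-1)).mul hf

theorem sub (hf : BddLip f) (hg : BddLip g) : BddLip fun s => f s - g s := by
  simpa only [sub_eq_add_neg] using hf.add hg.neg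

theorem inv (hf : BddLip f) {c : ℝ} (hc : 0 < c) (h : ∀ s, c ≤ |f s|) :
    BddLip fun s => (f s)⁻¹ := by
  obtain ⟨C, hC⟩ := hf
  have h0 : ∀ s, f s ≠ 0 := fun s => abs_pos.1 (hc.trans_le (h s))
  refine of_bounds (A := c⁻¹) (B := C / (c * c)) (fun s => ?_) (fun s t => ?_)
  · rw [abs_inv]
    exact inv_anti₀ hc (h s)
  · rw [inv_sub_inv (h0 s) (h0 t), abs_div, abs_mul, abs_sub_comm, div_mul_eq_mul_div]
    exact div_le_div₀ ((abs_nonneg _).trans (hC s t).2) (hC s t).2 (mul_pos hc hc)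
      (mul_le_mul (h s) (h t) hc.le (abs_nonneg _))

theorem of_periodic (hf : ContDiff ℝ 1 f) {T : ℝ} (hT : 0 < T) (hp : Function.Periodic f T) :
    BddLip f := by
  have hbd : ∀ {g : ℝ → ℝ}, Continuous g → Function.Periodic g T → ∃ C, ∀ s, |g s| ≤ C := by
    intro g hg hp
    obtain ⟨C, hC⟩ := (isCompact_Icc (a := 0) (b := T)).exists_bound_of_continuousOn hg.continuousOn
    refine ⟨C, fun s => ?_⟩
    obtain ⟨y, hy, e⟩ := hp.exists_mem_Ico₀ hT s
    rw [e]
    exact hC y (Set.Ico_subset_Icc_self hy)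
  obtain ⟨A, hA⟩ := hbd hf.continuous hp
  obtain ⟨B, hB⟩ := hbd (hf.continuous_deriv le_rfl) fun y => by
    rw [← deriv_comp_add_const]
    exact congrArg (fun g => deriv g y) (funext hp)
  refine of_bounds (B := B) hA fun s t => ?_
  exact convex_univ.norm_image_sub_le_of_norm_deriv_le
    (fun x _ => hf.differentiable one_ne_zero x) (fun x _ => hB x)
    (Set.mem_univ t) (Set.mem_univ s)

theorem cos : BddLip Real.cos :=
  of_periodic Real.contDiff_cos Real.two_pi_pos Real.cos_periodic

end BddLip

/-! ### The eigenvalues and the matrix of eigenvectors -/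

/-- Written as the modulus of `κ + e^{2ik}`, the square root inherits the Lipschitz constant 2 from
the exponential, uniformly in `κ`. -/
theorem rho_eq_norm (κ k : ℝ) :
    rho κ k = ‖(κ : ℂ) + Complex.exp (Complex.I * ((2 * k : ℝ) : ℂ))‖ := by
  have e : Complex.exp (Complex.I * ((2 * k : ℝ) : ℂ))
      = (Real.cos (2 * k) : ℂ) + (Real.sin (2 * k) : ℂ) * Complex.I := by
    rw [mul_comm, Complex.exp_mul_I, Complex.ofReal_cos, Complex.ofReal_sin]
  rw [rho, e, ← add_assoc, ← Complex.ofReal_add, Complex.norm_add_mul_I]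
  congr 1
  have h1 := Real.sin_sq_add_cos_sq (2 * k)
  have h2 := Real.cos_two_mul k
  linear_combination (-2 * κ) * h2 - h1

theorem abs_rho_sub_le (κ s t : ℝ) : |rho κ s - rho κ t| ≤ 2 * |s - t| := by
  rw [rho_eq_norm, rho_eq_norm]
  refine (abs_norm_sub_norm_le _ _).trans ?_
  have e : (κ : ℂ) + Complex.exp (Complex.I * ((2 * s : ℝ) : ℂ))
      - (κ + Complex.exp (Complex.I * ((2 * t : ℝ) : ℂ)))
      = Complex.exp (Complex.I * ((2 * t : ℝ) : ℂ))
        * (Complex.exp (Complex.I * ((2 * (s - t) : ℝ) : ℂ)) - 1) := by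
    rw [mul_sub, ← Complex.exp_add, mul_one, add_sub_add_left_eq_sub]
    congr 2
    push_cast
    ring
  rw [e, norm_mul, mul_comm Complex.I, Complex.norm_exp_ofReal_mul_I, one_mul]
  refine (Real.norm_exp_I_mul_ofReal_sub_one_le).trans ?_
  rw [Real.norm_eq_abs, abs_mul, abs_two]

theorem rho_le {κ : ℝ} (hκ : 1 < κ) (k : ℝ) : rho κ k ≤ κ + 1 := by
  refine Real.sqrt_le_iff.2 ⟨by linarith, ?_⟩
  nlinarith [Real.cos_sq_le_one k]

theorem le_rho {κ : ℝ} (hκ : 1 < κ) (k : ℝ) : κ - 1 ≤ rho κ k := by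
  refine Real.le_sqrt_of_sq_le ?_
  nlinarith [sq_nonneg (Real.cos k)]

theorem lamMinus_le {κ : ℝ} (hκ : 1 < κ) (k : ℝ) : lamMinus κ k ≤ 2 := by
  have := le_rho hκ k
  rw [lamMinus]; linarith

theorem lamPlus_le {κ : ℝ} (hκ : 1 < κ) (k : ℝ) : lamPlus κ k ≤ 2 + 2 * κ := by
  have := rho_le hκ k
  rw [lamPlus]; linarith

theorem le_lamPlus {κ : ℝ} (hκ : 1 < κ) (k : ℝ) : 2 * κ ≤ lamPlus κ k := by
  have := le_rho hκ k
  rw [lamPlus]; linarith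

theorem abs_lamPlus_sub_le (κ s t : ℝ) : |lamPlus κ s - lamPlus κ t| ≤ 2 * |s - t| := by
  rw [lamPlus, lamPlus, add_sub_add_left_eq_sub]
  exact abs_rho_sub_le κ s t

theorem bddLip_rho {κ : ℝ} (hκ : 1 < κ) : BddLip (rho κ) :=
  BddLip.of_bounds (A := κ + 1)
    (fun s => by rw [abs_of_nonneg (show 0 ≤ rho κ s from Real.sqrt_nonneg _)]; exact rho_le hκ s)
    (abs_rho_sub_le κ)

theorem bddLip_lamPlus {κ : ℝ} (hκ : 1 < κ) : BddLip (lamPlus κ) :=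
  (BddLip.const (1 + κ)).add (bddLip_rho hκ)

theorem bddLip_lamMinus {κ : ℝ} (hκ : 1 < κ) : BddLip (lamMinus κ) :=
  (BddLip.const (1 + κ)).sub (bddLip_rho hκ)

theorem bddLip_normalization {d : Fin 2 → ℝ → ℝ} (hd : IsNormalization d) (i : Fin 2) :
    BddLip (d i) :=
  .of_periodic ((hd i).1.of_le (by exact_mod_cast le_top)) Real.two_pi_pos (hd i).2.2.1

theorem bddLip_eigMatrix {κ : ℝ} (hκ : 1 < κ) {d : Fin 2 → ℝ → ℝ} (hd : IsNormalization d)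
    (i j : Fin 2) : BddLip fun k => eigMatrix κ d k i j := by
  have h0 := bddLip_normalization hd 0
  have h1 := bddLip_normalization hd 1
  fin_cases i <;> fin_cases j <;> simp [eigMatrix]
  · exact h0.mul ((BddLip.const 2).mul .cos)
  · exact h1.mul ((BddLip.const 2).sub (bddLip_lamPlus hκ))
  · exact h0.mul ((BddLip.const (2 * κ)).sub (bddLip_lamMinus hκ))
  · exact h1.mul ((BddLip.const (2 * κ)).mul .cos)

theorem det_eigMatrix {κ : ℝ} (d : Fin 2 → ℝ → ℝ) (k : ℝ) : (eigMatrix κ d k).det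
      = d 0 k * d 1 k * (4 * κ * Real.cos k ^ 2 + (κ - 1 + rho κ k) ^ 2) := by
  simp [eigMatrix, Matrix.det_fin_two, lamMinus, lamPlus]
  ring

theorem exists_le_abs_normalization {d : Fin 2 → ℝ → ℝ} (hd : IsNormalization d) (i : Fin 2) :
    ∃ c > 0, ∀ k, c ≤ |d i k| := by
  obtain ⟨h1, -, h3, h4⟩ := hd i
  obtain ⟨y, -, hy⟩ := (isCompact_Icc (a := 0) (b := 2 * Real.pi)).exists_isMinOn
    (Set.nonempty_Icc.2 Real.two_pi_pos.le) h1.continuous.abs.continuousOn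
  refine ⟨|d i y|, abs_pos.2 (h4 y), fun k => ?_⟩
  obtain ⟨z, hz, e⟩ := h3.exists_mem_Ico₀ Real.two_pi_pos k
  rw [e]
  exact hy (Set.Ico_subset_Icc_self hz)

/-- Cramer's rule: the determinant is bounded away from zero because the normalizations are (by
periodicity and compactness) and because `κ - 1 + ρ ≥ κ - 1 > 0`. -/
theorem bddLip_inv_eigMatrix {κ : ℝ} (hκ : 1 < κ) {d : Fin 2 → ℝ → ℝ} (hd : IsNormalization d)
    (i j : Fin 2) : BddLip fun k => (eigMatrix κ d k)⁻¹ i j := by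
  have hJ := bddLip_eigMatrix hκ hd
  have hdet : BddLip fun k => ((eigMatrix κ d k).det)⁻¹ := by
    obtain ⟨c, hc, hc'⟩ := exists_le_abs_normalization hd 0
    obtain ⟨e, he, he'⟩ := exists_le_abs_normalization hd 1
    have hκ1 : 0 < κ - 1 := by linarith
    refine BddLip.inv (c := c * e * (κ - 1) ^ 2) ?_ (by positivity) fun k => ?_
    · simp only [Matrix.det_fin_two]
      exact ((hJ 0 0).mul (hJ 1 1)).sub ((hJ 0 1).mul (hJ 1 0))
    · rw [det_eigMatrix, abs_mul, abs_mul]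
      have h1 : (κ - 1) ^ 2 ≤ |4 * κ * Real.cos k ^ 2 + (κ - 1 + rho κ k) ^ 2| := by
        refine le_trans ?_ (le_abs_self _)
        have := le_rho hκ k
        nlinarith [sq_nonneg (Real.cos k)]
      have := hc' k
      have := he' k
      gcongr
  simp only [Matrix.inv_def, Ring.inverse_eq_inv', Matrix.smul_apply, smul_eq_mul,
    Matrix.adjugate_fin_two]
  fin_cases i <;> fin_cases j <;> simp
  · exact hdet.mul (hJ 1 1)
  · exact (hdet.mul (hJ 0 1)).neg
  · exact (hdet.mul (hJ 1 0)).neg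
  · exact hdet.mul (hJ 0 0)

theorem eigMatrix_neg (κ : ℝ) {d : Fin 2 → ℝ → ℝ} (hd : IsNormalization d) (k : ℝ) :
    eigMatrix κ d (-k) = eigMatrix κ d k := by
  simp only [eigMatrix, lamPlus, lamMinus, rho, Real.cos_neg, (hd 0).2.1 k, (hd 1).2.1 k]

theorem lamPlus_neg (κ k : ℝ) : lamPlus κ (-k) = lamPlus κ k := by
  simp [lamPlus, rho]

theorem lamMinus_neg (κ k : ℝ) : lamMinus κ (-k) = lamMinus κ k := by
  simp [lamMinus, rho]

/-! ### The critical frequency -/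

theorem soundSpeed_sq {κ : ℝ} (hκ : 1 < κ) : soundSpeed κ ^ 2 = 2 * κ / (1 + κ) :=
  Real.sq_sqrt (by positivity)

theorem waveSpeed_sq (κ ε : ℝ) : waveSpeed κ ε ^ 2 = soundSpeed κ ^ 2 + ε ^ 2 :=
  Real.sq_sqrt (by positivity)

theorem one_le_soundSpeed_sq {κ : ℝ} (hκ : 1 < κ) : 1 ≤ soundSpeed κ ^ 2 := by
  rw [soundSpeed_sq hκ, le_div_iff₀ (by linarith)]
  linarith

theorem soundSpeed_sq_le {κ : ℝ} (hκ : 1 < κ) : soundSpeed κ ^ 2 ≤ 2 := by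
  rw [soundSpeed_sq hκ, div_le_iff₀ (by linarith)]
  linarith

theorem one_le_waveSpeed_sq {κ : ℝ} (hκ : 1 < κ) (ε : ℝ) : 1 ≤ waveSpeed κ ε ^ 2 := by
  have := one_le_soundSpeed_sq hκ
  rw [waveSpeed_sq]
  nlinarith

theorem waveSpeed_pos {κ : ℝ} (hκ : 1 < κ) (ε : ℝ) : 0 < waveSpeed κ ε := by
  have h := one_le_waveSpeed_sq hκ ε
  have h0 : 0 ≤ waveSpeed κ ε := Real.sqrt_nonneg _
  rcases h0.eq_or_lt with h1 | h1
  · rw [← h1] at h; norm_num at h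
  · exact h1

/-- The wave numbers `K` among which that of the periodic solutions is sought. -/
def WaveNumber (κ ε K : ℝ) : Prop :=
  0 < K ∧ κ + 1 ≤ waveSpeed κ ε ^ 2 * K ^ 2 ∧ waveSpeed κ ε ^ 2 * K ^ 2 ≤ 2 * κ + 3

theorem WaveNumber.le {κ ε K : ℝ} (hκ : 1 < κ) (h : WaveNumber κ ε K) : K ≤ 2 * κ + 3 := by
  have := one_le_waveSpeed_sq hκ ε
  have h2 : K ^ 2 ≤ 2 * κ + 3 := by nlinarith [h.2.2, sq_nonneg K]
  nlinarith [h.1]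

/-- Since `c² K² = λ₊ - ξ` and `2κ ≤ λ₊ ≤ 2 + 2κ`, this range of `ξ` leads to the ends `κ + 1` and
`2κ + 3`. The lower end exceeds the maximum 2 of `λ₋`, and four times it exceeds the maximum of
`λ₊`; these gaps exclude the other resonances. -/
theorem WaveNumber.of_xiSymbol {κ ε K : ℝ} (hκ : 1 < κ) (hK : 0 < K)
    (h1 : -1 ≤ xiSymbol κ (waveSpeed κ ε) K) (h2 : xiSymbol κ (waveSpeed κ ε) K ≤ κ - 1) :
    WaveNumber κ ε K := by
  have := le_lamPlus hκ K
  have := lamPlus_le hκ K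
  simp only [xiSymbol] at h1 h2
  exact ⟨hK, by linarith, by linarith⟩

/-- The quadratic term has slope `c² (K + L) ≥ 14/5`, whereas `λ₊` is Lipschitz with constant 2; the
surplus is `4/5`. No derivative of `λ₊` is needed. -/
theorem abs_sub_le_xiSymbol_sub {κ ε K L : ℝ} (hκ : 1 < κ) (hK : WaveNumber κ ε K)
    (hL : WaveNumber κ ε L) : 4 / 5 * |K - L| ≤
      |xiSymbol κ (waveSpeed κ ε) K - xiSymbol κ (waveSpeed κ ε) L| := by
  have hc := one_le_waveSpeed_sq hκ ε
  -- As `c² ≥ 1`, one has `(c² K)² ≥ c² K² ≥ κ + 1 > 2 > (7/5)²`.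
  have low : ∀ {K}, WaveNumber κ ε K → 7 / 5 ≤ waveSpeed κ ε ^ 2 * K := by
    intro K hK
    by_contra! h
    have h0 : 0 ≤ waveSpeed κ ε ^ 2 * K := mul_nonneg (sq_nonneg _) hK.1.le
    have h1 : (waveSpeed κ ε ^ 2 * K) ^ 2 < (7 / 5) ^ 2 := by gcongr
    have h2 : κ + 1 ≤ (waveSpeed κ ε ^ 2 * K) ^ 2 := by
      calc κ + 1 ≤ 1 * (waveSpeed κ ε ^ 2 * K ^ 2) := by linarith [hK.2.1]
        _ ≤ waveSpeed κ ε ^ 2 * (waveSpeed κ ε ^ 2 * K ^ 2) := by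
          gcongr
        _ = _ := by ring
    norm_num at h1
    linarith
  have hr := abs_lamPlus_sub_le κ K L
  have h1 := low hK
  have h2 := low hL
  have e : xiSymbol κ (waveSpeed κ ε) K - xiSymbol κ (waveSpeed κ ε) L
      = (lamPlus κ K - lamPlus κ L) - (waveSpeed κ ε ^ 2 * K + waveSpeed κ ε ^ 2 * L) * (K - L) := by
    simp only [xiSymbol]; ring
  have h3 : 14 / 5 * |K - L| ≤ |(waveSpeed κ ε ^ 2 * K + waveSpeed κ ε ^ 2 * L) * (K - L)| := by
    rw [abs_mul]
    refine mul_le_mul_of_nonneg_right ?_ (abs_nonneg _)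
    exact le_trans (by linarith) (le_abs_self _)
  rw [e]
  refine le_trans ?_ ((abs_sub_abs_le_abs_sub _ _).trans_eq (abs_sub_comm _ _))
  linarith

/-- Intermediate value theorem between the ends of the window: at `√s / c` the symbol equals `λ₊ -
s`, which is at least `κ - 1` for `s = κ + 1` and at most `-1` for `s = 2κ + 3`. -/
theorem exists_waveNumber {κ : ℝ} (hκ : 1 < κ) (ε : ℝ) {t : ℝ} (h1 : -1 ≤ t) (h2 : t ≤ κ - 1) :
    ∃ K, WaveNumber κ ε K ∧ xiSymbol κ (waveSpeed κ ε) K = t := by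
  have hc := waveSpeed_pos hκ ε
  have hcont : Continuous fun K => xiSymbol κ (waveSpeed κ ε) K := by
    simp only [xiSymbol, lamPlus, rho]
    fun_prop
  have hval : ∀ a : ℝ, 0 ≤ a → -waveSpeed κ ε ^ 2 * (Real.sqrt a / waveSpeed κ ε) ^ 2 = -a := by
    intro a ha
    rw [div_pow, Real.sq_sqrt ha]
    field_simp
  have hle : Real.sqrt (κ + 1) / waveSpeed κ ε ≤ Real.sqrt (2 * κ + 3) / waveSpeed κ ε := by
    gcongr <;> linarith
  have hmem : t ∈ Set.Icc (xiSymbol κ (waveSpeed κ ε) (Real.sqrt (2 * κ + 3) / waveSpeed κ ε))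
      (xiSymbol κ (waveSpeed κ ε) (Real.sqrt (κ + 1) / waveSpeed κ ε)) := by
    simp only [xiSymbol]
    rw [hval _ (by linarith), hval _ (by linarith)]
    constructor
    · linarith [lamPlus_le hκ (Real.sqrt (2 * κ + 3) / waveSpeed κ ε)]
    · linarith [le_lamPlus hκ (Real.sqrt (κ + 1) / waveSpeed κ ε)]
  obtain ⟨K, hK, e⟩ := intermediate_value_Icc' hle hcont.continuousOn hmem
  have hK0 : 0 < K := lt_of_lt_of_le (div_pos (Real.sqrt_pos.2 (by linarith)) hc) hK.1
  simp only at e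
  exact ⟨K, .of_xiSymbol hκ hK0 (by rw [e]; exact h1) (by rw [e]; exact h2), e⟩

/-! ### Symbols depending on the wave number -/

/-- Symbols with `|S ε K k| ≤ C g(k)` and `|S ε K k - S ε K' k| ≤ C (1 + |k|) g(k) |K - K'|`. -/
def SymbolClass (κ : ℝ) (g : ℤ → ℝ) (S : ℝ → ℝ → ℤ → ℝ) : Prop :=
  ∃ C, ∀ ε K L k, 0 < ε → ε ≤ 1 → WaveNumber κ ε K → WaveNumber κ ε L →
    |S ε K k| ≤ C * g k ∧ |S ε K k - S ε L k| ≤ C * (wt k * g k) * |K - L|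

namespace SymbolClass

variable {κ : ℝ} {g g₁ g₂ : ℤ → ℝ} {S T : ℝ → ℝ → ℤ → ℝ}

theorem of_bounds (hg : ∀ k, 0 ≤ g k) {A B : ℝ}
    (hA : ∀ ε K k, 0 < ε → ε ≤ 1 → WaveNumber κ ε K → |S ε K k| ≤ A * g k)
    (hB : ∀ ε K L k, 0 < ε → ε ≤ 1 → WaveNumber κ ε K → WaveNumber κ ε L →
      |S ε K k - S ε L k| ≤ B * (wt k * g k) * |K - L|) : SymbolClass κ g S := by
  refine ⟨max A B, fun ε K L k h1 h2 h3 h4 => ⟨(hA ε K k h1 h2 h3).trans ?_,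
    (hB ε K L k h1 h2 h3 h4).trans ?_⟩⟩
  · exact mul_le_mul_of_nonneg_right (le_max_left _ _) (hg k)
  · have := hg k
    have := (wt_pos k).le
    gcongr
    exact le_max_right _ _

theorem mono (h : SymbolClass κ g₁ S) (hg₁ : ∀ k, 0 ≤ g₁ k) {A : ℝ}
    (hle : ∀ k, g₁ k ≤ A * g k) : SymbolClass κ g S := by
  obtain ⟨C, hC⟩ := h
  refine ⟨|C| * A, fun ε K L k h1 h2 h3 h4 => ?_⟩
  obtain ⟨ha, hb⟩ := hC ε K L k h1 h2 h3 h4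
  have := (wt_pos k).le
  have := hg₁ k
  have := hle k
  constructor
  · calc _ ≤ C * g₁ k := ha
      _ ≤ |C| * (A * g k) := by gcongr; exact le_abs_self C
      _ = _ := by ring
  · calc _ ≤ C * (wt k * g₁ k) * |K - L| := hb
      _ ≤ |C| * (wt k * (A * g k)) * |K - L| := by gcongr; exact le_abs_self C
      _ = _ := by ring

/-- Changing `K` moves the argument `K k` by `|k|` times as much. This is the source of the extra
factor `wt` in the difference bound of the class. -/
theorem of_bddLip {f : ℝ → ℝ} (hf : BddLip f) :
    SymbolClass κ (fun _ => 1) fun _ K k => f (K * k) := by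
  obtain ⟨C, hC⟩ := hf
  have hC0 : 0 ≤ C := (abs_nonneg _).trans (hC 0 0).1
  refine of_bounds (fun _ => zero_le_one) (A := C) (B := C)
    (fun ε K k _ _ _ => by simpa using (hC (K * k) 0).1) (fun ε K L k _ _ _ _ => ?_)
  refine (hC _ _).2.trans ?_
  rw [← sub_mul, abs_mul, mul_one, mul_assoc, mul_comm |K - L|]
  have := abs_le_wt k
  gcongr

theorem of_indep {s : ℝ → ℤ → ℝ} {A : ℝ} (hs : ∀ ε k, 0 < ε → ε ≤ 1 → |s ε k| ≤ A * g k)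
    (hg : ∀ k, 0 ≤ g k) : SymbolClass κ g fun ε _ k => s ε k :=
  of_bounds hg (A := A) (B := 0) (fun ε _ k h1 h2 _ => hs ε k h1 h2) (by simp)

theorem of_waveNumber (hκ : 1 < κ) : SymbolClass κ wt fun _ K k => K * k := by
  refine of_bounds (fun k => (wt_pos k).le) (A := 2 * κ + 3) (B := 1) (fun ε K k _ _ h => ?_)
    (fun ε K L k _ _ _ _ => ?_)
  · have := abs_le_wt k
    have := h.le hκ
    have := h.1.le
    rw [abs_mul, abs_of_pos h.1]
    gcongr
  · rw [← sub_mul, abs_mul, one_mul, mul_comm]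
    have : |(k : ℝ)| ≤ wt k * wt k :=
      (abs_le_wt k).trans (le_mul_of_one_le_left (wt_pos k).le (one_le_wt k))
    gcongr

theorem add (hS : SymbolClass κ g S) (hT : SymbolClass κ g T) :
    SymbolClass κ g fun ε K k => S ε K k + T ε K k := by
  obtain ⟨C, hC⟩ := hS
  obtain ⟨D, hD⟩ := hT
  refine ⟨C + D, fun ε K L k h1 h2 h3 h4 => ?_⟩
  obtain ⟨ha, hb⟩ := hC ε K L k h1 h2 h3 h4
  obtain ⟨hc, hd⟩ := hD ε K L k h1 h2 h3 h4
  constructor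
  · linarith [abs_add_le (S ε K k) (T ε K k)]
  · have := abs_add_le (S ε K k - S ε L k) (T ε K k - T ε L k)
    rw [show S ε K k + T ε K k - (S ε L k + T ε L k)
      = S ε K k - S ε L k + (T ε K k - T ε L k) by ring]
    linarith

theorem mul (hS : SymbolClass κ g₁ S) (hT : SymbolClass κ g₂ T) (hg₁ : ∀ k, 0 < g₁ k)
    (hg₂ : ∀ k, 0 < g₂ k) :
    SymbolClass κ (fun k => g₁ k * g₂ k) fun ε K k => S ε K k * T ε K k := by
  obtain ⟨C, hC⟩ := hS
  obtain ⟨D, hD⟩ := hT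
  refine of_bounds (fun k => (mul_pos (hg₁ k) (hg₂ k)).le) (A := C * D) (B := 2 * (C * D))
    (fun ε K k h1 h2 h3 => ?_) (fun ε K L k h1 h2 h3 h4 => ?_)
  · have ha := (hC ε K K k h1 h2 h3 h3).1
    have hb := (hD ε K K k h1 h2 h3 h3).1
    rw [abs_mul]
    calc _ ≤ (C * g₁ k) * (D * g₂ k) :=
          mul_le_mul ha hb (abs_nonneg _) ((abs_nonneg _).trans ha)
      _ = _ := by ring
  · obtain ⟨ha, hb⟩ := hC ε K L k h1 h2 h3 h4
    obtain ⟨hc, hd⟩ := hD ε K L k h1 h2 h3 h4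
    have he := (hD ε L L k h1 h2 h4 h4).1
    calc |S ε K k * T ε K k - S ε L k * T ε L k|
        = |S ε K k * (T ε K k - T ε L k) + (S ε K k - S ε L k) * T ε L k| := by ring_nf
      _ ≤ |S ε K k| * |T ε K k - T ε L k| + |S ε K k - S ε L k| * |T ε L k| := by
        rw [← abs_mul, ← abs_mul]; exact abs_add_le _ _
      _ ≤ (C * g₁ k) * (D * (wt k * g₂ k) * |K - L|)
          + (C * (wt k * g₁ k) * |K - L|) * (D * g₂ k) :=
        add_le_add (mul_le_mul ha hd (abs_nonneg _) ((abs_nonneg _).trans ha))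
          (mul_le_mul hb he (abs_nonneg _) ((abs_nonneg _).trans hb))
      _ = _ := by ring

theorem inv (hS : SymbolClass κ g S) (hg : ∀ k, 0 < g k) {c : ℝ} (hc : 0 < c)
    (h : ∀ ε K k, 0 < ε → ε ≤ 1 → WaveNumber κ ε K → c * g k ≤ |S ε K k|) :
    SymbolClass κ (fun k => (g k)⁻¹) fun ε K k => (S ε K k)⁻¹ := by
  obtain ⟨C, hC⟩ := hS
  refine of_bounds (fun k => (inv_pos.2 (hg k)).le) (A := c⁻¹) (B := C / (c * c))
    (fun ε K k h1 h2 h3 => ?_) (fun ε K L k h1 h2 h3 h4 => ?_)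
  · rw [abs_inv, ← mul_inv]
    exact inv_anti₀ (mul_pos hc (hg k)) (h ε K k h1 h2 h3)
  · have hK := h ε K k h1 h2 h3
    have hL := h ε L k h1 h2 h4
    have hcg := mul_pos hc (hg k)
    have hb := (hC ε K L k h1 h2 h3 h4).2
    rw [inv_sub_inv (abs_pos.1 (hcg.trans_le hK)) (abs_pos.1 (hcg.trans_le hL)), abs_div, abs_mul,
      abs_sub_comm]
    calc _ ≤ C * (wt k * g k) * |K - L| / ((c * g k) * (c * g k)) :=
          div_le_div₀ ((abs_nonneg _).trans hb) hb (mul_pos hcg hcg)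
            (mul_le_mul hK hL hcg.le (abs_nonneg _))
      _ = _ := by have := (hg k).ne'; field_simp

theorem ite (hS : SymbolClass κ g S) (hT : SymbolClass κ g T) (hg : ∀ k, 0 ≤ g k) (p : ℤ → Prop)
    [DecidablePred p] : SymbolClass κ g fun ε K k => if p k then S ε K k else T ε K k := by
  obtain ⟨C, hC⟩ := hS
  obtain ⟨D, hD⟩ := hT
  refine ⟨max C D, fun ε K L k h1 h2 h3 h4 => ?_⟩
  have := hg k
  have := (wt_pos k).le
  dsimp only
  split_ifs
  · obtain ⟨ha, hb⟩ := hC ε K L k h1 h2 h3 h4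
    refine ⟨ha.trans ?_, hb.trans ?_⟩ <;> gcongr <;> exact le_max_left _ _
  · obtain ⟨ha, hb⟩ := hD ε K L k h1 h2 h3 h4
    refine ⟨ha.trans ?_, hb.trans ?_⟩ <;> gcongr <;> exact le_max_right _ _

end SymbolClass

/-! ### The acoustic and optical symbols and their nonresonance -/

/-- The symbol `ϖ^ε` at the wave number `K k / ε`. -/
def acousticSymbol (κ ε K : ℝ) (k : ℤ) : ℝ :=
  if k = 0 then -soundSpeed κ ^ 2
  else ε ^ 2 * lamMinus κ (K * k) * (lamMinus κ (K * k) - waveSpeed κ ε ^ 2 * (K * k) ^ 2)⁻¹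

/-- The symbol `ε² λ₊ / ξ` away from the critical modes `k = ±1`, where it is set to zero. -/
def opticalSymbol (κ ε K : ℝ) (k : ℤ) : ℝ :=
  if k = 1 ∨ k = -1 then 0
  else ε ^ 2 * lamPlus κ (K * k) * (xiSymbol κ (waveSpeed κ ε) (K * k))⁻¹

theorem varpiSymbol_eq (κ : ℝ) (ε : ℝ) {w : ℝ} (hw : w ≠ 0) (k : ℤ) :
    varpiSymbol κ ε (w * k) = acousticSymbol κ ε (ε * w) k := by
  have : w * (k : ℝ) = 0 ↔ k = 0 := by simp [hw]
  simp only [varpiSymbol, acousticSymbol, this, mul_assoc, div_eq_mul_inv]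

theorem wt_sq_le {k : ℤ} (hk : k ≠ 0) : wt k ^ 2 ≤ 4 * (k : ℝ) ^ 2 := by
  have h : (1 : ℝ) ≤ |(k : ℝ)| := by exact_mod_cast Int.one_le_abs hk
  have h2 : wt k ≤ 2 * |(k : ℝ)| := by rw [wt]; linarith
  calc wt k ^ 2 ≤ (2 * |(k : ℝ)|) ^ 2 := pow_le_pow_left₀ (wt_pos k).le h2 2
    _ = _ := by rw [mul_pow, sq_abs]; norm_num

theorem one_le_sq {k : ℤ} (hk : k ≠ 0) : 1 ≤ (k : ℝ) ^ 2 := by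
  have h : (1 : ℝ) ≤ |(k : ℝ)| := by exact_mod_cast Int.one_le_abs hk
  rw [← sq_abs]
  exact one_le_pow₀ h

/-- No acoustic resonance: `c² K² k² ≥ (κ + 1) k²`, while `λ₋ ≤ 2 ≤ 2k²`. -/
theorem lamMinus_sub_le {κ ε K : ℝ} (hκ : 1 < κ) (hK : WaveNumber κ ε K) {k : ℤ} (hk : k ≠ 0) :
    (κ - 1) * (k : ℝ) ^ 2 ≤ waveSpeed κ ε ^ 2 * (K * k) ^ 2 - lamMinus κ (K * k) := by
  have h1 := one_le_sq hk
  have h2 := lamMinus_le hκ (K * k)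
  have h3 := mul_le_mul_of_nonneg_right hK.2.1 (sq_nonneg (k : ℝ))
  rw [mul_pow, ← mul_assoc]
  nlinarith

/-- No higher optical resonance: for `k² ≥ 4` the bound `λ₊ ≤ 2(κ + 1)` uses up at most half of `(κ
+ 1) k²`. -/
theorem xiSymbol_le {κ ε K : ℝ} (hκ : 1 < κ) (hK : WaveNumber κ ε K) {k : ℤ} (hk : k ≠ 0)
    (hk1 : ¬ (k = 1 ∨ k = -1)) : (k : ℝ) ^ 2 ≤ -xiSymbol κ (waveSpeed κ ε) (K * k) := by
  have h1 : (4 : ℝ) ≤ (k : ℝ) ^ 2 := by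
    have : (2 : ℝ) ≤ |(k : ℝ)| := by
      have : 2 ≤ |k| := by
        push Not at hk1
        rcases abs_cases k with h | h <;> omega
      exact_mod_cast this
    rw [← sq_abs]
    nlinarith
  have h2 := lamPlus_le hκ (K * k)
  have h3 := mul_le_mul_of_nonneg_right hK.2.1 (sq_nonneg (k : ℝ))
  rw [xiSymbol, mul_pow, neg_mul, ← mul_assoc]
  nlinarith

theorem wt_zero : wt 0 = 1 := by simp [wt]

theorem symbolClass_waveSpeed_mul_sq {κ : ℝ} (hκ : 1 < κ) :
    SymbolClass κ (fun k => wt k ^ 2) fun ε K k => waveSpeed κ ε ^ 2 * (K * k) ^ 2 := by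
  have h := (SymbolClass.of_waveNumber hκ).mul (.of_waveNumber hκ) wt_pos wt_pos
  have h3 := (SymbolClass.of_indep (κ := κ) (g := fun _ => 1) (s := fun ε _ => waveSpeed κ ε ^ 2)
    (A := 3) (fun ε k h1 h2 => by
      rw [abs_of_nonneg (sq_nonneg _), waveSpeed_sq]
      nlinarith [soundSpeed_sq_le hκ]) (by simp)).mul h (by simp)
        (fun k => mul_pos (wt_pos k) (wt_pos k))
  simpa only [one_mul, sq] using h3

theorem symbolClass_eps_sq_mul {κ : ℝ} {f : ℝ → ℝ} (hf : BddLip f) :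
    SymbolClass κ (fun _ => 1) fun ε K k => ε ^ 2 * f (K * k) := by
  simpa using (SymbolClass.of_indep (κ := κ) (g := fun _ => 1) (s := fun ε _ => ε ^ 2) (A := 1)
    (fun ε k h1 h2 => by rw [abs_of_nonneg (sq_nonneg _)]; nlinarith) (by simp)).mul
      (.of_bddLip hf) (by simp) (by simp)

theorem SymbolClass.of_bddLip_wt {κ : ℝ} {f : ℝ → ℝ} (hf : BddLip f) :
    SymbolClass κ (fun k => wt k ^ 2) fun _ K k => f (K * k) :=
  (SymbolClass.of_bddLip hf).mono (A := 1) (by simp) fun k => by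
    rw [one_mul]
    exact one_le_pow₀ (one_le_wt k)

theorem symbolClass_acoustic {κ : ℝ} (hκ : 1 < κ) :
    SymbolClass κ (fun k => (wt k)⁻¹ ^ 2) (acousticSymbol κ) := by
  -- The formula is not used at `k = 0`, so the denominator is given the dummy value 1 there.
  -- Elsewhere its sign is reversed to make it positive.
  have hden : SymbolClass κ (fun k => wt k ^ 2) fun ε K k => if k = 0 then 1
      else waveSpeed κ ε ^ 2 * (K * k) ^ 2 + -lamMinus κ (K * k) :=
    (SymbolClass.of_bddLip_wt (BddLip.const 1)).ite ((symbolClass_waveSpeed_mul_sq hκ).add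
      (.of_bddLip_wt (bddLip_lamMinus hκ).neg)) (fun k => sq_nonneg _) _
  have hκ1 : 0 < κ - 1 := by linarith
  have hinv := hden.inv (fun k => pow_pos (wt_pos k) 2) (c := min 1 ((κ - 1) / 4))
    (lt_min one_pos (by linarith)) fun ε K k _ _ hK => by
      split_ifs with hk
      · rw [hk, wt_zero]
        simp
      · rw [← sub_eq_add_neg]
        refine le_trans ?_ ((lamMinus_sub_le hκ hK hk).trans (le_abs_self _))
        calc _ ≤ (κ - 1) / 4 * (4 * (k : ℝ) ^ 2) :=
              mul_le_mul (min_le_right _ _) (wt_sq_le hk) (sq_nonneg _) (by linarith)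
          _ = _ := by ring
  have hnum : SymbolClass κ (fun _ => 1) fun ε K k => if k = 0 then -soundSpeed κ ^ 2
      else -(ε ^ 2 * lamMinus κ (K * k)) := by
    refine SymbolClass.ite (.of_indep (s := fun _ _ => -soundSpeed κ ^ 2) (A := 2)
      (fun ε k _ _ => ?_) (by simp)) ?_ (by simp) _
    · rw [abs_neg, abs_of_nonneg (sq_nonneg _)]
      simpa using soundSpeed_sq_le hκ
    · simpa using symbolClass_eps_sq_mul (κ := κ) (bddLip_lamMinus hκ).neg
  convert hnum.mul hinv (by simp) (fun k => inv_pos.2 (pow_pos (wt_pos k) 2)) using 4 with k ε K k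
  · simp
  · rw [acousticSymbol]
    split_ifs
    · simp
    · rw [← sub_eq_add_neg, ← neg_sub (waveSpeed κ ε ^ 2 * (K * k) ^ 2), inv_neg]
      ring

theorem symbolClass_optical {κ : ℝ} (hκ : 1 < κ) :
    SymbolClass κ (fun k => (wt k)⁻¹ ^ 2) (opticalSymbol κ) := by
  have hden : SymbolClass κ (fun k => wt k ^ 2) fun ε K k => if k = 1 ∨ k = -1 then 4
      else waveSpeed κ ε ^ 2 * (K * k) ^ 2 + -lamPlus κ (K * k) :=
    (SymbolClass.of_bddLip_wt (BddLip.const 4)).ite ((symbolClass_waveSpeed_mul_sq hκ).add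
      (.of_bddLip_wt (bddLip_lamPlus hκ).neg)) (fun k => sq_nonneg _) _
  have hinv := hden.inv (fun k => pow_pos (wt_pos k) 2) (c := 1 / 4)
    (by norm_num) fun ε K k _ _ hK => by
      have e : waveSpeed κ ε ^ 2 * (K * k) ^ 2 + -lamPlus κ (K * k)
        = -xiSymbol κ (waveSpeed κ ε) (K * k) := by rw [xiSymbol]; ring
      rw [e]
      split_ifs with hk
      · rcases hk with rfl | rfl <;> norm_num [wt]
      · rcases eq_or_ne k 0 with rfl | hk0
        · have h := le_lamPlus hκ 0
          rw [wt_zero, Int.cast_zero, mul_zero, xiSymbol, abs_neg]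
          refine le_trans ?_ (le_abs_self _)
          linarith
        · refine le_trans ?_ ((xiSymbol_le hκ hK hk0 hk).trans (le_abs_self _))
          linarith [wt_sq_le hk0]
  have hnum : SymbolClass κ (fun _ => 1) fun ε K k => if k = 1 ∨ k = -1 then 0
      else -(ε ^ 2 * lamPlus κ (K * k)) := by
    refine SymbolClass.ite (.of_bddLip (BddLip.const 0)) ?_ (by simp) _
    simpa using symbolClass_eps_sq_mul (κ := κ) (bddLip_lamPlus hκ).neg
  convert hnum.mul hinv (by simp) (fun k => inv_pos.2 (pow_pos (wt_pos k) 2)) using 4 with k ε K k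
  · simp
  · rw [opticalSymbol]
    split_ifs
    · simp
    · rw [xiSymbol, ← sub_eq_add_neg, ← neg_sub (lamPlus κ (K * k)), inv_neg,
        show -waveSpeed κ ε ^ 2 * (K * k) ^ 2 + lamPlus κ (K * k)
          = lamPlus κ (K * k) - waveSpeed κ ε ^ 2 * (K * k) ^ 2 by ring]
      ring

/-- The symbol taking the Fourier coefficients of the nonlinearity to those of the solution. -/
def solutionSymbol (κ : ℝ) (d : Fin 2 → ℝ → ℝ) (i j : Fin 2) (ε K : ℝ) (k : ℤ) : ℝ :=
  -(![acousticSymbol κ ε K k, opticalSymbol κ ε K k] i * (eigMatrix κ d (K * k))⁻¹ i j)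

theorem symbolClass_solutionSymbol {κ : ℝ} (hκ : 1 < κ) {d : Fin 2 → ℝ → ℝ}
    (hd : IsNormalization d) (i j : Fin 2) :
    SymbolClass κ (fun k => (wt k)⁻¹ ^ 2) (solutionSymbol κ d i j) := by
  have hP := SymbolClass.of_bddLip (κ := κ) (bddLip_inv_eigMatrix hκ hd i j).neg
  have hw : ∀ k, 0 < (wt k)⁻¹ ^ 2 := fun k => pow_pos (inv_pos.2 (wt_pos k)) 2
  match i with
  | 0 =>
    have e : solutionSymbol κ d 0 j = fun ε K k =>
        acousticSymbol κ ε K k * -(eigMatrix κ d (K * k))⁻¹ 0 j := by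
      funext ε K k
      simp [solutionSymbol]
    rw [e]
    simpa using (symbolClass_acoustic hκ).mul hP hw (by simp)
  | 1 =>
    have e : solutionSymbol κ d 1 j = fun ε K k =>
        opticalSymbol κ ε K k * -(eigMatrix κ d (K * k))⁻¹ 1 j := by
      funext ε K k
      simp [solutionSymbol]
    rw [e]
    simpa using (symbolClass_optical hκ).mul hP hw (by simp)

theorem CBound.mul_sub_mul {ι : Type*} {n : ℕ} {w : ι → ℝ} {f f' g g' : ι → ℝ → ℝ}
    (hf : CBound n (fun _ => 1) f) (hg' : CBound n (fun _ => 1) g')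
    (hff : CBound n w fun i y => f i y - f' i y) (hgg : CBound n w fun i y => g i y - g' i y) :
    CBound n w fun i y => f i y * g i y - f' i y * g' i y := by
  have h1 := CBound.mul (w := w) hf hgg (by simp)
  have h2 := CBound.mul (w := w) hff hg' (by simp)
  convert h1.add h2 using 3
  ring

/-- The symbol has order -1, as differences of order -2 symbols in `K` do. Cauchy–Schwarz uses up
this single order, so the level `n` is kept without gain. -/
theorem LBound.symbol_mul_of_order_one {ι : Type*} {n : ℕ} {w w₁ w₂ : ι → ℝ} {x S : ι → ℤ → ℝ}
    (hS : SBound (fun k => wt k * ((wt k)⁻¹) ^ 2) w₁ S) (hx : LBound n w₂ x)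
    (hw : ∀ i, w₁ i * w₂ i = w i) : WBound n w (fun i k => S i k * x i k) := by
  have hS' : SBound (fun k => ((wt k)⁻¹) ^ 2) w₁ (fun i k => (wt k)⁻¹ * S i k) := by
    obtain ⟨C, hC⟩ := hS
    refine ⟨C, fun i k => ?_⟩
    have h0 := wt_pos k
    rw [abs_mul, abs_of_pos (inv_pos.2 h0), inv_mul_le_iff₀ h0]
    exact (hC i k).trans_eq (by ring)
  have h := WBound.symbol_mul (p := 1) (w := w) (w₁ := fun _ => 1) (S := fun _ k => wt k)
    ⟨1, fun i k => by simp [abs_of_pos (wt_pos k)]⟩ (LBound.symbol_mul hS' hx hw) (by simp)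
  convert h using 3 with i k
  have := (wt_pos k).ne'
  field_simp

/-! ### The nonlinearity in terms of Fourier coefficients -/

/-- The Fourier coefficients of `J θ`. -/
def strainCoeff (κ : ℝ) (d : Fin 2 → ℝ → ℝ) (K : ℝ) (φ : Fin 2 → ℤ → ℝ) (i : Fin 2) (k : ℤ) : ℝ :=
  ∑ j, eigMatrix κ d (K * k) i j * φ j k

/-- The function `J θ`. -/
def strain (κ : ℝ) (d : Fin 2 → ℝ → ℝ) (K : ℝ) (φ : Fin 2 → ℤ → ℝ) (i : Fin 2) : ℝ → ℝ :=
  trigSeries (strainCoeff κ d K φ i) 0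

/-- The nonlinear part of the scaled spring forces. -/
def force (κ β : ℝ) (N : Fin 2 → ℝ → ℝ) (i : Fin 2) (b u : ℝ) : ℝ :=
  u * u * (![β / κ, 1] i + ![1 / κ, 1] i * (b * u * N i (b * u)))

/-- The Fourier coefficients of the nonlinear part of the spring forces. -/
def forceCoeff (κ β : ℝ) (N d : Fin 2 → ℝ → ℝ) (K b : ℝ) (φ : Fin 2 → ℤ → ℝ) (i : Fin 2) :
    ℤ → ℝ :=
  reCoeff fun y => force κ β N i b (strain κ d K φ i y)

/-- The Fourier coefficients of the nonlinearity under a multiplier with row symbol `T`. -/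
def responseCoeff (κ β : ℝ) (N d : Fin 2 → ℝ → ℝ) (T : Fin 2 → ℝ → ℝ → ℤ → ℝ) (ε K b : ℝ)
    (φ : Fin 2 → ℤ → ℝ) (k : ℤ) : ℝ :=
  ∑ j, T j ε K k * forceCoeff κ β N d K b φ j k

section

variable {ι : Type*} {κ β : ℝ} {N d : Fin 2 → ℝ → ℝ} {n : ℕ} {w : ι → ℝ} {ε K K' b b' : ι → ℝ}
  {φ φ' : ι → Fin 2 → ℤ → ℝ} {g : ℤ → ℝ} {S : ℝ → ℝ → ℤ → ℝ}

theorem SymbolClass.sBound (hS : SymbolClass κ g S) (hε : ∀ i, 0 < ε i ∧ ε i ≤ 1)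
    (hK : ∀ i, WaveNumber κ (ε i) (K i)) :
    SBound g (fun _ => 1) (fun i k => S (ε i) (K i) k) := by
  obtain ⟨C, hC⟩ := hS
  exact ⟨C, fun i k => by simpa using (hC _ _ _ k (hε i).1 (hε i).2 (hK i) (hK i)).1⟩

theorem SymbolClass.sBound_sub (hS : SymbolClass κ g S) (hg : ∀ k, 0 ≤ g k)
    (hε : ∀ i, 0 < ε i ∧ ε i ≤ 1) (hK : ∀ i, WaveNumber κ (ε i) (K i))
    (hK' : ∀ i, WaveNumber κ (ε i) (K' i)) (hw : ∃ C, ∀ i, |K i - K' i| ≤ C * w i) :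
    SBound (fun k => wt k * g k) w (fun i k => S (ε i) (K i) k - S (ε i) (K' i) k) := by
  obtain ⟨C, hC⟩ := hS
  obtain ⟨D, hD⟩ := hw
  refine ⟨|C| * D, fun i k => (hC _ _ _ k (hε i).1 (hε i).2 (hK i) (hK' i)).2.trans ?_⟩
  have := hD i
  have := (wt_pos k).le
  have := hg k
  calc C * (wt k * g k) * |K i - K' i| ≤ |C| * (wt k * g k) * (D * w i) := by
        gcongr
        exact le_abs_self C
    _ = _ := by ring

theorem WBound.strainCoeff (hκ : 1 < κ) (hd : IsNormalization d) (hε : ∀ i, 0 < ε i ∧ ε i ≤ 1)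
    (hK : ∀ i, WaveNumber κ (ε i) (K i)) (hφ : ∀ j, WBound n w fun i => φ i j) (m : Fin 2) :
    WBound n w fun i => strainCoeff κ d (K i) (φ i) m := by
  have h : ∀ j, WBound n w fun i k => eigMatrix κ d (K i * k) m j * φ i j k := fun j =>
    WBound.symbol_mul (p := 0) (w₁ := fun _ => 1)
      (by simpa using (SymbolClass.of_bddLip (bddLip_eigMatrix hκ hd m j)).sBound hε hK)
      (hφ j) (by simp)
  unfold SpringDimer.strainCoeff
  simpa only [Fin.sum_univ_two] using (h 0).add (h 1)

theorem WBound.strain (hκ : 1 < κ) (hd : IsNormalization d) (hε : ∀ i, 0 < ε i ∧ ε i ≤ 1)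
    (hK : ∀ i, WaveNumber κ (ε i) (K i)) (hφ : ∀ j, WBound n w fun i => φ i j) (m : Fin 2) :
    CBound n w fun i => strain κ d (K i) (φ i) m :=
  (WBound.strainCoeff hκ hd hε hK hφ m).trigSeries 0

/-- Split as `J(K)(φ - φ') + (J(K) - J(K')) φ'`. The second term costs a factor `k` on `φ'`, hence
the bounds one level above that of the difference. -/
theorem WBound.strain_sub (hκ : 1 < κ) (hd : IsNormalization d) (hε : ∀ i, 0 < ε i ∧ ε i ≤ 1)
    (hK : ∀ i, WaveNumber κ (ε i) (K i)) (hK' : ∀ i, WaveNumber κ (ε i) (K' i))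
    (hφ : ∀ j, WBound (n + 1) (fun _ => 1) fun i => φ i j)
    (hφ' : ∀ j, WBound (n + 1) (fun _ => 1) fun i => φ' i j)
    (hφφ : ∀ j, WBound n w fun i k => φ i j k - φ' i j k)
    (hKK : ∃ C, ∀ i, |K i - K' i| ≤ C * w i) (m : Fin 2) :
    CBound n w fun i y => SpringDimer.strain κ d (K i) (φ i) m y
      - SpringDimer.strain κ d (K' i) (φ' i) m y := by
  have hw : ∀ j, SymbolClass κ (fun _ => 1) fun _ K k => eigMatrix κ d (K * k) m j := fun j =>
    SymbolClass.of_bddLip (bddLip_eigMatrix hκ hd m j)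
  have h2 : ∀ j, WBound n w fun i k =>
      (eigMatrix κ d (K i * k) m j - eigMatrix κ d (K' i * k) m j) * φ' i j k := fun j =>
    WBound.symbol_mul (p := 1) (w₁ := w) (w₂ := fun _ => 1)
      (by simpa using (hw j).sBound_sub (by simp) hε hK hK' hKK) (hφ' j) (by simp)
  have h1 := WBound.strainCoeff hκ hd hε hK hφφ m
  have h3 : WBound n w fun i k =>
      SpringDimer.strainCoeff κ d (K i) (φ i) m k - SpringDimer.strainCoeff κ d (K' i) (φ' i) m k := by
    convert h1.add ((h2 0).add (h2 1)) using 3 with i k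
    simp only [SpringDimer.strainCoeff, Fin.sum_univ_two]
    ring
  convert h3.trigSeries 0 using 3 with i y
  exact (trigSeries_sub ((WBound.strainCoeff hκ hd hε hK hφ m).summable_abs i)
    ((WBound.strainCoeff hκ hd hε hK' hφ' m).summable_abs i) 0 y).symm

theorem contDiff_mul_self_apply (hN : ∀ i, ContDiff ℝ ∞ (N i)) (m : Fin 2) :
    ContDiff ℝ ∞ fun z => z * N m z :=
  contDiff_id.mul (hN m)

theorem CBound.force (hN : ∀ i, ContDiff ℝ ∞ (N i)) (hb : ∀ i, |b i| ≤ 1) {u : ι → ℝ → ℝ}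
    (hu : CBound n (fun _ => 1) u) (m : Fin 2) :
    CBound n (fun _ => 1) fun i y => force κ β N m (b i) (u i y) := by
  have hb' : CBound n (fun _ => 1) fun i _ => b i := .const ⟨1, by simpa using hb⟩
  have hc : ∀ c : ℝ, CBound (ι := ι) n (fun _ => 1) fun _ _ => c := fun c => .const ⟨|c|, by simp⟩
  exact (hu.mul hu (w := fun _ => 1) (by simp)).mul ((hc _).add ((hc _).mul
    (CBound.comp (contDiff_mul_self_apply hN m) (hb'.mul hu (w := fun _ => 1) (by simp)))
      (by simp))) (by simp)

theorem CBound.force_sub (hN : ∀ i, ContDiff ℝ ∞ (N i)) (hb : ∀ i, |b i| ≤ 1)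
    (hb' : ∀ i, |b' i| ≤ 1) {u u' : ι → ℝ → ℝ} (hu : CBound n (fun _ => 1) u)
    (hu' : CBound n (fun _ => 1) u') (huu : CBound n w fun i y => u i y - u' i y)
    (hbb : ∃ C, ∀ i, |b i - b' i| ≤ C * w i) (m : Fin 2) :
    CBound n w fun i y =>
      SpringDimer.force κ β N m (b i) (u i y) - SpringDimer.force κ β N m (b' i) (u' i y) := by
  have h1 : CBound n (fun _ => 1) fun i _ => b i := .const ⟨1, by simpa using hb⟩
  have h1' : CBound n (fun _ => 1) fun i _ => b' i := .const ⟨1, by simpa using hb'⟩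
  have hc : ∀ c : ℝ, CBound (ι := ι) n (fun _ => 1) fun _ _ => c := fun c => .const ⟨|c|, by simp⟩
  have hH := contDiff_mul_self_apply hN m
  have hm := h1.mul hu (w := fun _ => 1) (by simp)
  have hm' := h1'.mul hu' (w := fun _ => 1) (by simp)
  have hq := CBound.comp_sub hH hm hm' (CBound.mul_sub_mul h1 hu' (.const hbb) huu)
  have hr' := (hc (![β / κ, 1] m)).add ((hc (![1 / κ, 1] m)).mul (CBound.comp hH hm')
    (w := fun _ => 1) (by simp))
  have hr : CBound n w fun i y =>
      (![β / κ, 1] m + ![1 / κ, 1] m * (b i * u i y * N m (b i * u i y)))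
        - (![β / κ, 1] m + ![1 / κ, 1] m * (b' i * u' i y * N m (b' i * u' i y))) := by
    convert (hc (![1 / κ, 1] m)).mul hq (w := w) (by simp) using 3
    ring
  exact CBound.mul_sub_mul (hu.mul hu (w := fun _ => 1) (by simp)) hr'
    (CBound.mul_sub_mul hu hu' huu huu) hr

theorem force_strain_periodic (κ β : ℝ) (N d : Fin 2 → ℝ → ℝ) (K b : ℝ) (φ : Fin 2 → ℤ → ℝ)
    (m : Fin 2) : Function.Periodic (fun y => force κ β N m b (strain κ d K φ m y))
      (2 * Real.pi) := fun y => by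
  simp only [strain, trigSeries_periodic _ 0 y]

theorem WBound.response (hκ : 1 < κ) (hN : ∀ i, ContDiff ℝ ∞ (N i)) (hd : IsNormalization d)
    (hε : ∀ i, 0 < ε i ∧ ε i ≤ 1) (hK : ∀ i, WaveNumber κ (ε i) (K i)) (hb : ∀ i, |b i| ≤ 1)
    (hφ : ∀ j, WBound n (fun _ => 1) fun i => φ i j) {T : Fin 2 → ℝ → ℝ → ℤ → ℝ}
    (hT : ∀ j, SymbolClass κ (fun k => (wt k)⁻¹ ^ 2) (T j)) :
    WBound (n + 1) (fun _ => 1) fun i => responseCoeff κ β N d T (ε i) (K i) (b i) (φ i) := by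
  have h : ∀ j, WBound (n + 1) (fun _ => 1) fun i k =>
      T j (ε i) (K i) k * forceCoeff κ β N d (K i) (b i) (φ i) j k := fun j =>
    LBound.symbol_mul ((hT j).sBound hε hK)
      (((WBound.strain hκ hd hε hK hφ j).force hN hb j).reCoeff
        fun i => force_strain_periodic κ β N d (K i) (b i) (φ i) j) (by simp)
  unfold responseCoeff
  simpa only [Fin.sum_univ_two] using (h 0).add (h 1)

/-- With `f` the force coefficients, `T f - T' f' = T (f - f') + (T - T') f'`. The first term gains
a level over the difference of the profiles; the second has a symbol of order -1 only, but acts on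
`f'`, which is bounded at level `n + 1`. The derivative lost by varying `K` is thus recovered. -/
theorem WBound.response_sub (hκ : 1 < κ) (hN : ∀ i, ContDiff ℝ ∞ (N i)) (hd : IsNormalization d)
    (hε : ∀ i, 0 < ε i ∧ ε i ≤ 1) (hK : ∀ i, WaveNumber κ (ε i) (K i))
    (hK' : ∀ i, WaveNumber κ (ε i) (K' i)) (hb : ∀ i, |b i| ≤ 1) (hb' : ∀ i, |b' i| ≤ 1)
    (hφ : ∀ j, WBound (n + 1) (fun _ => 1) fun i => φ i j)
    (hφ' : ∀ j, WBound (n + 1) (fun _ => 1) fun i => φ' i j)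
    (hφφ : ∀ j, WBound n w fun i k => φ i j k - φ' i j k)
    (hKK : ∃ C, ∀ i, |K i - K' i| ≤ C * w i) (hbb : ∃ C, ∀ i, |b i - b' i| ≤ C * w i)
    {T : Fin 2 → ℝ → ℝ → ℤ → ℝ} (hT : ∀ j, SymbolClass κ (fun k => (wt k)⁻¹ ^ 2) (T j)) :
    WBound (n + 1) w fun i k => responseCoeff κ β N d T (ε i) (K i) (b i) (φ i) k
      - responseCoeff κ β N d T (ε i) (K' i) (b' i) (φ' i) k := by
  have h : ∀ j, WBound (n + 1) w fun i k =>
      T j (ε i) (K i) k * forceCoeff κ β N d (K i) (b i) (φ i) j k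
        - T j (ε i) (K' i) k * forceCoeff κ β N d (K' i) (b' i) (φ' i) j k := by
    intro j
    have hu := WBound.strain hκ hd hε hK hφ j
    have hu' := WBound.strain hκ hd hε hK' hφ' j
    have hf := hu.force (κ := κ) (β := β) hN hb j
    have hf' := hu'.force (κ := κ) (β := β) hN hb' j
    have hff := CBound.force_sub (κ := κ) (β := β) hN hb hb' hu.of_succ hu'.of_succ
      (WBound.strain_sub hκ hd hε hK hK' hφ hφ' hφφ hKK j) hbb j
    have hp := fun i => force_strain_periodic κ β N d (K i) (b i) (φ i) j
    have hp' := fun i => force_strain_periodic κ β N d (K' i) (b' i) (φ' i) j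
    have hg : LBound n w fun i k => forceCoeff κ β N d (K i) (b i) (φ i) j k
        - forceCoeff κ β N d (K' i) (b' i) (φ' i) j k := by
      convert hff.reCoeff (fun i => (hp i).sub (hp' i)) using 3 with i k
      exact (reCoeff_sub (hf.continuous i) (hf'.continuous i) k).symm
    have h1 := LBound.symbol_mul (w := w) ((hT j).sBound hε hK) hg (by simp)
    have h2 := LBound.symbol_mul_of_order_one (w := w) ((hT j).sBound_sub
      (fun k => sq_nonneg _) hε hK hK' hKK) (hf'.reCoeff hp') (by simp)
    convert h1.add h2 using 3 with i k
    simp only [forceCoeff]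
    ring
  convert (h 0).add (h 1) using 3 with i k
  simp only [responseCoeff, Fin.sum_univ_two]
  ring

end

/-! ### The bifurcation equation as a fixed point problem -/

theorem exists_fixedPoint_of_half_lipschitz {F : Type*} [NormedAddCommGroup F] [CompleteSpace F]
    {Ψ : F → F} (h1 : ∀ z, ‖z‖ ≤ 1 → ‖Ψ z‖ ≤ 1)
    (h2 : ∀ z z', ‖z‖ ≤ 1 → ‖z'‖ ≤ 1 → ‖Ψ z - Ψ z'‖ ≤ 1 / 2 * ‖z - z'‖) :
    ∃ z, ‖z‖ ≤ 1 ∧ Ψ z = z := by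
  have hmaps : Set.MapsTo Ψ (Metric.closedBall 0 1) (Metric.closedBall 0 1) := fun z hz => by
    simpa using h1 z (by simpa using hz)
  have hc : ContractingWith (1 / 2) (hmaps.restrict Ψ _ _) := by
    refine ⟨by rw [← NNReal.coe_lt_coe]; norm_num, LipschitzWith.of_dist_le_mul fun z z' => ?_⟩
    have := h2 z z' (mem_closedBall_zero_iff.1 z.2) (mem_closedBall_zero_iff.1 z'.2)
    simpa [Subtype.dist_eq, dist_eq_norm] using this
  obtain ⟨y, hy, hfix, -⟩ := ContractingWith.exists_fixedPoint'
    (Metric.isClosed_closedBall (x := (0 : F)) (ε := 1)).isComplete hmaps hc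
    (x := 0) (by simp) (edist_ne_top _ _)
  exact ⟨y, by simpa using hy, hfix⟩

/-! ### The unknowns and the response map -/

/-- The Fourier coefficients of `ν`. -/
def nuCoeff (i : Fin 2) (k : ℤ) : ℝ := if i = 1 ∧ (k = 1 ∨ k = -1) then 1 / 2 else 0

theorem nuCoeff_zero (k : ℤ) : nuCoeff 0 k = 0 := by simp [nuCoeff]

theorem nuCoeff_neg (i : Fin 2) (k : ℤ) : nuCoeff i (-k) = nuCoeff i k := by
  have : (-k = 1 ∨ -k = -1) ↔ (k = 1 ∨ k = -1) := by omega
  simp only [nuCoeff, this]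

theorem wBound_nuCoeff {ι : Type*} (n : ℕ) (i : Fin 2) :
    WBound n (fun _ : ι => 1) fun _ => nuCoeff i := by
  have hs : Summable fun k => wt k ^ n * |nuCoeff i k| := by
    refine summable_of_ne_finset_zero (s := {1, -1}) fun k hk => ?_
    simp only [Finset.mem_insert, Finset.mem_singleton] at hk
    simp [nuCoeff, hk]
  exact ⟨_, fun _ => ⟨hs, by rw [mul_one]⟩⟩

/-- The symbol of the bifurcation equation, concentrated at the mode `k = 1`. -/
def criticalSymbol (κ : ℝ) (d : Fin 2 → ℝ → ℝ) (j : Fin 2) (_ε K : ℝ) (k : ℤ) : ℝ :=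
  if k = 1 then -2 * (lamPlus κ (K * k) * (eigMatrix κ d (K * k))⁻¹ 1 j) else 0

/-- The factor `-2` in the symbol inverts the coefficient `1/2` of `ν` at `k = 1`. Support in a
single mode permits any decay rate; the rate -2 lets the response estimates cover the bifurcation
equation as well. -/
theorem symbolClass_criticalSymbol {κ : ℝ} (hκ : 1 < κ) {d : Fin 2 → ℝ → ℝ}
    (hd : IsNormalization d) (j : Fin 2) :
    SymbolClass κ (fun k => (wt k)⁻¹ ^ 2) (criticalSymbol κ d j) := by
  obtain ⟨C, hC⟩ := SymbolClass.of_bddLip (κ := κ)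
    ((BddLip.const (-2)).mul ((bddLip_lamPlus hκ).mul (bddLip_inv_eigMatrix hκ hd 1 j)))
  -- At `k = 1` the weight is `wt 1 = 2`, so `wt⁻²` is `1/4`.
  refine ⟨4 * C, fun ε K L k h1 h2 h3 h4 => ?_⟩
  obtain ⟨ha, hb⟩ := hC ε K L k h1 h2 h3 h4
  have hC0 : 0 ≤ C := by simpa using (abs_nonneg _).trans ha
  have hk := wt_pos k
  unfold criticalSymbol
  split_ifs with h
  · have : wt k = 2 := by rw [h]; norm_num [wt]
    simp only [this, mul_one] at ha hb ⊢
    exact ⟨ha.trans_eq (by ring), hb.trans_eq (by ring)⟩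
  · simp only [abs_zero, sub_zero]
    constructor <;> positivity

/-- The unknowns: weighted Fourier coefficients and the scaled detuning of the wave number. -/
abbrev Unknown : Type := (Fin 2 → lp (fun _ : ℤ => ℝ) 1) × ℝ

/-- The Fourier coefficients of the profile. -/
def Unknown.coeff (z : Unknown) (i : Fin 2) (k : ℤ) : ℝ := nuCoeff i k + (wt k)⁻¹ * z.1 i k

theorem lp_one_summable (x : lp (fun _ : ℤ => ℝ) 1) : Summable fun k => |x k| := by
  simpa using (lp.memℓp x).summable (by norm_num)

theorem lp_one_norm (x : lp (fun _ : ℤ => ℝ) 1) : ‖x‖ = ∑' k, |x k| := by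
  simpa using lp.norm_eq_tsum_rpow (p := 1) (by norm_num) x

theorem Unknown.wBound {ι : Type*} (z : ι → Unknown) (j : Fin 2) :
    WBound 1 (fun i => ‖z i‖) fun i k => (wt k)⁻¹ * (z i).1 j k := by
  refine WBound.of_le ⟨1, fun i => ⟨_, lp_one_summable ((z i).1 j), fun k => ?_, ?_⟩⟩
  · have := wt_pos k
    rw [abs_mul, abs_of_pos (inv_pos.2 this), pow_one, mul_inv_cancel_left₀ this.ne']
  · rw [one_mul, ← lp_one_norm]
    exact (norm_le_pi_norm _ j).trans (norm_fst_le _)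

theorem WBound.weaken {ι : Type*} {n : ℕ} {w w' : ι → ℝ} {x : ι → ℤ → ℝ} (h : WBound n w x)
    (hw : ∃ D, 0 ≤ D ∧ ∀ i, 0 ≤ w i ∧ w i ≤ D * w' i) : WBound n w' x := by
  obtain ⟨C, hC⟩ := h
  obtain ⟨D, hD, hw⟩ := hw
  refine ⟨|C| * D, fun i => ⟨(hC i).1, (hC i).2.trans ?_⟩⟩
  calc C * w i ≤ |C| * (D * w' i) :=
        mul_le_mul (le_abs_self C) (hw i).2 (hw i).1 (abs_nonneg _)
    _ = _ := by ring

/-- The wave number `K` with `ξ(K) = t`. -/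
def rootNumber (κ ε t : ℝ) : ℝ :=
  Classical.epsilon fun K => WaveNumber κ ε K ∧ xiSymbol κ (waveSpeed κ ε) K = t

theorem rootNumber_spec {κ : ℝ} (hκ : 1 < κ) (ε : ℝ) {t : ℝ} (h1 : -1 ≤ t) (h2 : t ≤ κ - 1) :
    WaveNumber κ ε (rootNumber κ ε t) ∧ xiSymbol κ (waveSpeed κ ε) (rootNumber κ ε t) = t :=
  Classical.epsilon_spec (exists_waveNumber hκ ε h1 h2)

/-- This is where the threshold `min 1 (κ - 1)` for `ε` comes from: since `ε² ≤ ε`, detunings in the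
unit ball keep `ε² τ` in the range where `ξ(K) = ε² τ` has a root in the window. -/
theorem eps_sq_mul_mem {κ ε τ : ℝ} (hε : 0 < ε) (hε' : ε < min 1 (κ - 1)) (hτ : |τ| ≤ 1) :
    -1 ≤ ε ^ 2 * τ ∧ ε ^ 2 * τ ≤ κ - 1 := by
  have h1 := hε'.trans_le (min_le_left _ _)
  have h2 := hε'.trans_le (min_le_right _ _)
  have h3 : ε ^ 2 ≤ ε := by nlinarith
  obtain ⟨h4, h5⟩ := abs_le.1 hτ
  have h6 := sq_nonneg ε
  constructor <;> nlinarith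

/-- The wave number belonging to an unknown. -/
def Unknown.waveNumber (κ ε : ℝ) (z : Unknown) : ℝ := rootNumber κ ε (ε ^ 2 * z.2)

open Classical in
/-- The element of `ℓ¹` with given entries, zero if they are not summable. -/
def toLpOne (x : ℤ → ℝ) : lp (fun _ : ℤ => ℝ) 1 :=
  if h : Memℓp x 1 then ⟨x, h⟩ else 0

theorem toLpOne_apply {x : ℤ → ℝ} (h : Summable fun k => |x k|) (k : ℤ) : toLpOne x k = x k := by
  have : Memℓp (E := fun _ : ℤ => ℝ) x 1 := memℓp_gen (by simpa using h)
  rw [toLpOne, dif_pos this]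

/-- The response map, of which the solutions of the problem are the fixed points up to the factor
`a`. -/
def responseMap (κ β : ℝ) (N d : Fin 2 → ℝ → ℝ) (ε a : ℝ) (z : Unknown) : Unknown :=
  (fun i => toLpOne fun k => wt k * responseCoeff κ β N d (solutionSymbol κ d i) ε
      (z.waveNumber κ ε) (ε ^ 2 * a) z.coeff k,
    responseCoeff κ β N d (criticalSymbol κ d) ε (z.waveNumber κ ε) (ε ^ 2 * a) z.coeff 1)

theorem WBound.abs_le {ι : Type*} {n : ℕ} {w : ι → ℝ} {x : ι → ℤ → ℝ} (h : WBound n w x) (k : ℤ) :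
    ∃ C, ∀ i, |x i k| ≤ C * w i := by
  obtain ⟨C, hC⟩ := h.mono (Nat.zero_le n)
  simp only [pow_zero, one_mul] at hC
  exact ⟨C, fun i => ((hC i).1.le_tsum k fun _ _ => abs_nonneg _).trans (hC i).2⟩

theorem Unknown.norm_le {z : Unknown} {C : ℝ} (h1 : ∀ i, ∑' k, |z.1 i k| ≤ C) (h2 : |z.2| ≤ C) :
    ‖z‖ ≤ C := by
  refine norm_prod_le_iff.2 ⟨(pi_norm_le_iff_of_nonneg ((abs_nonneg _).trans h2)).2 fun i => ?_, h2⟩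
  rw [lp_one_norm]
  exact h1 i

/-- Uniformity is obtained by applying the family estimates to the family of all admissible
parameters at once, with weight 1 for bounds and `‖z - z'‖ + |a - a'|` for differences. -/
theorem responseMap_bounds {κ : ℝ} (hκ : 1 < κ) (β : ℝ) {N d : Fin 2 → ℝ → ℝ}
    (hN : ∀ i, ContDiff ℝ ∞ (N i)) (hd : IsNormalization d) :
    ∃ C, 1 ≤ C ∧ ∀ ε a a' z z', 0 < ε → ε < min 1 (κ - 1) → |a| ≤ 1 → |a'| ≤ 1 → ‖z‖ ≤ 1 →
      ‖z'‖ ≤ 1 → (∀ i k, (responseMap κ β N d ε a z).1 i k = wt k * responseCoeff κ β N d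
        (solutionSymbol κ d i) ε (z.waveNumber κ ε) (ε ^ 2 * a) z.coeff k) ∧
      ‖responseMap κ β N d ε a z‖ ≤ C ∧
      ‖responseMap κ β N d ε a z - responseMap κ β N d ε a' z'‖ ≤ C * (‖z - z'‖ + |a - a'|) := by
  let ι := {p : ℝ × (ℝ × Unknown) × (ℝ × Unknown) // 0 < p.1 ∧ p.1 < min 1 (κ - 1) ∧
    |p.2.1.1| ≤ 1 ∧ |p.2.2.1| ≤ 1 ∧ ‖p.2.1.2‖ ≤ 1 ∧ ‖p.2.2.2‖ ≤ 1}
  let ε : ι → ℝ := fun i => i.1.1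
  let a : ι → ℝ := fun i => i.1.2.1.1
  let a' : ι → ℝ := fun i => i.1.2.2.1
  let z : ι → Unknown := fun i => i.1.2.1.2
  let z' : ι → Unknown := fun i => i.1.2.2.2
  let w : ι → ℝ := fun i => ‖z i - z' i‖ + |a i - a' i|
  have hε : ∀ i, 0 < ε i ∧ ε i ≤ 1 := fun i =>
    ⟨i.2.1, (i.2.2.1.trans_le (min_le_left _ _)).le⟩
  have hε2 : ∀ i, ε i ^ 2 ≤ 1 := fun i => pow_le_one₀ (hε i).1.le (hε i).2
  have hsnd : ∀ z : Unknown, ‖z‖ ≤ 1 → |z.2| ≤ 1 := fun z h => (norm_snd_le z).trans h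
  have hb : ∀ i, |ε i ^ 2 * a i| ≤ 1 := fun i => by
    rw [abs_mul, abs_of_nonneg (sq_nonneg _)]
    exact mul_le_one₀ (hε2 i) (abs_nonneg _) i.2.2.2.1
  have hb' : ∀ i, |ε i ^ 2 * a' i| ≤ 1 := fun i => by
    rw [abs_mul, abs_of_nonneg (sq_nonneg _)]
    exact mul_le_one₀ (hε2 i) (abs_nonneg _) i.2.2.2.2.1
  have hKs : ∀ i, _ := fun i => rootNumber_spec hκ (ε i)
    (eps_sq_mul_mem i.2.1 i.2.2.1 (hsnd (z i) i.2.2.2.2.2.1)).1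
    (eps_sq_mul_mem i.2.1 i.2.2.1 (hsnd (z i) i.2.2.2.2.2.1)).2
  have hKs' : ∀ i, _ := fun i => rootNumber_spec hκ (ε i)
    (eps_sq_mul_mem i.2.1 i.2.2.1 (hsnd (z' i) i.2.2.2.2.2.2)).1
    (eps_sq_mul_mem i.2.1 i.2.2.1 (hsnd (z' i) i.2.2.2.2.2.2)).2
  have hK : ∀ i, WaveNumber κ (ε i) ((z i).waveNumber κ (ε i)) := fun i => (hKs i).1
  have hK' : ∀ i, WaveNumber κ (ε i) ((z' i).waveNumber κ (ε i)) := fun i => (hKs' i).1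
  have hKK : ∃ C, ∀ i, |(z i).waveNumber κ (ε i) - (z' i).waveNumber κ (ε i)| ≤ C * w i := by
    -- The lower slope `4/5` of `ξ` and `ε ≤ 1` give `|K - K'| ≤ 5/4 ‖z - z'‖`, rounded up to 2.
    refine ⟨2, fun i => ?_⟩
    have h := abs_sub_le_xiSymbol_sub hκ (hK i) (hK' i)
    unfold Unknown.waveNumber at h ⊢
    rw [(hKs i).2, (hKs' i).2, ← mul_sub, abs_mul, abs_of_nonneg (sq_nonneg i.1.1)] at h
    have h3 : |(z i).2 - (z' i).2| ≤ ‖z i - z' i‖ := norm_snd_le (z i - z' i)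
    have h4 := mul_le_mul (hε2 i) h3 (abs_nonneg _) zero_le_one
    have h5 := abs_nonneg (a i - a' i)
    have h6 := norm_nonneg (z i - z' i)
    simp only [w]
    linarith
  have hbb : ∃ C, ∀ i, |ε i ^ 2 * a i - ε i ^ 2 * a' i| ≤ C * w i := by
    refine ⟨1, fun i => ?_⟩
    rw [← mul_sub, abs_mul, abs_of_nonneg (sq_nonneg _)]
    have h6 := norm_nonneg (z i - z' i)
    refine (mul_le_of_le_one_left (abs_nonneg _) (hε2 i)).trans ?_
    simp only [w]
    linarith
  have hφ : ∀ j, WBound 1 (fun _ => 1) fun i => (z i).coeff j := fun j =>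
    (wBound_nuCoeff 1 j).add ((Unknown.wBound z j).weaken
      ⟨1, zero_le_one, fun i => ⟨norm_nonneg _, by simpa using i.2.2.2.2.2.1⟩⟩)
  have hφ' : ∀ j, WBound 1 (fun _ => 1) fun i => (z' i).coeff j := fun j =>
    (wBound_nuCoeff 1 j).add ((Unknown.wBound z' j).weaken
      ⟨1, zero_le_one, fun i => ⟨norm_nonneg _, by simpa using i.2.2.2.2.2.2⟩⟩)
  -- Level 0 suffices for the difference although the unknowns live at level 1: the response
  -- estimate returns level 1.
  have hφφ : ∀ j, WBound 0 w fun i k => (z i).coeff j k - (z' i).coeff j k := fun j => by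
    have h := ((Unknown.wBound (fun i => z i - z' i) j).weaken (w' := w) ⟨1, zero_le_one, fun i =>
      ⟨norm_nonneg _, by simp [w]⟩⟩).mono zero_le_one
    convert h using 3 with i k
    simp [Unknown.coeff, mul_sub]
  have hsol := symbolClass_solutionSymbol hκ hd
  have hcrit := symbolClass_criticalSymbol hκ hd
  have hR := fun m => WBound.response (β := β) hκ hN hd hε hK hb (fun j => (hφ j).mono zero_le_one)
    (hsol m)
  have hR' := fun m => WBound.response (β := β) hκ hN hd hε hK' hb'
    (fun j => (hφ' j).mono zero_le_one) (hsol m)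
  have hD := fun m => WBound.response_sub (β := β) (w := w) hκ hN hd hε hK hK' hb hb' hφ hφ' hφφ
    hKK hbb (hsol m)
  have hQ := (WBound.response (β := β) hκ hN hd hε hK hb (fun j => (hφ j).mono zero_le_one)
    hcrit).abs_le 1
  have hQD := (WBound.response_sub (β := β) (w := w) hκ hN hd hε hK hK' hb hb' hφ hφ' hφφ
    hKK hbb hcrit).abs_le 1
  have happ : ∀ i m k, (responseMap κ β N d (ε i) (a i) (z i)).1 m k = wt k * responseCoeff κ β N d
        (solutionSymbol κ d m) (ε i) ((z i).waveNumber κ (ε i)) (ε i ^ 2 * a i) (z i).coeff k := by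
    intro i m k
    refine toLpOne_apply ?_ k
    simpa only [abs_mul, abs_of_pos (wt_pos _), pow_one, zero_add] using (hR m).summable i
  have happ' : ∀ i m k, (responseMap κ β N d (ε i) (a' i) (z' i)).1 m k = wt k *
        responseCoeff κ β N d (solutionSymbol κ d m) (ε i) ((z' i).waveNumber κ (ε i))
          (ε i ^ 2 * a' i) (z' i).coeff k := by
    intro i m k
    refine toLpOne_apply ?_ k
    simpa only [abs_mul, abs_of_pos (wt_pos _), pow_one, zero_add] using (hR' m).summable i
  choose A hA using hR
  choose B hB using hD
  obtain ⟨P, hP⟩ := hQ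
  obtain ⟨Q, hQ⟩ := hQD
  have hw : ∀ i, 0 ≤ w i := fun i => add_nonneg (norm_nonneg _) (abs_nonneg _)
  let C := 1 + ∑ m, |A m| + ∑ m, |B m| + |P| + |Q|
  have hA0 : 0 ≤ ∑ m, |A m| := Finset.sum_nonneg fun m _ => abs_nonneg _
  have hB0 : 0 ≤ ∑ m, |B m| := Finset.sum_nonneg fun m _ => abs_nonneg _
  have hP0 := abs_nonneg P
  have hQ0 := abs_nonneg Q
  have hAC : ∀ m, A m ≤ C := fun m => by
    have := Finset.single_le_sum (fun m _ => abs_nonneg (A m)) (Finset.mem_univ m)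
    linarith [le_abs_self (A m)]
  have hBC : ∀ m, B m ≤ C := fun m => by
    have := Finset.single_le_sum (fun m _ => abs_nonneg (B m)) (Finset.mem_univ m)
    linarith [le_abs_self (B m)]
  have hC : 1 ≤ C ∧ P ≤ C ∧ Q ≤ C :=
    ⟨by linarith, by linarith [le_abs_self P], by linarith [le_abs_self Q]⟩
  refine ⟨C, hC.1, fun ε₀ a₀ a₀' z₀ z₀' h1 h2 h3 h4 h5 h6 => ?_⟩
  let i : ι := ⟨(ε₀, (a₀, z₀), (a₀', z₀')), h1, h2, h3, h4, h5, h6⟩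
  refine ⟨happ i, Unknown.norm_le (fun m => ?_) ?_, Unknown.norm_le (fun m => ?_) ?_⟩
  · have h := (hA m i).2
    simp only [pow_one, zero_add, mul_one] at h
    refine le_trans (le_of_eq (tsum_congr fun k => ?_)) (h.trans (hAC m))
    rw [happ i m k, abs_mul, abs_of_pos (wt_pos _)]
  · exact (hP i).trans (by simpa using hC.2.1)
  · have h := (hB m i).2
    simp only [pow_one, zero_add] at h
    refine le_trans (le_of_eq (tsum_congr fun k => ?_))
      (h.trans (mul_le_mul_of_nonneg_right (hBC m) (hw i)))
    have e : (responseMap κ β N d ε₀ a₀ z₀ - responseMap κ β N d ε₀ a₀' z₀').1 m k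
      = (responseMap κ β N d ε₀ a₀ z₀).1 m k - (responseMap κ β N d ε₀ a₀' z₀').1 m k := rfl
    rw [e, happ i m k, happ' i m k, ← mul_sub, abs_mul, abs_of_pos (wt_pos _)]
  · exact (hQ i).trans (mul_le_mul_of_nonneg_right hC.2.2 (hw i))

/-! ### Existence and regularity of the Fourier coefficients of the solution -/

/-- The parameters `(ε, a, a')`. -/
abbrev Param (κ A : ℝ) : Type :=
  {p : ℝ × ℝ × ℝ // 0 < p.1 ∧ p.1 < min 1 (κ - 1) ∧ |p.2.1| ≤ A ∧ |p.2.2| ≤ A}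

/-- The equations for the wave number `K` and the coefficients `ψ` of the corrector, divided by
the amplitude. -/
structure IsCoeffSolution (κ β : ℝ) (N d : Fin 2 → ℝ → ℝ) (ε a K : ℝ) (ψ : Fin 2 → ℤ → ℝ) :
    Prop where
  waveNumber : WaveNumber κ ε K
  coeff_eq : ∀ i k, ψ i k = a * responseCoeff κ β N d (solutionSymbol κ d i) ε K (ε ^ 2 * a)
    (fun i k => nuCoeff i k + ψ i k) k
  xi_eq : xiSymbol κ (waveSpeed κ ε) K = ε ^ 2 * (a * responseCoeff κ β N d (criticalSymbol κ d) ε K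
    (ε ^ 2 * a) (fun i k => nuCoeff i k + ψ i k) 1)

/-- Fixed points of `z ↦ a Φ(z)` in the unit ball. The detuning is scaled by `ε²`, so the Lipschitz
bound for `z` in `a` becomes one with a factor `ε²` for `K`; this factor absorbs the later division
by `ε`. -/
theorem exists_coeffSolution {κ : ℝ} (hκ : 1 < κ) (β : ℝ) {N d : Fin 2 → ℝ → ℝ}
    (hN : ∀ i, ContDiff ℝ ∞ (N i)) (hd : IsNormalization d) :
    ∃ A, 0 < A ∧ A ≤ 1 ∧ ∃ (K : ℝ → ℝ → ℝ) (ψ : ℝ → ℝ → Fin 2 → ℤ → ℝ),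
      (∀ ε a, 0 < ε → ε < min 1 (κ - 1) → |a| ≤ A →
        IsCoeffSolution κ β N d ε a (K ε a) (ψ ε a)) ∧
      (∃ C, ∀ ε a a', 0 < ε → ε < min 1 (κ - 1) → |a| ≤ A → |a'| ≤ A →
        |K ε a - K ε a'| ≤ C * ε ^ 2 * |a - a'|) ∧
      (∀ j, WBound 1 (fun _ => 1) fun p : Param κ A => ψ p.1.1 p.1.2.1 j) ∧
      (∀ j, WBound 1 (fun p => |p.1.2.1 - p.1.2.2|) fun (p : Param κ A) k =>
        ψ p.1.1 p.1.2.1 j k - ψ p.1.1 p.1.2.2 j k) := by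
  obtain ⟨C, hC1, hC⟩ := responseMap_bounds hκ β hN hd
  have hC0 : 0 < C := by linarith
  -- Then `|a| C ≤ 1/2`, so `a Φ` maps the unit ball into itself and halves distances.
  set A : ℝ := 1 / (2 * C) with hA
  have hAC : A * C = 1 / 2 := by rw [hA]; field_simp
  have hA0 : 0 < A := by positivity
  have hA1 : A ≤ 1 := by nlinarith
  have hex : ∀ ε a, ∃ z : Unknown, 0 < ε → ε < min 1 (κ - 1) → |a| ≤ A →
      ‖z‖ ≤ 1 ∧ a • responseMap κ β N d ε a z = z := by
    intro ε a
    by_cases h : 0 < ε ∧ ε < min 1 (κ - 1) ∧ |a| ≤ A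
    · obtain ⟨h1, h2, h3⟩ := h
      have h4 := h3.trans hA1
      obtain ⟨z, hz⟩ := exists_fixedPoint_of_half_lipschitz
        (Ψ := fun z => a • responseMap κ β N d ε a z)
        (fun z hz => by
          rw [norm_smul, Real.norm_eq_abs]
          have := mul_le_mul h3 (hC ε a a z z h1 h2 h4 h4 hz hz).2.1 (norm_nonneg _) hA0.le
          linarith)
        (fun z z' hz hz' => by
          have h5 := (hC ε a a z z' h1 h2 h4 h4 hz hz').2.2
          rw [sub_self, abs_zero, add_zero] at h5
          rw [← smul_sub, norm_smul, Real.norm_eq_abs, ← hAC, mul_assoc]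
          exact mul_le_mul h3 h5 (norm_nonneg _) hA0.le)
      exact ⟨z, fun _ _ _ => hz⟩
    · exact ⟨0, fun h1 h2 h3 => absurd ⟨h1, h2, h3⟩ h⟩
  choose z hz using hex
  have hlip : ∀ ε a a', 0 < ε → ε < min 1 (κ - 1) → |a| ≤ A → |a'| ≤ A →
      ‖z ε a - z ε a'‖ ≤ (1 + 2 * C) * |a - a'| := by
    intro ε a a' h1 h2 h3 h4
    obtain ⟨hz1, hz2⟩ := hz ε a h1 h2 h3
    obtain ⟨hz1', hz2'⟩ := hz ε a' h1 h2 h4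
    have hb := hC ε a a' _ _ h1 h2 (h3.trans hA1) (h4.trans hA1) hz1 hz1'
    have hb' := (hC ε a' a' _ _ h1 h2 (h4.trans hA1) (h4.trans hA1) hz1' hz1').2.1
    -- Comparing the two fixed points leaves half of their distance on the right, where it is
    -- absorbed; the rest is `(1/2 + C) |a - a'|`, whence the constant `1 + 2C`.
    have e : z ε a - z ε a' = a • (responseMap κ β N d ε a (z ε a)
        - responseMap κ β N d ε a' (z ε a')) + (a - a') • responseMap κ β N d ε a' (z ε a') := by
      conv_lhs => rw [← hz2, ← hz2']
      rw [smul_sub, sub_smul]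
      abel
    have h5 : ‖z ε a - z ε a'‖ ≤ A * (C * (‖z ε a - z ε a'‖ + |a - a'|)) + |a - a'| * C := by
      conv_lhs => rw [e]
      refine (norm_add_le _ _).trans ?_
      rw [norm_smul, norm_smul, Real.norm_eq_abs, Real.norm_eq_abs]
      exact add_le_add (mul_le_mul h3 hb.2.2 (norm_nonneg _) hA0.le)
        (mul_le_mul_of_nonneg_left hb' (abs_nonneg _))
    rw [← mul_assoc, hAC] at h5
    linarith
  have hroot := fun ε a h1 h2 h3 => rootNumber_spec hκ ε
    (eps_sq_mul_mem h1 h2 ((norm_snd_le _).trans (hz ε a h1 h2 h3).1)).1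
    (eps_sq_mul_mem h1 h2 ((norm_snd_le _).trans (hz ε a h1 h2 h3).1)).2
  -- The constant `5/4 * (1 + 2 * C)` for `K` is the inverse of the slope `4/5` times the Lipschitz
  -- constant of `z`.
  refine ⟨A, hA0, hA1, fun ε a => (z ε a).waveNumber κ ε, fun ε a i k => (wt k)⁻¹ * (z ε a).1 i k,
    fun ε a h1 h2 h3 => ⟨(hroot ε a h1 h2 h3).1, fun i k => ?_, ?_⟩, ⟨5 / 4 * (1 + 2 * C), ?_⟩,
    fun j => ?_, fun j => ?_⟩
  · obtain ⟨hz1, hz2⟩ := hz ε a h1 h2 h3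
    have h4 := h3.trans hA1
    have h := (hC ε a a _ _ h1 h2 h4 h4 hz1 hz1).1 i k
    have e : (z ε a).1 i k = a * (responseMap κ β N d ε a (z ε a)).1 i k := by
      conv_lhs => rw [← hz2]
      rfl
    have key : ∀ R, (wt k)⁻¹ * (a * (wt k * R)) = a * R := fun R => by
      rw [mul_left_comm, inv_mul_cancel_left₀ (wt_pos k).ne']
    exact (congrArg ((wt k)⁻¹ * ·) (e.trans (congrArg (a * ·) h))).trans (key _)
  · obtain ⟨hz1, hz2⟩ := hz ε a h1 h2 h3
    have e : (z ε a).2 = a * (responseMap κ β N d ε a (z ε a)).2 := by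
      conv_lhs => rw [← hz2]
      rfl
    exact (hroot ε a h1 h2 h3).2.trans (congrArg (ε ^ 2 * ·) e)
  · intro ε a a' h1 h2 h3 h4
    have h := abs_sub_le_xiSymbol_sub hκ (hroot ε a h1 h2 h3).1 (hroot ε a' h1 h2 h4).1
    rw [(hroot ε a h1 h2 h3).2, (hroot ε a' h1 h2 h4).2, ← mul_sub, abs_mul,
      abs_of_nonneg (sq_nonneg ε)] at h
    have h5 : |(z ε a).2 - (z ε a').2| ≤ ‖z ε a - z ε a'‖ := norm_snd_le (z ε a - z ε a')
    have h6 := mul_le_mul_of_nonneg_left (h5.trans (hlip ε a a' h1 h2 h3 h4)) (sq_nonneg ε)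
    simp only [Unknown.waveNumber]
    linarith
  · exact (Unknown.wBound (fun p : Param κ A => z p.1.1 p.1.2.1) j).weaken
      ⟨1, zero_le_one, fun p => ⟨norm_nonneg _, by
        simpa using (hz _ _ p.2.1 p.2.2.1 p.2.2.2.1).1⟩⟩
  · have h := (Unknown.wBound (fun p : Param κ A => z p.1.1 p.1.2.1 - z p.1.1 p.1.2.2) j).weaken
      (w' := fun p => |p.1.2.1 - p.1.2.2|) ⟨1 + 2 * C, by linarith, fun p => ⟨norm_nonneg _,
        hlip _ _ _ p.2.1 p.2.2.1 p.2.2.2.1 p.2.2.2.2⟩⟩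
    convert h using 3 with p k
    exact (mul_sub _ _ _).symm

/-- Bootstrap: each passage through `coeff_eq` raises the level by one, both for the solutions and,
once all bounds are known, for their differences. Only the constants depend on the level, so `A`
never shrinks. -/
theorem exists_smooth_coeffSolution {κ : ℝ} (hκ : 1 < κ) (β : ℝ) {N d : Fin 2 → ℝ → ℝ}
    (hN : ∀ i, ContDiff ℝ ∞ (N i)) (hd : IsNormalization d) :
    ∃ A, 0 < A ∧ A ≤ 1 ∧ ∃ (K : ℝ → ℝ → ℝ) (ψ : ℝ → ℝ → Fin 2 → ℤ → ℝ),
      (∀ ε a, 0 < ε → ε < min 1 (κ - 1) → |a| ≤ A →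
        IsCoeffSolution κ β N d ε a (K ε a) (ψ ε a)) ∧
      (∃ C, ∀ ε a a', 0 < ε → ε < min 1 (κ - 1) → |a| ≤ A → |a'| ≤ A →
        |K ε a - K ε a'| ≤ C * ε ^ 2 * |a - a'|) ∧
      (∀ n j, WBound n (fun _ => 1) fun p : Param κ A => ψ p.1.1 p.1.2.1 j) ∧
      (∀ n j, WBound n (fun p => |p.1.2.1 - p.1.2.2|) fun (p : Param κ A) k =>
        ψ p.1.1 p.1.2.1 j k - ψ p.1.1 p.1.2.2 j k) := by
  obtain ⟨A, hA0, hA1, K, ψ, hsol, ⟨C, hKK⟩, hb, hl⟩ := exists_coeffSolution hκ β hN hd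
  refine ⟨A, hA0, hA1, K, ψ, hsol, ⟨C, hKK⟩, ?_⟩
  have hs : ∀ p : Param κ A, _ := fun p => hsol _ _ p.2.1 p.2.2.1 p.2.2.2.1
  have hs' : ∀ p : Param κ A, _ := fun p => hsol _ _ p.2.1 p.2.2.1 p.2.2.2.2
  have hε : ∀ p : Param κ A, 0 < p.1.1 ∧ p.1.1 ≤ 1 := fun p =>
    ⟨p.2.1, (p.2.2.1.trans_le (min_le_left _ _)).le⟩
  have hε2 : ∀ p : Param κ A, p.1.1 ^ 2 ≤ 1 := fun p => pow_le_one₀ (hε p).1.le (hε p).2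
  have ha : ∀ p : Param κ A, |p.1.1 ^ 2 * p.1.2.1| ≤ 1 := fun p => by
    rw [abs_mul, abs_of_nonneg (sq_nonneg _)]
    exact mul_le_one₀ (hε2 p) (abs_nonneg _) (p.2.2.2.1.trans hA1)
  have ha' : ∀ p : Param κ A, |p.1.1 ^ 2 * p.1.2.2| ≤ 1 := fun p => by
    rw [abs_mul, abs_of_nonneg (sq_nonneg _)]
    exact mul_le_one₀ (hε2 p) (abs_nonneg _) (p.2.2.2.2.trans hA1)
  have hres : ∀ n, (∀ j, WBound n (fun _ => 1) fun p : Param κ A => ψ p.1.1 p.1.2.1 j) → ∀ j,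
      WBound (n + 1) (fun _ => 1) fun p : Param κ A => responseCoeff κ β N d (solutionSymbol κ d j)
        p.1.1 (K p.1.1 p.1.2.1) (p.1.1 ^ 2 * p.1.2.1)
        (fun i k => nuCoeff i k + ψ p.1.1 p.1.2.1 i k) := fun n hn j =>
    WBound.response hκ hN hd hε (fun p => (hs p).waveNumber) ha
      (fun j => (wBound_nuCoeff n j).add (hn j)) (symbolClass_solutionSymbol hκ hd j)
  have hbd : ∀ n j, WBound n (fun _ => 1) fun p : Param κ A => ψ p.1.1 p.1.2.1 j := by
    intro n
    induction n with
    | zero => exact fun j => (hb j).mono zero_le_one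
    | succ n ih =>
      intro j
      convert WBound.const_mul (w := fun _ => 1) (w₁ := fun _ => 1) (c := fun p => p.1.2.1)
        ⟨1, fun p => by simpa using p.2.2.2.1.trans hA1⟩ (hres n ih j) (by simp) using 3 with p k
      exact (hs p).coeff_eq j k
  -- Replaces `a` by `a'`, so that bounds proved for the first amplitude also serve the second.
  let σ : Param κ A → Param κ A := fun p =>
    ⟨(p.1.1, p.1.2.2, p.1.2.2), p.2.1, p.2.2.1, p.2.2.2.2, p.2.2.2.2⟩
  refine ⟨hbd, fun n => ?_⟩
  induction n with
  | zero => exact fun j => (hl j).mono zero_le_one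
  | succ n ih =>
    intro j
    have hφ : ∀ j, WBound (n + 1) (fun _ => 1) fun (p : Param κ A) k =>
        nuCoeff j k + ψ p.1.1 p.1.2.1 j k :=
      fun j => (wBound_nuCoeff (n + 1) j).add (hbd (n + 1) j)
    have h1 := WBound.response_sub (β := β) hκ hN hd hε (fun p => (hs p).waveNumber)
      (fun p => (hs' p).waveNumber) ha ha' hφ (fun j => (hφ j).comap σ)
      (w := fun p => |p.1.2.1 - p.1.2.2|)
      (fun j => by convert ih j using 3 with p k; simp [σ])
      ⟨|C|, fun p => by
        refine (hKK _ _ _ p.2.1 p.2.2.1 p.2.2.2.1 p.2.2.2.2).trans ?_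
        refine mul_le_mul_of_nonneg_right ?_ (abs_nonneg _)
        calc C * p.1.1 ^ 2 ≤ |C| * 1 :=
              mul_le_mul (le_abs_self C) (hε2 p) (sq_nonneg _) (abs_nonneg _)
          _ = |C| := mul_one _⟩
      ⟨1, fun p => by
        rw [← mul_sub, abs_mul, abs_of_nonneg (sq_nonneg p.1.1)]
        exact mul_le_mul_of_nonneg_right (hε2 p) (abs_nonneg _)⟩
      (symbolClass_solutionSymbol hκ hd j)
    have h2 := WBound.const_mul (w := fun p => |p.1.2.1 - p.1.2.2|) (w₁ := fun _ => 1)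
      (c := fun p : Param κ A => p.1.2.1) ⟨1, fun p => by simpa using p.2.2.2.1.trans hA1⟩ h1
      (by simp)
    have h3 := WBound.const_mul (w := fun p => |p.1.2.1 - p.1.2.2|)
      (w₁ := fun p => |p.1.2.1 - p.1.2.2|) (c := fun p : Param κ A => p.1.2.1 - p.1.2.2)
      ⟨1, fun p => by simp⟩ ((hres n (hbd n) j).comap σ) (by simp)
    convert h2.add h3 using 3 with p k
    rw [(hs p).coeff_eq j k, (hs' p).coeff_eq j k]
    simp only [σ]
    ring

/-! ### The long wave operator in terms of Fourier coefficients -/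

/-- Multiplying by `wt⁻²` gains one level on the way to `ℓ¹`, and multiplying back by `wt²` loses
two; the net cost is one. -/
theorem LBound.wBound {ι : Type*} {n : ℕ} {w : ι → ℝ} {x : ι → ℤ → ℝ} (hx : LBound (n + 1) w x) :
    WBound n w x := by
  have h1 := LBound.symbol_mul (w := w) (w₁ := fun _ => 1) (S := fun _ k => ((wt k)⁻¹) ^ 2)
    ⟨1, fun i k => by simp⟩ hx (by simp)
  have h2 := WBound.symbol_mul (p := 2) (w := w) (w₁ := fun _ => 1) (S := fun _ k => wt k ^ 2)
    ⟨1, fun i k => by simp⟩ h1 (by simp)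
  convert h2 using 3 with i k
  have := (wt_pos k).ne'
  field_simp

theorem summable_reCoeff {F : ℝ → ℝ} (hF : ContDiff ℝ ∞ F)
    (hp : Function.Periodic F (2 * Real.pi)) : Summable fun k => |reCoeff F k| := by
  have hbd : ∀ G : ℝ → ℝ, Continuous G → Function.Periodic G (2 * Real.pi) →
      ∃ C, ∀ y, |G y| ≤ C := by
    intro G hG hp
    obtain ⟨C, hC⟩ := (isCompact_Icc (a := 0) (b := 2 * Real.pi)).exists_bound_of_continuousOn
      hG.continuousOn
    refine ⟨C, fun s => ?_⟩
    obtain ⟨y, hy, e⟩ := hp.exists_mem_Ico₀ Real.two_pi_pos s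
    rw [e]
    exact hC y (Set.Ico_subset_Icc_self hy)
  have h' := contDiff_infty_iff_deriv.1 hF
  obtain ⟨A, hA⟩ := hbd F hF.continuous hp
  obtain ⟨B, hB⟩ := hbd (deriv F) h'.2.continuous fun y => by
    rw [← deriv_comp_add_const]
    exact congrArg (fun g => deriv g y) (funext hp)
  have hc : CBound 1 (fun _ : Unit => 1) fun _ => F :=
    ⟨⟨fun _ => hF.continuous, A, fun _ y => by simpa using hA y⟩, fun _ => h'.1,
      fun _ => h'.2.continuous, B, fun _ y => by simpa using hB y⟩
  exact (LBound.wBound (n := 0) (hc.reCoeff fun _ => hp)).summable_abs ()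

theorem summable_bdd_mul {s x : ℤ → ℝ} (hs : ∃ C, ∀ k, |s k| ≤ C)
    (hx : Summable fun k => |x k|) : Summable fun k => |s k * x k| := by
  obtain ⟨C, hC⟩ := hs
  refine Summable.of_nonneg_of_le (fun k => abs_nonneg _) (fun k => ?_) (hx.mul_left C)
  rw [abs_mul]
  exact mul_le_mul_of_nonneg_right (hC k) (abs_nonneg _)

theorem BddLip.exists_bound {f : ℝ → ℝ} (hf : BddLip f) (s : ℤ → ℝ) : ∃ C, ∀ k, |f (s k)| ≤ C :=
  hf.imp fun _ hC k => (hC (s k) 0).1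

theorem trigSeries_nuCoeff (i : Fin 2) (y : ℝ) : trigSeries (nuCoeff i) 0 y = nu i y := by
  match i with
  | 0 => simp [trigSeries, nuCoeff_zero, nu]
  | 1 =>
    rw [trigSeries, tsum_eq_sum (s := {1, -1}) fun k hk => ?_]
    · rw [Finset.sum_pair (by norm_num)]
      simp [nuCoeff, nu]
      ring
    · simp only [Finset.mem_insert, Finset.mem_singleton] at hk
      simp [nuCoeff, hk]

theorem opJ₁_comp_mul {κ : ℝ} (hκ : 1 < κ) {d : Fin 2 → ℝ → ℝ} (hd : IsNormalization d) (ε : ℝ)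
    {w : ℝ} (hw : 0 < w) {F : Fin 2 → ℝ → ℝ} (hF : ∀ j, ContDiff ℝ ∞ (F j))
    (he : ∀ j, Function.Even (F j)) (hp : ∀ j, Function.Periodic (F j) (2 * Real.pi)) (i : Fin 2)
    (X : ℝ) : opJ₁ κ d ε w (fun j X => F j (w * X)) i X = trigSeries
      (fun k => ∑ j, (eigMatrix κ d (ε * w * k))⁻¹ i j * reCoeff (F j) k) 0 (w * X) := by
  have hs : ∀ j, Summable fun k : ℤ =>
      |(eigMatrix κ d (ε * (w * k)))⁻¹ i j * reCoeff (F j) k| := fun j =>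
    summable_bdd_mul ((bddLip_inv_eigMatrix hκ hd i j).exists_bound fun k => ε * (w * k))
      (summable_reCoeff (hF j) (hp j))
  simp only [mul_assoc ε w, Fin.sum_univ_two]
  rw [trigSeries_add (hs 0) (hs 1)]
  simp only [opJ₁, perMatMult, Fin.sum_univ_two]
  rw [perMult_comp_mul hw (fun k => (eigMatrix κ d (ε * k))⁻¹ i 0) (he 0) (hp 0) (hs 0),
    perMult_comp_mul hw (fun k => (eigMatrix κ d (ε * k))⁻¹ i 1) (he 1) (hp 1) (hs 1)]

theorem opJ_trigSeries {κ : ℝ} (hκ : 1 < κ) {d : Fin 2 → ℝ → ℝ} (hd : IsNormalization d) (ε : ℝ)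
    {w : ℝ} (hw : 0 < w) {φ : Fin 2 → ℤ → ℝ} (hφ : ∀ j, Summable fun k => |φ j k|)
    (he : ∀ j k, φ j (-k) = φ j k) (a : ℝ) (i : Fin 2) (X : ℝ) :
    opJ κ d ε w (fun j X => a * trigSeries (φ j) 0 (w * X)) i X
      = a * strain κ d (ε * w) φ i (w * X) := by
  have hb : ∀ j, ∃ C, ∀ k : ℤ, |eigMatrix κ d (ε * (w * k)) i j| ≤ C := fun j =>
    (bddLip_eigMatrix hκ hd i j).exists_bound fun k => ε * (w * k)
  have hs : ∀ j, Summable fun k : ℤ => |eigMatrix κ d (ε * (w * k)) i j * φ j k| := fun j =>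
    summable_bdd_mul (hb j) (hφ j)
  have haφ : ∀ j, Summable fun k => |a * φ j k| := fun j =>
    summable_bdd_mul (s := fun _ => a) ⟨|a|, fun _ => le_rfl⟩ (hφ j)
  have key : ∀ j, perMult w (fun k => eigMatrix κ d (ε * k) i j)
      (fun X => a * trigSeries (φ j) 0 (w * X)) X
      = a * trigSeries (fun k => eigMatrix κ d (ε * (w * k)) i j * φ j k) 0 (w * X) := by
    intro j
    simp only [← trigSeries_const_mul]
    rw [perMult_trigSeries hw (fun k => eigMatrix κ d (ε * k) i j) (haφ j) (by simp [he])
      (summable_bdd_mul (hb j) (haφ j))]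
    simp only [mul_left_comm]
  simp only [opJ, perMatMult, Fin.sum_univ_two, key]
  rw [← mul_add, ← trigSeries_add (hs 0) (hs 1)]
  have e : strainCoeff κ d (ε * w) φ i = fun k : ℤ =>
      eigMatrix κ d (ε * (w * k)) i 0 * φ 0 k + eigMatrix κ d (ε * (w * k)) i 1 * φ 1 k := by
    funext k
    simp only [strainCoeff, Fin.sum_univ_two, mul_assoc ε w]
  rw [strain, e]

theorem reCoeff_add {f g : ℝ → ℝ} (hf : Continuous f) (hg : Continuous g) (k : ℤ) :
    reCoeff (fun y => f y + g y) k = reCoeff f k + reCoeff g k := by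
  simp [reCoeff, fCoeff_one_add hf hg]

theorem reCoeff_const_mul (c : ℝ) (f : ℝ → ℝ) (k : ℤ) :
    reCoeff (fun y => c * f y) k = c * reCoeff f k := by
  simp [reCoeff, fCoeff_const_mul]

theorem iteratedDeriv_two_trigSeries {x : ℤ → ℝ} (hx : Summable fun k => wt k ^ 2 * |x k|)
    (w X : ℝ) : iteratedDeriv 2 (fun X => trigSeries x 0 (w * X)) X
      = trigSeries (fun k => -(w * k) ^ 2 * x k) 0 (w * X) := by
  have h1 : Summable fun k => wt k * |x k| := Summable.of_nonneg_of_le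
    (fun k => mul_nonneg (wt_pos k).le (abs_nonneg _))
    (fun k => mul_le_mul_of_nonneg_right (le_self_pow₀ (one_le_wt k) two_ne_zero) (abs_nonneg _)) hx
  have h2 : Summable fun k : ℤ => wt k * |k * x k| := by
    refine Summable.of_nonneg_of_le (fun k => mul_nonneg (wt_pos k).le (abs_nonneg _))
      (fun k => ?_) hx
    have := wt_pos k
    have := abs_le_wt k
    rw [abs_mul, sq, mul_assoc]
    gcongr
  have d1 : deriv (fun X => trigSeries x 0 (w * X)) = fun X =>
      w * trigSeries (fun k => k * x k) (0 + Real.pi / 2) (w * X) := by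
    funext X
    have h := (hasDerivAt_trigSeries h1 0 (w * X)).comp X ((hasDerivAt_id X).const_mul w)
    refine h.deriv.trans ?_
    rw [mul_one, mul_comm]
  rw [iteratedDeriv_succ, iteratedDeriv_one, d1]
  have h := ((hasDerivAt_trigSeries h2 (0 + Real.pi / 2) (w * X)).comp X
    ((hasDerivAt_id X).const_mul w)).const_mul w
  refine h.deriv.trans ?_
  rw [mul_one, mul_comm _ w, ← mul_assoc, ← trigSeries_const_mul]
  refine tsum_congr fun k => ?_
  rw [show k * (w * X) + (0 + Real.pi / 2 + Real.pi / 2) = k * (w * X) + 0 + Real.pi by ring,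
    Real.cos_add_pi]
  ring

theorem xiSymbol_ne_zero {κ ε K : ℝ} (hκ : 1 < κ) (hK : WaveNumber κ ε K) {k : ℤ}
    (hk : ¬ (k = 1 ∨ k = -1)) : xiSymbol κ (waveSpeed κ ε) (K * k) ≠ 0 := by
  rcases eq_or_ne k 0 with rfl | hk0
  · have := le_lamPlus hκ 0
    simp only [xiSymbol, Int.cast_zero, mul_zero]
    intro h
    linarith
  · have h1 := xiSymbol_le hκ hK hk0 hk
    have h2 := one_le_sq hk0
    intro h
    linarith

/-! ### The modal equations satisfied by a coefficient solution -/

section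

variable {κ β : ℝ} {N d : Fin 2 → ℝ → ℝ} {ε a K : ℝ} {ψ : Fin 2 → ℤ → ℝ}

theorem forceCoeff_neg (κ β : ℝ) (N d : Fin 2 → ℝ → ℝ) (K b : ℝ) (φ : Fin 2 → ℤ → ℝ) (j : Fin 2)
    (k : ℤ) : forceCoeff κ β N d K b φ j (-k) = forceCoeff κ β N d K b φ j k :=
  reCoeff_neg (fun y => by simp only [strain, trigSeries_even _ y])
    (force_strain_periodic κ β N d K b φ j) k

theorem solutionSymbol_neg (κ : ℝ) (hd : IsNormalization d) (i j : Fin 2) (ε K : ℝ) (k : ℤ) :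
    solutionSymbol κ d i j ε K (-k) = solutionSymbol κ d i j ε K k := by
  have h1 : acousticSymbol κ ε K (-k) = acousticSymbol κ ε K k := by
    simp [acousticSymbol, lamMinus_neg]
  have h2 : opticalSymbol κ ε K (-k) = opticalSymbol κ ε K k := by
    have : (-k = 1 ∨ -k = -1) ↔ (k = 1 ∨ k = -1) := by omega
    simp only [opticalSymbol, this, Int.cast_neg, mul_neg, lamPlus_neg, xiSymbol, neg_sq]
  simp only [solutionSymbol, h1, h2, Int.cast_neg, mul_neg, eigMatrix_neg κ hd]

theorem IsCoeffSolution.even (h : IsCoeffSolution κ β N d ε a K ψ) (hd : IsNormalization d)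
    (i : Fin 2) (k : ℤ) : ψ i (-k) = ψ i k := by
  rw [h.coeff_eq, h.coeff_eq i k]
  simp only [responseCoeff, solutionSymbol_neg κ hd, forceCoeff_neg]

theorem IsCoeffSolution.critical (h : IsCoeffSolution κ β N d ε a K ψ) {k : ℤ}
    (hk : k = 1 ∨ k = -1) : ψ 1 k = 0 := by
  rw [h.coeff_eq]
  simp [responseCoeff, solutionSymbol, opticalSymbol, hk]

theorem IsCoeffSolution.acoustic_eq (h : IsCoeffSolution κ β N d ε a K ψ) (k : ℤ) :
    a * (nuCoeff 0 k + ψ 0 k) + acousticSymbol κ ε K k * ∑ j, (eigMatrix κ d (K * k))⁻¹ 0 j *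
      (a ^ 2 * forceCoeff κ β N d K (ε ^ 2 * a) (fun i k => nuCoeff i k + ψ i k) j k) = 0 := by
  rw [h.coeff_eq, nuCoeff_zero]
  simp only [responseCoeff, solutionSymbol, Fin.sum_univ_two, Matrix.cons_val_zero]
  ring

/-- At `k = ±1` the corrector vanishes and this is the bifurcation equation, carried from `1` to
`-1` by symmetry. At the other modes `ξ ≠ 0`, and the division can be undone. -/
theorem IsCoeffSolution.optical_eq (h : IsCoeffSolution κ β N d ε a K ψ) (hκ : 1 < κ)
    (hd : IsNormalization d) (k : ℤ) :
    xiSymbol κ (waveSpeed κ ε) (K * k) * (a * (nuCoeff 1 k + ψ 1 k))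
      + ε ^ 2 * (lamPlus κ (K * k) * ∑ j, (eigMatrix κ d (K * k))⁻¹ 1 j *
      (a ^ 2 * forceCoeff κ β N d K (ε ^ 2 * a) (fun i k => nuCoeff i k + ψ i k) j k)) = 0 := by
  by_cases hk : k = 1 ∨ k = -1
  · rw [h.critical hk]
    have hxi := h.xi_eq
    simp only [responseCoeff, criticalSymbol, Fin.sum_univ_two, if_true] at hxi ⊢
    have hn : nuCoeff 1 k = 1 / 2 := by simp [nuCoeff, hk]
    rw [hn]
    rcases hk with rfl | rfl
    · simp only [Int.cast_one, mul_one] at hxi ⊢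
      rw [hxi]
      ring
    · simp only [Int.cast_one, mul_one, forceCoeff_neg, Int.cast_neg, mul_neg, lamPlus_neg,
        eigMatrix_neg κ hd, xiSymbol, neg_sq] at hxi ⊢
      rw [hxi]
      ring
  · have hn : nuCoeff 1 k = 0 := by simp [nuCoeff, hk]
    rw [h.coeff_eq, hn]
    simp only [responseCoeff, solutionSymbol, Fin.sum_univ_two, Matrix.cons_val_one,
      Matrix.cons_val_zero, opticalSymbol, if_neg hk]
    have := xiSymbol_ne_zero hκ h.waveNumber hk
    field_simp
    ring

end

/-! ### Recovering the solution from its coefficients -/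

theorem contDiff_trigSeries {x : ℤ → ℝ} (hx : ∀ n : ℕ, Summable fun k => wt k ^ n * |x k|) :
    ContDiff ℝ ∞ (trigSeries x 0) :=
  CBound.contDiff (ι := Unit) (w := fun _ => 1) (f := fun _ => trigSeries x 0)
    (fun n => WBound.trigSeries (ι := Unit) (x := fun _ => x)
      ⟨∑' k, wt k ^ n * |x k|, fun _ => ⟨hx n, (mul_one _).ge⟩⟩ 0) ()

theorem contDiff_strain {κ : ℝ} (hκ : 1 < κ) {d : Fin 2 → ℝ → ℝ} (hd : IsNormalization d) (K : ℝ)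
    {φ : Fin 2 → ℤ → ℝ} (hφ : ∀ (n : ℕ) j, Summable fun k => wt k ^ n * |φ j k|) (j : Fin 2) :
    ContDiff ℝ ∞ (strain κ d K φ j) := by
  refine contDiff_trigSeries fun n => ?_
  obtain ⟨C, hC⟩ := (bddLip_eigMatrix hκ hd j 0).exists_bound fun k => K * k
  obtain ⟨D, hD⟩ := (bddLip_eigMatrix hκ hd j 1).exists_bound fun k => K * k
  refine Summable.of_nonneg_of_le (fun k => mul_nonneg (pow_nonneg (wt_pos k).le _) (abs_nonneg _))
    (fun k => ?_) (((hφ n 0).mul_left C).add ((hφ n 1).mul_left D))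
  have := wt_pos k
  have h1 := hC k
  have h2 := hD k
  rw [strainCoeff, Fin.sum_univ_two]
  calc wt k ^ n * |eigMatrix κ d (K * k) j 0 * φ 0 k + eigMatrix κ d (K * k) j 1 * φ 1 k|
      ≤ wt k ^ n * (|eigMatrix κ d (K * k) j 0| * |φ 0 k|
        + |eigMatrix κ d (K * k) j 1| * |φ 1 k|) := by
        rw [← abs_mul, ← abs_mul]
        gcongr
        exact abs_add_le _ _
    _ ≤ wt k ^ n * (C * |φ 0 k| + D * |φ 1 k|) := by gcongr
    _ = _ := by ring

theorem summable_profileCoeff {ψ : Fin 2 → ℤ → ℝ}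
    (hs : ∀ (n : ℕ) j, Summable fun k => wt k ^ n * |ψ j k|) (n : ℕ) (j : Fin 2) :
    Summable fun k => wt k ^ n * |nuCoeff j k + ψ j k| := by
  have h := (wBound_nuCoeff (ι := Unit) n j).summable ()
  refine Summable.of_nonneg_of_le (fun k => mul_nonneg (pow_nonneg (wt_pos k).le _) (abs_nonneg _))
    (fun k => ?_) (h.add (hs n j))
  rw [← mul_add]
  exact mul_le_mul_of_nonneg_left (abs_add_le _ _) (pow_nonneg (wt_pos k).le _)

/-- All series involved converge absolutely, so each component of the long-wave operator collapses
to a single cosine series whose coefficients vanish by the modal equations. -/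
theorem IsCoeffSolution.isPeriodicSolution {κ β : ℝ} {N d : Fin 2 → ℝ → ℝ} {ε a w : ℝ}
    {ψ : Fin 2 → ℤ → ℝ} (h : IsCoeffSolution κ β N d ε a (ε * w) ψ) (hκ : 1 < κ)
    (hN : ∀ i, ContDiff ℝ ∞ (N i)) (hd : IsNormalization d) (hε : 0 < ε) (hε1 : ε ≤ 1)
    (hw : 0 < w) (hs : ∀ (n : ℕ) j, Summable fun k => wt k ^ n * |ψ j k|) :
    IsPeriodicSolution κ β N d ε w
      (fun i X => a * profile w (fun i => trigSeries (ψ i) 0) i X) := by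
  set φ : Fin 2 → ℤ → ℝ := fun i k => nuCoeff i k + ψ i k with hφdef
  have hφ : ∀ (n : ℕ) j, Summable fun k => wt k ^ n * |φ j k| := summable_profileCoeff hs
  have hφ0 : ∀ j, Summable fun k => |φ j k| := fun j => by simpa using hφ 0 j
  have hφe : ∀ j k, φ j (-k) = φ j k := fun j k => by
    simp only [hφdef, nuCoeff_neg, h.even hd]
  have hθ : (fun i X => a * profile w (fun i => trigSeries (ψ i) 0) i X)
      = fun i X => a * trigSeries (φ i) 0 (w * X) := by
    funext i X
    have h1 := (wBound_nuCoeff (ι := Unit) 0 i).summable_abs ()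
    rw [hφdef, trigSeries_add h1 (by simpa using hs 0 i), trigSeries_nuCoeff, profile]
  rw [hθ]
  set u := strain κ d (ε * w) φ with hu
  have hus : ∀ j, ContDiff ℝ ∞ (u j) := contDiff_strain hκ hd _ hφ
  have hue : ∀ j y, u j (-y) = u j y := fun j y => trigSeries_even _ y
  have hup : ∀ j y, u j (y + 2 * Real.pi) = u j y := fun j y => trigSeries_periodic _ 0 y
  have hJ : ∀ i X, opJ κ d ε w (fun i X => a * trigSeries (φ i) 0 (w * X)) i X
      = a * u i (w * X) := opJ_trigSeries hκ hd ε hw hφ0 hφe a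
  let FB : Fin 2 → ℝ → ℝ := fun j y => ![β / κ, 1] j * ((a * u j y) * (a * u j y))
  let FQ : Fin 2 → ℝ → ℝ := fun j y =>
    ![1 / κ, 1] j * ((a * u j y) ^ 3 * N j (ε ^ 2 * (a * u j y)))
  have hau : ∀ j, ContDiff ℝ ∞ fun y => a * u j y := fun j => contDiff_const.mul (hus j)
  have hFB : ∀ j, ContDiff ℝ ∞ (FB j) := fun j => contDiff_const.mul ((hau j).mul (hau j))
  have hFQ : ∀ j, ContDiff ℝ ∞ (FQ j) := fun j =>
    contDiff_const.mul (((hau j).pow 3).mul ((hN j).comp (contDiff_const.mul (hau j))))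
  have hFBe : ∀ j, Function.Even (FB j) := fun j y => by simp only [FB, hue]
  have hFQe : ∀ j, Function.Even (FQ j) := fun j y => by simp only [FQ, hue]
  have hFBp : ∀ j, Function.Periodic (FB j) (2 * Real.pi) := fun j y => by simp only [FB, hup]
  have hFQp : ∀ j, Function.Periodic (FQ j) (2 * Real.pi) := fun j y => by simp only [FQ, hup]
  let out : (Fin 2 → ℝ → ℝ) → Fin 2 → ℤ → ℝ := fun F i k =>
    ∑ j, (eigMatrix κ d (ε * w * k))⁻¹ i j * reCoeff (F j) k
  have hout : ∀ {F : Fin 2 → ℝ → ℝ}, (∀ j, ContDiff ℝ ∞ (F j)) →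
      (∀ j, Function.Periodic (F j) (2 * Real.pi)) → ∀ i, Summable fun k => |out F i k| := by
    intro F hF hp i
    have hj : ∀ j, Summable fun k : ℤ => (eigMatrix κ d (ε * w * k))⁻¹ i j * reCoeff (F j) k :=
      fun j => (summable_bdd_mul ((bddLip_inv_eigMatrix hκ hd i j).exists_bound
        fun k => ε * w * k) (summable_reCoeff (hF j) (hp j))).of_abs
    exact (summable_sum fun j _ => hj j).abs
  have houte : ∀ {F : Fin 2 → ℝ → ℝ}, (∀ j, Function.Even (F j)) →
      (∀ j, Function.Periodic (F j) (2 * Real.pi)) → ∀ i k, out F i (-k) = out F i k := by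
    intro F he hp i k
    simp only [out, Int.cast_neg, mul_neg, eigMatrix_neg κ hd, reCoeff_neg (he _) (hp _)]
  have hB : opB κ β d ε w (fun i X => a * trigSeries (φ i) 0 (w * X))
      (fun i X => a * trigSeries (φ i) 0 (w * X)) = fun i X => trigSeries (out FB i) 0 (w * X) := by
    funext i X
    rw [← opJ₁_comp_mul hκ hd ε hw hFB hFBe hFBp i X]
    simp only [opB, hJ]
    rfl
  have hQ : opQ κ N d ε w (fun i X => a * trigSeries (φ i) 0 (w * X))
      = fun i X => trigSeries (fun k => ε ^ 2 * out FQ i k) 0 (w * X) := by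
    funext i X
    rw [trigSeries_const_mul, ← opJ₁_comp_mul hκ hd ε hw hFQ hFQe hFQp i X]
    simp only [opQ, hJ]
    rfl
  have hQs : ∀ i, Summable fun k => |ε ^ 2 * out FQ i k| := fun i =>
    summable_bdd_mul (s := fun _ => ε ^ 2) ⟨|ε ^ 2|, fun _ => le_rfl⟩ (hout hFQ hFQp i)
  have hQe : ∀ i k, ε ^ 2 * out FQ i (-k) = ε ^ 2 * out FQ i k := fun i k => by
    rw [houte hFQe hFQp]
  -- Quadratic and higher-order terms merge: with `v = a u` and `b = ε² a`, the sum of `v²` and `ε²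
  -- v³ N(ε² v)`, with their matrix factors, is `a²` times `force` at `b`.
  have hsum : ∀ i k, out FB i k + ε ^ 2 * out FQ i k = ∑ j, (eigMatrix κ d (ε * w * k))⁻¹ i j *
      (a ^ 2 * forceCoeff κ β N d (ε * w) (ε ^ 2 * a) φ j k) := by
    intro i k
    have e : ∀ j, reCoeff (FB j) k + ε ^ 2 * reCoeff (FQ j) k
        = a ^ 2 * forceCoeff κ β N d (ε * w) (ε ^ 2 * a) φ j k := by
      intro j
      have h1 := reCoeff_add (f := FB j) (g := fun y => ε ^ 2 * FQ j y) (hFB j).continuous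
        (continuous_const.mul (hFQ j).continuous) k
      rw [forceCoeff, ← reCoeff_const_mul, ← reCoeff_const_mul, ← h1]
      congr 1
      funext y
      simp only [FB, FQ, force, ← hu]
      ring_nf
    simp only [out, ← e, Fin.sum_univ_two]
    ring
  have hperB := fun (m : ℝ → ℝ) (hm : ∃ C, ∀ k : ℤ, |m (w * k)| ≤ C) i X =>
    perMult_trigSeries hw m (hout hFB hFBp i) (houte hFBe hFBp i)
      (summable_bdd_mul hm (hout hFB hFBp i)) X
  have hperQ := fun (m : ℝ → ℝ) (hm : ∃ C, ∀ k : ℤ, |m (w * k)| ≤ C) i X =>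
    perMult_trigSeries hw m (hQs i) (hQe i) (summable_bdd_mul hm (hQs i)) X
  have hvarpi : ∃ C, ∀ k : ℤ, |varpiSymbol κ ε (w * k)| ≤ C := by
    obtain ⟨C, hC⟩ := symbolClass_acoustic hκ
    refine ⟨|C|, fun k => ?_⟩
    rw [varpiSymbol_eq κ ε hw.ne']
    refine (hC ε _ _ k hε hε1 h.waveNumber h.waveNumber).1.trans ?_
    have h0 : 0 ≤ ((wt k)⁻¹) ^ 2 := sq_nonneg _
    have h1 : ((wt k)⁻¹) ^ 2 ≤ 1 :=
      pow_le_one₀ (inv_pos.2 (wt_pos k)).le (inv_le_one_of_one_le₀ (one_le_wt k))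
    calc C * ((wt k)⁻¹) ^ 2 ≤ |C| * 1 := mul_le_mul (le_abs_self C) h1 h0 (abs_nonneg _)
      _ = |C| := mul_one _
  have hlam : ∃ C, ∀ k : ℤ, |lamPlus κ (ε * (w * k))| ≤ C :=
    (bddLip_lamPlus hκ).exists_bound fun k => ε * (w * k)
  have haφ : ∀ j, Summable fun k => |a * φ j k| := fun j =>
    summable_bdd_mul (s := fun _ => a) ⟨|a|, fun _ => le_rfl⟩ (hφ0 j)
  refine ⟨fun i => ⟨?_, ?_⟩, fun i X => ?_⟩
  · exact contDiff_const.mul ((contDiff_trigSeries fun n => hφ n i).comp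
      (contDiff_const.mul contDiff_id))
  · intro X
    simp only
    rw [mul_add, mul_div_cancel₀ _ hw.ne', trigSeries_periodic]
  · match i with
    | 0 =>
      simp only [longWave, Matrix.cons_val_zero, hB, hQ]
      rw [hperB _ hvarpi, hperQ _ hvarpi, ← trigSeries_const_mul, ← trigSeries_add (haφ 0)
        (summable_bdd_mul hvarpi (hout hFB hFBp 0)), ← trigSeries_add _
        (summable_bdd_mul hvarpi (hQs 0))]
      · refine (tsum_congr fun k => ?_).trans tsum_zero
        have e : a * φ 0 k + acousticSymbol κ ε (ε * w) k * (out FB 0 k + ε ^ 2 * out FQ 0 k)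
            = 0 := by
          rw [hsum]
          exact h.acoustic_eq k
        beta_reduce
        rw [varpiSymbol_eq κ ε hw.ne', add_assoc, ← mul_add, e, zero_mul]
      · exact ((haφ 0).of_abs.add (summable_bdd_mul hvarpi (hout hFB hFBp 0)).of_abs).abs
    | 1 =>
      simp only [longWave, Matrix.cons_val_one, Matrix.cons_val_zero, hB, hQ]
      simp only [← trigSeries_const_mul]
      have h2 : Summable fun k => wt k ^ 2 * |a * φ 1 k| := by
        simpa only [abs_mul, mul_left_comm] using (hφ 2 1).mul_left |a|
      rw [iteratedDeriv_two_trigSeries h2,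
        perMult_trigSeries hw (fun k => lamPlus κ (ε * k)) (haφ 1)
          (fun k => by rw [hφe]) (summable_bdd_mul hlam (haφ 1)),
        hperB (fun k => lamPlus κ (ε * k)) hlam, hperQ (fun k => lamPlus κ (ε * k)) hlam]
      simp only [← trigSeries_const_mul]
      have s1 : Summable fun k : ℤ => |ε ^ 2 * waveSpeed κ ε ^ 2 * (-(w * k) ^ 2 * (a * φ 1 k))| := by
        refine Summable.of_nonneg_of_le (fun k => abs_nonneg _) (fun k => ?_)
          (h2.mul_left (ε ^ 2 * waveSpeed κ ε ^ 2 * w ^ 2))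
        have hk : (k : ℝ) ^ 2 ≤ wt k ^ 2 := by
          rw [← sq_abs]
          exact pow_le_pow_left₀ (abs_nonneg _) (abs_le_wt k) 2
        have e : |ε ^ 2 * waveSpeed κ ε ^ 2 * (-(w * k) ^ 2 * (a * φ 1 k))|
            = ε ^ 2 * waveSpeed κ ε ^ 2 * w ^ 2 * ((k : ℝ) ^ 2 * |a * φ 1 k|) := by
          rw [abs_mul, abs_mul (-(w * (k : ℝ)) ^ 2), abs_neg, abs_of_nonneg (by positivity),
            abs_of_nonneg (by positivity)]
          ring
        rw [e]
        gcongr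
      have s2 := summable_bdd_mul hlam (haφ 1)
      have hc : ∃ C, ∀ _ : ℤ, |ε ^ 2| ≤ C := ⟨|ε ^ 2|, fun _ => le_rfl⟩
      have s3 := summable_bdd_mul hc (summable_bdd_mul hlam (hout hFB hFBp 1))
      have s4 := summable_bdd_mul hc (summable_bdd_mul hlam (hQs 1))
      rw [← trigSeries_add s1 s2, ← trigSeries_add (s1.of_abs.add s2.of_abs).abs s3,
        ← trigSeries_add ((s1.of_abs.add s2.of_abs).add s3.of_abs).abs s4]
      refine (tsum_congr fun k => ?_).trans tsum_zero
      have e : xiSymbol κ (waveSpeed κ ε) (ε * w * k) * (a * φ 1 k) + ε ^ 2 *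
          (lamPlus κ (ε * w * k) * (out FB 1 k + ε ^ 2 * out FQ 1 k)) = 0 := by
        rw [hsum]
        exact h.optical_eq hκ hd k
      rw [xiSymbol, mul_assoc ε w] at e
      have e' : ε ^ 2 * waveSpeed κ ε ^ 2 * (-(w * k) ^ 2 * (a * φ 1 k))
          + lamPlus κ (ε * (w * k)) * (a * φ 1 k)
          + ε ^ 2 * (lamPlus κ (ε * (w * k)) * out FB 1 k)
          + ε ^ 2 * (lamPlus κ (ε * (w * k)) * (ε ^ 2 * out FQ 1 k)) = 0 := by
        rw [← e]
        ring
      beta_reduce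
      rw [e', zero_mul]

/-! ### Sobolev norms of cosine series and the main theorem -/

theorem hper_term_le {r : ℝ} {n : ℕ} (hr : 0 ≤ r) (hrn : r ≤ n) (k : ℤ) (t : ℝ) :
    (1 + (k : ℝ) ^ 2) ^ r * ‖(t : ℂ)‖ ^ 2 ≤ (wt k ^ n * |t|) ^ 2 := by
  rw [Complex.norm_real, Real.norm_eq_abs, mul_pow, ← pow_mul, mul_comm n, pow_mul]
  refine mul_le_mul_of_nonneg_right ?_ (sq_nonneg _)
  have h1 : 1 + (k : ℝ) ^ 2 ≤ wt k ^ 2 := by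
    rw [wt, ← sq_abs (k : ℝ)]
    nlinarith [abs_nonneg (k : ℝ)]
  calc (1 + (k : ℝ) ^ 2) ^ r ≤ (wt k ^ 2) ^ r := Real.rpow_le_rpow (by positivity) h1 hr
    _ ≤ (wt k ^ 2) ^ (n : ℝ) :=
      Real.rpow_le_rpow_of_exponent_le (one_le_pow₀ (one_le_wt k)) hrn
    _ = (wt k ^ 2) ^ n := Real.rpow_natCast _ _

/-- The weighted `ℓ²` norm is dominated by the weighted `ℓ¹` norm `S`: every term is at most `S`, so
the squares sum to at most `S²`. -/
theorem hperNorm_trigSeries_le {x : ℤ → ℝ} {r : ℝ} {n : ℕ} (hr : 0 ≤ r) (hrn : r ≤ n)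
    (h0 : Summable fun k => |x k|) (hx : Summable fun k => wt k ^ n * |x k|)
    (he : ∀ k, x (-k) = x k) :
    (Summable fun k : ℤ => (1 + (k : ℝ) ^ 2) ^ r * ‖fCoeff 1 (trigSeries x 0) k‖ ^ 2) ∧
      hperNorm r (trigSeries x 0) ≤ ∑' k, wt k ^ n * |x k| := by
  set S := ∑' k, wt k ^ n * |x k|
  have hpos : ∀ k, 0 ≤ wt k ^ n * |x k| := fun k =>
    mul_nonneg (pow_nonneg (wt_pos k).le _) (abs_nonneg _)
  have hle : ∀ k : ℤ, (1 + (k : ℝ) ^ 2) ^ r * ‖fCoeff 1 (trigSeries x 0) k‖ ^ 2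
      ≤ S * (wt k ^ n * |x k|) := fun k => by
    rw [fCoeff_trigSeries h0 he]
    refine (hper_term_le hr hrn k _).trans ?_
    rw [sq]
    exact mul_le_mul_of_nonneg_right (hx.le_tsum k fun j _ => hpos j) (hpos k)
  have hs : Summable fun k : ℤ => (1 + (k : ℝ) ^ 2) ^ r * ‖fCoeff 1 (trigSeries x 0) k‖ ^ 2 :=
    Summable.of_nonneg_of_le (fun k => by positivity) hle (hx.mul_left S)
  refine ⟨hs, Real.sqrt_le_iff.2 ⟨tsum_nonneg hpos, ?_⟩⟩
  calc _ ≤ ∑' k, S * (wt k ^ n * |x k|) := hs.tsum_le_tsum hle (hx.mul_left S)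
    _ = S ^ 2 := by rw [tsum_mul_left, sq]

theorem memHper_trigSeries {x : ℤ → ℝ} (hx : ∀ n : ℕ, Summable fun k => wt k ^ n * |x k|)
    (he : ∀ k, x (-k) = x k) {r : ℝ} (hr : 0 ≤ r) : MemHper r (trigSeries x 0) :=
  ⟨trigSeries_periodic x 0, memLp_two_of_continuous (contDiff_trigSeries hx).continuous,
    (hperNorm_trigSeries_le hr (Nat.le_ceil r) (by simpa using hx 0) (hx _) he).1⟩

theorem integral_trigSeries_mul_cos {x : ℤ → ℝ} (hx : Summable fun k => |x k|)
    (he : ∀ k, x (-k) = x k) (h1 : x 1 = 0) :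
    ∫ y in (0 : ℝ)..(2 * Real.pi), trigSeries x 0 y * Real.cos y = 0 := by
  have hc := continuous_trigSeries hx 0
  have h := fCoeff_trigSeries hx he 1
  rw [h1, fCoeff, Complex.ofReal_zero, mul_eq_zero] at h
  -- The real part of the vanishing first Fourier coefficient is, up to normalization, the integral
  -- against the cosine.
  have h2 := congrArg Complex.re
    (h.resolve_left (Complex.ofReal_ne_zero.2 (one_div_pos.2 Real.two_pi_pos).ne'))
  rw [div_one] at h2
  have hi : IntervalIntegrable (fun y : ℝ => (trigSeries x 0 y : ℂ) *
      Complex.exp (-(Complex.I * (1 * (1 : ℤ) * y : ℝ)))) MeasureTheory.volume 0 (2 * Real.pi) := by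
    apply Continuous.intervalIntegrable
    fun_prop
  refine Eq.trans ?_ ((Complex.reCLM.intervalIntegral_comp_comm hi).trans h2)
  refine intervalIntegral.integral_congr fun y _ => ?_
  simp [Complex.exp_re]

/-- A critical wave number is unique and satisfies explicit bounds. -/
theorem critical_bounds {κ ε δ w : ℝ} (hκ : 1 < κ) (hε : 0 < ε) (hεδ : ε ≤ δ) (hw : 0 < w)
    (h : xiSymbol κ (waveSpeed κ ε) (ε * w) = 0) :
    1 / ε * (Real.sqrt (2 * κ) / Real.sqrt (soundSpeed κ ^ 2 + δ ^ 2)) ≤ w ∧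
      w ≤ 1 / ε * (Real.sqrt (2 + 2 * κ) / soundSpeed κ) := by
  have hs := one_le_soundSpeed_sq hκ
  have hs0 : 0 < soundSpeed κ := Real.sqrt_pos.2 (by positivity)
  have hl := le_lamPlus hκ (ε * w)
  have hu := lamPlus_le hκ (ε * w)
  rw [xiSymbol, waveSpeed_sq] at h
  have hεw : 0 < ε * w := mul_pos hε hw
  have hδ : 0 < Real.sqrt (soundSpeed κ ^ 2 + δ ^ 2) := Real.sqrt_pos.2 (by positivity)
  constructor
  · rw [one_div_mul_eq_div, div_le_iff₀ hε, div_le_iff₀ hδ]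
    refine Real.sqrt_le_iff.2 ⟨by positivity, ?_⟩
    rw [mul_pow, Real.sq_sqrt (by positivity)]
    have : ε ^ 2 ≤ δ ^ 2 := pow_le_pow_left₀ hε.le hεδ 2
    nlinarith [mul_nonneg (sub_nonneg.2 this) (sq_nonneg (ε * w))]
  · rw [one_div_mul_eq_div, le_div_iff₀ hε, le_div_iff₀ hs0]
    refine Real.le_sqrt_of_sq_le ?_
    nlinarith [mul_nonneg (sq_nonneg ε) (sq_nonneg (ε * w))]

/-- Any positive zero of `ξ` lies in the window automatically, and `ξ` is injective there. -/
theorem critical_unique {κ ε K L : ℝ} (hκ : 1 < κ) (hK : 0 < K) (hL : 0 < L)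
    (h : xiSymbol κ (waveSpeed κ ε) K = 0) (h' : xiSymbol κ (waveSpeed κ ε) L = 0) : K = L := by
  have hb : ∀ {K}, 0 < K → xiSymbol κ (waveSpeed κ ε) K = 0 → WaveNumber κ ε K :=
    fun hK h => .of_xiSymbol hκ hK (by linarith) (by linarith)
  have := abs_sub_le_xiSymbol_sub hκ (hb hK h) (hb hL h')
  rw [h, h', sub_zero, abs_zero] at this
  exact sub_eq_zero.1 (abs_eq_zero.1 (by linarith [abs_nonneg (K - L)]))

theorem exists_hperNorm_le {ι : Type*} {w : ι → ℝ} (hw : ∀ p, 0 ≤ w p) {x : ι → Fin 2 → ℤ → ℝ}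
    (hx : ∀ (n : ℕ) j, WBound n w fun p => x p j) (he : ∀ p j k, x p j (-k) = x p j k) {r : ℝ}
    (hr : 0 ≤ r) :
    ∃ C, 0 ≤ C ∧ ∀ p, hperNorm₂ r (fun j => trigSeries (x p j) 0) ≤ C * w p := by
  obtain ⟨C, hC⟩ := hx ⌈r⌉₊ 0
  obtain ⟨D, hD⟩ := hx ⌈r⌉₊ 1
  have key := fun p j => (hperNorm_trigSeries_le hr (Nat.le_ceil r) ((hx 0 j).summable_abs p)
    ((hx _ j).summable p) (he p j)).2
  refine ⟨|C| + |D|, by positivity, fun p => ?_⟩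
  rw [hperNorm₂, add_mul]
  exact add_le_add
    ((key p 0).trans ((hC p).2.trans (mul_le_mul_of_nonneg_right (le_abs_self C) (hw p))))
    ((key p 1).trans ((hD p).2.trans (mul_le_mul_of_nonneg_right (le_abs_self D) (hw p))))

end SpringDimer

end

/-! ### Passage from the wave number `K` to the frequency `K / ε` -/

theorem mainTheorem1 (κ β : ℝ) (hκ : 1 < κ)
    (N : Fin 2 → ℝ → ℝ) (hN : ∀ i, ContDiff ℝ ∞ (N i))
    (d : Fin 2 → ℝ → ℝ) (hd : SpringDimer.IsNormalization d) :
    ∃ ε_per > (0 : ℝ), ∃ a_per > (0 : ℝ),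
    ∃ (om₀ : ℝ → ℝ) (om : ℝ → ℝ → ℝ) (ψ : ℝ → ℝ → Fin 2 → ℝ → ℝ),
      -- the critical frequency
      (∀ ε, 0 < ε → ε < ε_per →
        0 < om₀ ε ∧
        SpringDimer.xiSymbol κ (SpringDimer.waveSpeed κ ε) (ε * om₀ ε) = 0 ∧
        (∀ w, 0 < w → SpringDimer.xiSymbol κ (SpringDimer.waveSpeed κ ε) (ε * w) = 0 →
          w = om₀ ε) ∧
        1 / ε * (Real.sqrt (2 * κ) / Real.sqrt (SpringDimer.soundSpeed κ ^ 2 + ε_per ^ 2))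
          ≤ om₀ ε ∧
        om₀ ε ≤ 1 / ε * (Real.sqrt (2 + 2 * κ) / SpringDimer.soundSpeed κ)) ∧
      -- the periodic solutions
      (∀ ε a, 0 < ε → ε < ε_per → |a| ≤ a_per →
        0 < om ε a ∧
        (∀ i, ContDiff ℝ ∞ (ψ ε a i) ∧ Function.Even (ψ ε a i) ∧
          ∀ r, 0 ≤ r → SpringDimer.MemHper r (ψ ε a i)) ∧
        (∫ y in (0 : ℝ)..(2 * Real.pi), ψ ε a 1 y * Real.cos y) = 0 ∧
        SpringDimer.IsPeriodicSolution κ β N d ε (om ε a)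
          (fun i X => a * SpringDimer.profile (om ε a) (ψ ε a) i X)) ∧
      -- zero amplitude
      (∀ ε, 0 < ε → ε < ε_per → om ε 0 = om₀ ε ∧ ∀ i y, ψ ε 0 i y = 0) ∧
      -- uniform bounds and Lipschitz estimates
      (∀ r, 0 ≤ r → ∃ C > (0 : ℝ),
        (∀ ε a, 0 < ε → ε < ε_per → |a| ≤ a_per →
          SpringDimer.hperNorm₂ r (ψ ε a) + |om ε a - om₀ ε| ≤ C) ∧
        (∀ ε a a', 0 < ε → ε < ε_per → |a| ≤ a_per → |a'| ≤ a_per →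
          SpringDimer.hperNorm₂ r (fun i y => ψ ε a i y - ψ ε a' i y) + |om ε a - om ε a'|
            ≤ C * |a - a'|)) := by
  obtain ⟨A, hA0, hA1, K, ψ, hsol, ⟨C₀, hK⟩, hb, hl⟩ :=
    SpringDimer.exists_smooth_coeffSolution hκ β hN hd
  have h0A : |(0 : ℝ)| ≤ A := by simpa using hA0.le
  have hsum : ∀ {ε a}, 0 < ε → ε < min 1 (κ - 1) → |a| ≤ A → ∀ (n : ℕ) j,
      Summable fun k => SpringDimer.wt k ^ n * |ψ ε a j k| := fun {ε a} h1 h2 h3 n j =>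
    (hb n j).summable ⟨(ε, a, a), h1, h2, h3, h3⟩
  have hsum0 : ∀ {ε a}, 0 < ε → ε < min 1 (κ - 1) → |a| ≤ A → ∀ j,
      Summable fun k => |ψ ε a j k| := fun h1 h2 h3 j => by simpa using hsum h1 h2 h3 0 j
  have hdiv : ∀ {ε a}, 0 < ε → ε * (K ε a / ε) = K ε a := fun h => mul_div_cancel₀ _ h.ne'
  have hpos : ∀ {ε a}, 0 < ε → ε < min 1 (κ - 1) → |a| ≤ A → 0 < K ε a / ε :=
    fun h1 h2 h3 => div_pos (hsol _ _ h1 h2 h3).waveNumber.1 h1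
  have hcrit : ∀ {ε}, 0 < ε → ε < min 1 (κ - 1) →
      SpringDimer.xiSymbol κ (SpringDimer.waveSpeed κ ε) (ε * (K ε 0 / ε)) = 0 := fun h1 h2 => by
    rw [hdiv h1, (hsol _ _ h1 h2 h0A).xi_eq, zero_mul, mul_zero]
  -- After division by `ε` the bound `C₀ ε² |a - a'|` still carries a factor `ε ≤ 1`, so the
  -- frequencies are uniformly Lipschitz although they are themselves of size `1/ε`.
  have homLip : ∀ ε a a', 0 < ε → ε < min 1 (κ - 1) → |a| ≤ A → |a'| ≤ A →
      |K ε a / ε - K ε a' / ε| ≤ |C₀| * |a - a'| := by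
    intro ε a a' h1 h2 h3 h4
    rw [← sub_div, abs_div, abs_of_pos h1, div_le_iff₀ h1]
    have hε1 : ε ≤ 1 := (h2.trans_le (min_le_left _ _)).le
    calc |K ε a - K ε a'| ≤ C₀ * ε ^ 2 * |a - a'| := hK ε a a' h1 h2 h3 h4
      _ ≤ |C₀| * ε * |a - a'| := by
        have : ε ^ 2 ≤ ε := by nlinarith
        have := le_abs_self C₀
        gcongr
      _ = _ := by ring
  -- The critical frequency is the branch at `a = 0`, where the bifurcation equation reduces to
  -- `ξ(K) = 0`.
  refine ⟨min 1 (κ - 1), lt_min one_pos (sub_pos.2 hκ), A, hA0, fun ε => K ε 0 / ε,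
    fun ε a => K ε a / ε, fun ε a i => SpringDimer.trigSeries (ψ ε a i) 0, ?_, ?_, ?_, ?_⟩
  · intro ε h1 h2
    have hp := hpos h1 h2 h0A
    refine ⟨hp, hcrit h1 h2, fun w hw hx => ?_,
      SpringDimer.critical_bounds hκ h1 h2.le hp (hcrit h1 h2)⟩
    exact mul_left_cancel₀ h1.ne' (SpringDimer.critical_unique hκ (mul_pos h1 hw)
      (mul_pos h1 hp) hx (hcrit h1 h2))
  · intro ε a h1 h2 h3
    have h := hsol ε a h1 h2 h3
    refine ⟨hpos h1 h2 h3, fun i => ⟨SpringDimer.contDiff_trigSeries fun n => hsum h1 h2 h3 n i,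
      SpringDimer.trigSeries_even _, fun r hr => SpringDimer.memHper_trigSeries
        (fun n => hsum h1 h2 h3 n i) (h.even hd i) hr⟩,
      SpringDimer.integral_trigSeries_mul_cos (hsum0 h1 h2 h3 1) (h.even hd 1)
        (h.critical (Or.inl rfl)), ?_⟩
    rw [← hdiv (a := a) h1] at h
    exact h.isPeriodicSolution hκ hN hd h1 (h2.trans_le (min_le_left _ _)).le (hpos h1 h2 h3)
      (hsum h1 h2 h3)
  · intro ε h1 h2
    refine ⟨rfl, fun i y => (tsum_congr fun k => ?_).trans tsum_zero⟩
    rw [(hsol ε 0 h1 h2 h0A).coeff_eq, zero_mul, zero_mul]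
  · intro r hr
    have he : ∀ (p : SpringDimer.Param κ A) j k, ψ p.1.1 p.1.2.1 j (-k) = ψ p.1.1 p.1.2.1 j k :=
      fun p => (hsol _ _ p.2.1 p.2.2.1 p.2.2.2.1).even hd
    have he' : ∀ (p : SpringDimer.Param κ A) j k, ψ p.1.1 p.1.2.2 j (-k) = ψ p.1.1 p.1.2.2 j k :=
      fun p => (hsol _ _ p.2.1 p.2.2.1 p.2.2.2.2).even hd
    obtain ⟨C₁, hC₁, hn⟩ := SpringDimer.exists_hperNorm_le (fun _ => zero_le_one) hb he hr
    obtain ⟨C₂, hC₂, hn'⟩ := SpringDimer.exists_hperNorm_le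
      (x := fun (p : SpringDimer.Param κ A) j k => ψ p.1.1 p.1.2.1 j k - ψ p.1.1 p.1.2.2 j k)
      (fun p => abs_nonneg _) hl (fun p j k => by rw [he, he']) hr
    refine ⟨C₁ + C₂ + |C₀| + 1, by positivity, fun ε a h1 h2 h3 => ?_,
      fun ε a a' h1 h2 h3 h4 => ?_⟩
    · have e1 := hn ⟨(ε, a, a), h1, h2, h3, h3⟩
      have e2 := homLip ε a 0 h1 h2 h3 h0A
      have e3 : |C₀| * |a - 0| ≤ |C₀| * 1 := by
        rw [sub_zero]
        exact mul_le_mul_of_nonneg_left (h3.trans hA1) (abs_nonneg _)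
      dsimp only at e1
      linarith
    · have e1 := hn' ⟨(ε, a, a'), h1, h2, h3, h4⟩
      have e2 := homLip ε a a' h1 h2 h3 h4
      have e3 : (fun i y => SpringDimer.trigSeries (ψ ε a i) 0 y
          - SpringDimer.trigSeries (ψ ε a' i) 0 y)
          = fun i => SpringDimer.trigSeries (fun k => ψ ε a i k - ψ ε a' i k) 0 := by
        funext i y
        rw [SpringDimer.trigSeries_sub (hsum0 h1 h2 h3 i) (hsum0 h1 h2 h4 i)]
      rw [e3]
      dsimp only at e1
      nlinarith [abs_nonneg (a - a'), mul_nonneg hC₁ (abs_nonneg (a - a'))]
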